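/- Let $G$ be a finite group and let $\mathcal{E}$ be a Frobenius category, i.e. an exact category (in the sense of Quillen) with enough projectives and enough injectives in which projective and injective objects coincide. Let $\{F_g,\delta_{g,h}\}$ be an admissible (right) action of $G$ on $\mathcal{E}$: autoequivalences $F_g$ of $\mathcal{E}$ that preserve conflations and natural isomorphisms $\delta_{g,h}\colon F_gF_h\to F_{hg}$ satisfying the $2$-cocycle condition $\delta_{g,lh}\circ F_g\delta_{h,l}=\delta_{hg,l}\circ\delta_{g,h}F_l$. Suppose that $|G|$ is invertible in $\mathcal{E}$, i.e. for each morphism $f$ of $\mathcal{E}$ there is a unique morphism $f'$ with $|G|f'=f$. Let $\mathcal{E}^G$ be the category of equivariant objects $(A,\{\lambda_g\colon F_gA\overset{\cong}{\to}A\})$, $\lambda_g\circ F_g(\lambda_h)=\lambda_{hg}\circ\delta_{g,h,A}$, whose morphisms are the morphisms $f\colon A\to B$ of $\mathcal{E}$ with $\lambda^B_g\circ F_g(f)\circ(\lambda^A_g)^{-1}=f$ for all $g$, endowed with the exact structure whose conflations are the pairs of morphisms sent to conflations by the forgetful functor $\omega\colon\mathcal{E}^G\to\mathcal{E}$. If $\mathcal{E}$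 is idempotent-complete, then $\mathcal{E}^G$ has enough projectives and enough injectives. Suppose that $\mathcal{E}^G$ has enough projectives and enough injectives. Then $\mathcal{E}^G$ is a Frobenius category. For a Frobenius category $\mathcal{F}$ with chosen conflations $X\to \mathcal{I}X\to \mathcal{S}X$, $\mathcal{I}X$ injective, let $\underline{\mathcal{F}}$ be its stable category (morphisms modulo those that factor through an injective object), with translation functor $\mathcal{S}$; its exact triangles are those isomorphic to $X\overset{\bar u}{\to}Y\overset{\bar v}{\to}Z\overset{-\bar w}{\to}\mathcal{S}X$ for a conflation $X\overset{u}{\to}Y\overset{v}{\to}Z$ and a morphism $(\mathrm{Id}_X,b,w)$ from it to $X\to\mathcal{I}X\to\mathcal{S}X$. For any choice of these conflations, $\underline{\mathcal{E}}$ and $\underline{\mathcal{E}^G}$ are triangulated categories, and the following hold. 1. The induced $G$-action $\{\underline{F}_g,\underline{\delta}_{g,h}\}$ on $\underline{\mathcal{E}}$ is admissible: the $\underline{F}_g$ are exact autoequivalences whose induced commutating isomorphisms $\theta_g\colon\underline{F}_g\circ\mathcal{S}\to\mathcal{S}\circ\underline{F}_g$ (at $X$, the class of the third component of a morphism of conflations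 from $F_gX\to F_g\mathcal{I}X\to F_g\mathcal{S}X$ to $F_gX\to\mathcal{I}F_gX\to\mathcal{S}F_gX$ that is the identity on $F_gX$) are such that $\{\theta_g^{-1}\}$ makes $\mathcal{S}$ a $G$-equivariant functor. The category $\underline{\mathcal{E}}^G$ of equivariant objects of $\underline{\mathcal{E}}$, with the induced translation functor, admits a unique canonical triangulated structure, i.e. a unique class of exact triangles that makes it a triangulated category and the forgetful functor $\underline{\mathcal{E}}^G\to\underline{\mathcal{E}}$ exact. 2. The functor $\mathcal{E}^G\to\underline{\mathcal{E}}^G$ induced by the canonical functor $\mathcal{E}\to\underline{\mathcal{E}}$ factors through a functor $\underline{\mathcal{E}^G}\to\underline{\mathcal{E}}^G$. The latter is exact for the canonical triangulated structure and is an equivalence up to retracts, i.e. it is fully faithful and each object of the target is a retract of an object in its essential image. It is an equivalence if $\underline{\mathcal{E}^G}$ is idempotent-complete. -/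

import Mathlib

open CategoryTheory CategoryTheory.Limits

-- Without this line, hom types in a category may be elaborated through reflexive quivers.
attribute [-instance] CategoryTheory.catToReflQuiver

noncomputable section

namespace Equivariantization

universe v u v' u' w

/-! ### Group actions on additive categories and equivariant objects -/

/-- The integer `n` is invertible in `C`: division by `n` is uniquely possible in every
group of morphisms. -/
def InvertibleIn (n : ℕ) (C : Type u) [Category.{v} C] [Preadditive C] : Prop :=
  ∀ ⦃X Y : C⦄ (f : X ⟶ Y), ∃! g : X ⟶ Y, n • g = f

/-- A right action of a group `G` on a category: autoequivalences `F g` and natural isomorphisms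
`δ : F g ∘ F h ≅ F (h * g)` satisfying the 2-cocycle condition. In order to avoid transports along
the associativity of `G`, the isomorphism is indexed by `g`, `h` and any `k` with `h * g = k`. -/
structure RightAction (G : Type w) [Group G] (C : Type u) [Category.{v} C] where
  F : G → C ⥤ C
  isEquivalence : ∀ g, (F g).IsEquivalence
  δ : ∀ g h k : G, h * g = k → (F h ⋙ F g ≅ F k)
  cocycle : ∀ (g h l p q r : G) (h₁ : l * h = p) (h₂ : p * g = r) (h₃ : h * g = q)
    (h₄ : l * q = r) (A : C),
    (F g).map ((δ h l p h₁).hom.app A) ≫ (δ g p r h₂).hom.app A =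
      (δ g h q h₃).hom.app ((F l).obj A) ≫ (δ q l r h₄).hom.app A

section Action

variable {G : Type w} [Group G] {C : Type u} [Category.{v} C]

instance (a : RightAction G C) (g : G) : (a.F g).IsEquivalence := a.isEquivalence g

/-- The unit `Ξ : F 1 ≅ 𝟭` of the action, determined by `(F 1).map Ξ = δ 1 1`. -/
def RightAction.unit (a : RightAction G C) (A : C) : (a.F 1).obj A ≅ A :=
  (a.F 1).preimageIso ((a.δ 1 1 1 (one_mul 1)).app A)

/-- A `G`-equivariant object: an object `A` with isomorphisms `lam g : F g A ≅ A` such that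
`lam g ∘ F g (lam h) = lam (h * g) ∘ δ g h`. -/
structure EquivObj (a : RightAction G C) where
  obj : C
  lam : ∀ g, (a.F g).obj obj ≅ obj
  lam_mul : ∀ (g h k : G) (e : h * g = k),
    (a.F g).map (lam h).hom ≫ (lam g).hom = (a.δ g h k e).hom.app obj ≫ (lam k).hom

/-- A morphism of equivariant objects is a morphism that is invariant under the action
`f ↦ lam g ∘ F g (f) ∘ (lam g)⁻¹` of `G`. -/
@[ext]
structure EquivHom {a : RightAction G C} (X Y : EquivObj a) where
  hom : X.obj ⟶ Y.obj
  invariant : ∀ g, (X.lam g).inv ≫ (a.F g).map hom ≫ (Y.lam g).hom = hom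

theorem EquivHom.comm {a : RightAction G C} {X Y : EquivObj a} (f : EquivHom X Y) (g : G) :
    (a.F g).map f.hom ≫ (Y.lam g).hom = (X.lam g).hom ≫ f.hom := by
  rw [← Iso.inv_comp_eq]; exact f.invariant g

/-- Constructor for invariant morphisms through a commutative square. -/
def EquivHom.ofComm {a : RightAction G C} {X Y : EquivObj a} (f : X.obj ⟶ Y.obj)
    (h : ∀ g, (a.F g).map f ≫ (Y.lam g).hom = (X.lam g).hom ≫ f) : EquivHom X Y :=
  ⟨f, fun g => by rw [h g, Iso.inv_hom_id_assoc]⟩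

/-- The category `C^G` of equivariant objects. -/
instance (a : RightAction G C) : Category.{v} (EquivObj a) where
  Hom X Y := EquivHom X Y
  id X := EquivHom.ofComm (𝟙 _) (fun g => by simp)
  comp f g := EquivHom.ofComm (f.hom ≫ g.hom) (fun k => by
    rw [Functor.map_comp, Category.assoc, g.comm, ← Category.assoc, f.comm, Category.assoc])
  id_comp f := EquivHom.ext (Category.id_comp _)
  comp_id f := EquivHom.ext (Category.comp_id _)
  assoc f g h := EquivHom.ext (Category.assoc _ _ _)

variable {a : RightAction G C}

@[ext]
theorem EquivObj.hom_ext {X Y : EquivObj a} {f g : X ⟶ Y} (h : f.hom = g.hom) : f = g :=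
  EquivHom.ext h

@[simp] theorem EquivObj.id_hom (X : EquivObj a) : (𝟙 X : X ⟶ X).hom = 𝟙 X.obj := rfl

@[simp] theorem EquivObj.comp_hom {X Y Z : EquivObj a} (f : X ⟶ Y) (g : Y ⟶ Z) :
    (f ≫ g).hom = f.hom ≫ g.hom := rfl

/-- Constructor for morphisms of equivariant objects. -/
def EquivObj.homMk {X Y : EquivObj a} (f : X.obj ⟶ Y.obj)
    (h : ∀ g, (a.F g).map f ≫ (Y.lam g).hom = (X.lam g).hom ≫ f) : X ⟶ Y :=
  EquivHom.ofComm f h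

@[simp] theorem EquivObj.homMk_hom {X Y : EquivObj a} (f : X.obj ⟶ Y.obj)
    (h : ∀ g, (a.F g).map f ≫ (Y.lam g).hom = (X.lam g).hom ≫ f) :
    (EquivObj.homMk f h).hom = f := rfl

theorem EquivObj.comm {X Y : EquivObj a} (f : X ⟶ Y) (g : G) :
    (a.F g).map f.hom ≫ (Y.lam g).hom = (X.lam g).hom ≫ f.hom :=
  EquivHom.comm f g

variable (a) in
/-- The forgetful functor `ω : C^G ⥤ C`. -/
@[simps]
def forget : EquivObj a ⥤ C where
  obj X := X.obj
  map f := f.hom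

instance : (forget a).Faithful where
  map_injective h := EquivObj.hom_ext h

theorem EquivObj.isPullback {U Y Z Z' : EquivObj a} (p : U ⟶ Y) (q : U ⟶ Z') (d : Y ⟶ Z)
    (f : Z' ⟶ Z) (sq : IsPullback p.hom q.hom d.hom f.hom) : IsPullback p q d f := by
  refine ⟨⟨EquivObj.hom_ext sq.w⟩, ⟨PullbackCone.IsLimit.mk _
    (fun s => EquivObj.homMk (sq.lift s.fst.hom s.snd.hom
      (by rw [← EquivObj.comp_hom, ← EquivObj.comp_hom, s.condition])) (fun g => ?_)) ?_ ?_ ?_⟩⟩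
  · apply sq.hom_ext
    · rw [Category.assoc, ← EquivObj.comm p g, ← Functor.map_comp_assoc, sq.lift_fst,
        EquivObj.comm, Category.assoc, sq.lift_fst]
    · rw [Category.assoc, ← EquivObj.comm q g, ← Functor.map_comp_assoc, sq.lift_snd,
        EquivObj.comm, Category.assoc, sq.lift_snd]
  · exact fun s => EquivObj.hom_ext (sq.lift_fst _ _ _)
  · exact fun s => EquivObj.hom_ext (sq.lift_snd _ _ _)
  · exact fun s m h1 h2 => EquivObj.hom_ext (sq.hom_ext
      ((congrArg EquivHom.hom h1).trans (sq.lift_fst _ _ _).symm)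
      ((congrArg EquivHom.hom h2).trans (sq.lift_snd _ _ _).symm))

theorem EquivObj.isPushout {X X' Y U : EquivObj a} (i : X ⟶ Y) (h : X ⟶ X') (p : Y ⟶ U)
    (q : X' ⟶ U) (sq : IsPushout i.hom h.hom p.hom q.hom) : IsPushout i h p q := by
  refine ⟨⟨EquivObj.hom_ext sq.w⟩, ⟨PushoutCocone.IsColimit.mk _
    (fun s => EquivObj.homMk (sq.desc s.inl.hom s.inr.hom
      (by rw [← EquivObj.comp_hom, ← EquivObj.comp_hom, s.condition])) (fun g => ?_)) ?_ ?_ ?_⟩⟩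
  · apply (sq.map (a.F g)).hom_ext
    · rw [← Functor.map_comp_assoc, sq.inl_desc, EquivObj.comm,
        reassoc_of% (EquivObj.comm p g), sq.inl_desc]
    · rw [← Functor.map_comp_assoc, sq.inr_desc, EquivObj.comm,
        reassoc_of% (EquivObj.comm q g), sq.inr_desc]
  · exact fun s => EquivObj.hom_ext (sq.inl_desc _ _ _)
  · exact fun s => EquivObj.hom_ext (sq.inr_desc _ _ _)
  · exact fun s m h1 h2 => EquivObj.hom_ext (sq.hom_ext
      ((congrArg EquivHom.hom h1).trans (sq.inl_desc _ _ _).symm)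
      ((congrArg EquivHom.hom h2).trans (sq.inr_desc _ _ _).symm))

end Action

section Functors

variable {G : Type w} [Group G] {C : Type u} [Category.{v} C] {D : Type u'} [Category.{v'} D]

/-- The isomorphisms `φ g : F ∘ M g ≅ N g ∘ F` make the functor `F` a `G`-equivariant functor. -/
structure IsEquivariant (a : RightAction G C) (b : RightAction G D) (F : C ⥤ D)
    (φ : ∀ g, a.F g ⋙ F ≅ F ⋙ b.F g) : Prop where
  comp : ∀ (g h k : G) (e : h * g = k) (A : C),
    (φ g).hom.app ((a.F h).obj A) ≫ (b.F g).map ((φ h).hom.app A) ≫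
        (b.δ g h k e).hom.app (F.obj A) =
      F.map ((a.δ g h k e).hom.app A) ≫ (φ k).hom.app A
  unit : ∀ A : C, (φ 1).hom.app A ≫ (b.unit (F.obj A)).hom = F.map (a.unit A).hom

/-- The functor `F^G : C^G ⥤ D^G` induced by a `G`-equivariant functor `F`. -/
@[simps]
def IsEquivariant.functor {a : RightAction G C} {b : RightAction G D} {F : C ⥤ D}
    {φ : ∀ g, a.F g ⋙ F ≅ F ⋙ b.F g} (hφ : IsEquivariant a b F φ) :
    EquivObj a ⥤ EquivObj b where
  obj X :=
    { obj := F.obj X.obj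
      lam := fun g => ((φ g).app X.obj).symm ≪≫ F.mapIso (X.lam g)
      lam_mul := fun g h k e => by
        have h1 := hφ.comp g h k e X.obj
        have h2 := (φ g).hom.naturality (X.lam h).hom
        have h3 := congrArg (fun t => F.map t) (X.lam_mul g h k e)
        simp only [Functor.comp_map, Functor.map_comp, Functor.comp_obj] at h1 h2 h3
        simp only [Functor.comp_obj, Iso.trans_hom, Iso.symm_hom, Iso.app_inv, Functor.mapIso_hom,
          Functor.map_comp, Category.assoc]
        rw [← cancel_epi ((b.F g).map ((φ h).hom.app X.obj)), ← Functor.map_comp_assoc]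
        simp only [Functor.comp_obj, Iso.hom_inv_id_app, CategoryTheory.Functor.map_id, Category.id_comp]
        rw [← cancel_epi ((φ g).hom.app ((a.F h).obj X.obj))]
        simp only [Functor.comp_obj]
        rw [← reassoc_of% h2, Iso.hom_inv_id_app_assoc, h3, reassoc_of% h1,
          Iso.hom_inv_id_app_assoc] }
  map {X Y} f := EquivObj.homMk (F.map f.hom) (fun g => by
    have h2 := (φ g).inv.naturality f.hom
    have h3 := congrArg (fun t => F.map t) (EquivObj.comm f g)
    simp only [Functor.comp_map, Functor.map_comp] at h2 h3
    simp only [Functor.comp_obj, Iso.trans_hom, Iso.symm_hom, Iso.app_inv, Functor.mapIso_hom,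
          Category.assoc]
    rw [reassoc_of% h2, h3])

end Functors

section Additive

attribute [local instance] hasBinaryBiproducts_of_finite_biproducts

variable {G : Type w} [Group G] {C : Type u} [Category.{v} C] [Preadditive C]
  [HasFiniteBiproducts C]

/-- An autoequivalence of an additive category is additive. -/
instance (a : RightAction G C) (g : G) : (a.F g).Additive :=
  Functor.additive_of_preserves_binary_products _

variable {a : RightAction G C}

instance (X Y : EquivObj a) : Zero (X ⟶ Y) := ⟨EquivObj.homMk 0 (fun g => by simp)⟩

instance (X Y : EquivObj a) : Add (X ⟶ Y) :=
  ⟨fun f f' => EquivObj.homMk (f.hom + f'.hom) (fun g => by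
    rw [Functor.map_add, Preadditive.add_comp, Preadditive.comp_add, EquivObj.comm,
      EquivObj.comm])⟩

instance (X Y : EquivObj a) : Neg (X ⟶ Y) :=
  ⟨fun f => EquivObj.homMk (-f.hom) (fun g => by
    rw [Functor.map_neg, Preadditive.neg_comp, Preadditive.comp_neg, EquivObj.comm])⟩

instance (X Y : EquivObj a) : Sub (X ⟶ Y) :=
  ⟨fun f f' => EquivObj.homMk (f.hom - f'.hom) (fun g => by
    rw [Functor.map_sub, Preadditive.sub_comp, Preadditive.comp_sub, EquivObj.comm,
      EquivObj.comm])⟩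

instance (X Y : EquivObj a) : SMul ℕ (X ⟶ Y) :=
  ⟨fun n f => EquivObj.homMk (n • f.hom) (fun g => by
    rw [Functor.map_nsmul, Preadditive.nsmul_comp, Preadditive.comp_nsmul, EquivObj.comm])⟩

instance (X Y : EquivObj a) : SMul ℤ (X ⟶ Y) :=
  ⟨fun n f => EquivObj.homMk (n • f.hom) (fun g => by
    rw [Functor.map_zsmul, Preadditive.zsmul_comp, Preadditive.comp_zsmul, EquivObj.comm])⟩

instance : Preadditive (EquivObj a) where
  homGroup X Y := Function.Injective.addCommGroup (fun f : X ⟶ Y => f.hom)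
    (fun _ _ h => EquivObj.hom_ext h) rfl (fun _ _ => rfl) (fun _ => rfl) (fun _ _ => rfl)
    (fun _ _ => rfl) (fun _ _ => rfl)
  add_comp _ _ _ _ _ _ := EquivObj.hom_ext (Preadditive.add_comp _ _ _ _ _ _)
  comp_add _ _ _ _ _ _ := EquivObj.hom_ext (Preadditive.comp_add _ _ _ _ _ _)

@[simp] theorem EquivObj.zero_hom (X Y : EquivObj a) : (0 : X ⟶ Y).hom = 0 := rfl
@[simp] theorem EquivObj.add_hom {X Y : EquivObj a} (f f' : X ⟶ Y) :
    (f + f').hom = f.hom + f'.hom := rfl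

instance : (forget a).Additive where
  map_add := rfl

/-- Isomorphisms `lam g` which are compatible with two morphisms `p`, `q` that are jointly
monic, form an equivariant structure. -/
def EquivObj.ofMono (U : C) (lam : ∀ g, (a.F g).obj U ≅ U) (X Y : EquivObj a)
    (p : U ⟶ X.obj) (q : U ⟶ Y.obj)
    (hp : ∀ g, (a.F g).map p ≫ (X.lam g).hom = (lam g).hom ≫ p)
    (hq : ∀ g, (a.F g).map q ≫ (Y.lam g).hom = (lam g).hom ≫ q)
    (hm : ∀ ⦃W : C⦄ (s t : W ⟶ U), s ≫ p = t ≫ p → s ≫ q = t ≫ q → s = t) : EquivObj a where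
  obj := U
  lam := lam
  lam_mul := by
    have key : ∀ (Z : EquivObj a) (r : U ⟶ Z.obj)
        (_ : ∀ g, (a.F g).map r ≫ (Z.lam g).hom = (lam g).hom ≫ r) (g h k : G) (e : h * g = k),
        ((a.F g).map (lam h).hom ≫ (lam g).hom) ≫ r =
          ((a.δ g h k e).hom.app U ≫ (lam k).hom) ≫ r := by
      intro Z r hr g h k e
      have hn := (a.δ g h k e).hom.naturality r
      simp only [Functor.comp_map] at hn
      rw [Category.assoc, Category.assoc, ← hr g, ← hr k, ← Functor.map_comp_assoc, ← hr h,
        Functor.map_comp, Category.assoc, Z.lam_mul g h k e, ← reassoc_of% hn]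
    exact fun g h k e => hm _ _ (key X p hp g h k e) (key Y q hq g h k e)

/-- Isomorphisms `lam g` which are compatible with two morphisms `p`, `q` that are jointly
epic, form an equivariant structure. -/
def EquivObj.ofEpi (U : C) (lam : ∀ g, (a.F g).obj U ≅ U) (X Y : EquivObj a)
    (p : X.obj ⟶ U) (q : Y.obj ⟶ U)
    (hp : ∀ g, (a.F g).map p ≫ (lam g).hom = (X.lam g).hom ≫ p)
    (hq : ∀ g, (a.F g).map q ≫ (lam g).hom = (Y.lam g).hom ≫ q)
    (hm : ∀ (g h : G) ⦃W : C⦄ (s t : (a.F g).obj ((a.F h).obj U) ⟶ W),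
      (a.F g).map ((a.F h).map p) ≫ s = (a.F g).map ((a.F h).map p) ≫ t →
      (a.F g).map ((a.F h).map q) ≫ s = (a.F g).map ((a.F h).map q) ≫ t → s = t) :
    EquivObj a where
  obj := U
  lam := lam
  lam_mul := by
    have key : ∀ (Z : EquivObj a) (r : Z.obj ⟶ U)
        (_ : ∀ g, (a.F g).map r ≫ (lam g).hom = (Z.lam g).hom ≫ r) (g h k : G) (e : h * g = k),
        (a.F g).map ((a.F h).map r) ≫ ((a.F g).map (lam h).hom ≫ (lam g).hom) =
          (a.F g).map ((a.F h).map r) ≫ ((a.δ g h k e).hom.app U ≫ (lam k).hom) := by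
      intro Z r hr g h k e
      have hn := (a.δ g h k e).hom.naturality r
      simp only [Functor.comp_map] at hn
      rw [reassoc_of% hn, hr k, ← Functor.map_comp_assoc, hr h, Functor.map_comp, Category.assoc,
        hr g, reassoc_of% (Z.lam_mul g h k e)]
    exact fun g h k e => hm g h _ _ (key X p hp g h k e) (key Y q hq g h k e)

/-- The biproduct of two equivariant objects. -/
def EquivObj.sum (X Y : EquivObj a) : EquivObj a :=
  EquivObj.ofMono (X.obj ⊞ Y.obj)
    (fun g =>
      { hom := biprod.lift ((a.F g).map biprod.fst ≫ (X.lam g).hom)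
          ((a.F g).map biprod.snd ≫ (Y.lam g).hom)
        inv := biprod.desc ((X.lam g).inv ≫ (a.F g).map biprod.inl)
          ((Y.lam g).inv ≫ (a.F g).map biprod.inr)
        hom_inv_id := by
          rw [biprod.lift_desc]
          simp only [Category.assoc, Iso.hom_inv_id_assoc]
          rw [← Functor.map_comp, ← Functor.map_comp, ← Functor.map_add, biprod.total,
            CategoryTheory.Functor.map_id]
        inv_hom_id := by
          apply biprod.hom_ext' <;> apply biprod.hom_ext <;>
            simp [← Functor.map_comp_assoc] })
    X Y biprod.fst biprod.snd (fun g => by simp) (fun g => by simp)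
    (fun _ _ _ h h' => biprod.hom_ext _ _ h h')

instance : HasBinaryBiproducts (EquivObj a) where
  has_binary_biproduct X Y := hasBinaryBiproduct_of_total
    { pt := EquivObj.sum X Y
      fst := EquivObj.homMk biprod.fst (fun g => by simp [EquivObj.sum, EquivObj.ofMono])
      snd := EquivObj.homMk biprod.snd (fun g => by simp [EquivObj.sum, EquivObj.ofMono])
      inl := EquivObj.homMk biprod.inl (fun g => by
        apply biprod.hom_ext <;>
          simp [EquivObj.sum, EquivObj.ofMono, ← Functor.map_comp_assoc])
      inr := EquivObj.homMk biprod.inr (fun g => by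
        apply biprod.hom_ext <;>
          simp [EquivObj.sum, EquivObj.ofMono, ← Functor.map_comp_assoc])
      inl_fst := by ext; exact biprod.inl_fst
      inl_snd := by ext; exact biprod.inl_snd
      inr_fst := by ext; exact biprod.inr_fst
      inr_snd := by ext; exact biprod.inr_snd }
    (by ext; exact biprod.total)

open ZeroObject in
instance : HasZeroObject (EquivObj a) := by
  have hz : ∀ g, IsZero ((a.F g).obj (0 : C)) := fun g =>
    (a.F g).map_isZero (isZero_zero C)
  refine ⟨⟨(0 : C), fun g => (hz g).iso (isZero_zero C),
    fun g h k e => (isZero_zero C).eq_of_tgt _ _⟩, ?_⟩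
  exact (IsZero.iff_id_eq_zero _).2 (EquivObj.hom_ext ((isZero_zero C).eq_of_src _ _))

/-- `C^G` is additive. -/
instance : HasFiniteBiproducts (EquivObj a) :=
  have : HasTerminal (EquivObj a) := HasZeroObject.hasTerminal
  have : HasFiniteProducts (EquivObj a) := hasFiniteProducts_of_has_binary_and_terminal
  HasFiniteBiproducts.of_hasFiniteProducts

end Additive

/-! ### Exact categories -/

/-- A kernel-cokernel pair. -/
def IsKernelCokernelPair {C : Type u} [Category.{v} C] [Preadditive C] (S : ShortComplex C) :
    Prop :=
  Nonempty (IsLimit (KernelFork.ofι S.f S.zero)) ∧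
    Nonempty (IsColimit (CokernelCofork.ofπ S.g S.zero))

/-- The morphism `d` is the second morphism of a short complex in the class `P`. -/
def IsDeflationOf {C : Type u} [Category.{v} C] [Preadditive C] (P : ShortComplex C → Prop)
    {Y Z : C} (d : Y ⟶ Z) : Prop :=
  ∃ (X : C) (i : X ⟶ Y) (w : i ≫ d = 0), P (ShortComplex.mk i d w)

/-- The morphism `i` is the first morphism of a short complex in the class `P`. -/
def IsInflationOf {C : Type u} [Category.{v} C] [Preadditive C] (P : ShortComplex C → Prop)
    {X Y : C} (i : X ⟶ Y) : Prop :=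
  ∃ (Z : C) (d : Y ⟶ Z) (w : i ≫ d = 0), P (ShortComplex.mk i d w)

/-- An exact structure on an additive category (in the sense of Quillen, with Keller's axioms):
a class of kernel-cokernel pairs, the conflations. -/
structure ExactStructure (C : Type u) [Category.{v} C] [Preadditive C] [HasFiniteBiproducts C] where
  conflation : ShortComplex C → Prop
  isKernelCokernelPair : ∀ S, conflation S → IsKernelCokernelPair S
  of_iso : ∀ S S' : ShortComplex C, (S ≅ S') → conflation S → conflation S'
  ex0 : ∀ Z : C, IsZero Z → IsDeflationOf conflation (𝟙 Z)
  ex1 : ∀ ⦃X Y Z : C⦄ (d : X ⟶ Y) (d' : Y ⟶ Z), IsDeflationOf conflation d →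
    IsDeflationOf conflation d' → IsDeflationOf conflation (d ≫ d')
  ex2 : ∀ ⦃Y Z Z' : C⦄ (f : Z' ⟶ Z) (d : Y ⟶ Z), IsDeflationOf conflation d →
    ∃ (Y' : C) (f' : Y' ⟶ Y) (d' : Y' ⟶ Z'), IsPullback f' d' d f ∧
      IsDeflationOf conflation d'
  ex2op : ∀ ⦃X X' Y : C⦄ (h : X ⟶ X') (i : X ⟶ Y), IsInflationOf conflation i →
    ∃ (Y' : C) (h' : Y ⟶ Y') (i' : X' ⟶ Y'), IsPushout i h h' i' ∧
      IsInflationOf conflation i'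

namespace ExactStructure

variable {C : Type u} [Category.{v} C] [Preadditive C] [HasFiniteBiproducts C]
  (ex : ExactStructure C)

/-- Deflations. -/
def Deflation {Y Z : C} (d : Y ⟶ Z) : Prop := IsDeflationOf ex.conflation d

/-- Inflations. -/
def Inflation {X Y : C} (i : X ⟶ Y) : Prop := IsInflationOf ex.conflation i

/-- Projective objects of an exact category. -/
def IsProjective (P : C) : Prop :=
  ∀ ⦃X Y : C⦄ (d : X ⟶ Y) (f : P ⟶ Y), ex.Deflation d → ∃ t : P ⟶ X, t ≫ d = f

/-- Injective objects of an exact category. -/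
def IsInjective (I : C) : Prop :=
  ∀ ⦃X Y : C⦄ (i : X ⟶ Y) (f : X ⟶ I), ex.Inflation i → ∃ t : Y ⟶ I, i ≫ t = f

/-- Each object `E` admits a deflation `P ⟶ E` with `P` projective. -/
def EnoughProjectives : Prop :=
  ∀ E : C, ∃ (P : C) (d : P ⟶ E), ex.IsProjective P ∧ ex.Deflation d

/-- Each object `E` admits an inflation `E ⟶ I` with `I` injective. -/
def EnoughInjectives : Prop :=
  ∀ E : C, ∃ (I : C) (i : E ⟶ I), ex.IsInjective I ∧ ex.Inflation i

/-- Frobenius categories. -/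
structure IsFrobenius : Prop where
  enoughProjectives : ex.EnoughProjectives
  enoughInjectives : ex.EnoughInjectives
  projective_iff_injective : ∀ X : C, ex.IsProjective X ↔ ex.IsInjective X

variable {ex}

theorem epi_g {S : ShortComplex C} (hS : ex.conflation S) : Epi S.g := by
  obtain ⟨h⟩ := (ex.isKernelCokernelPair S hS).2
  exact epi_of_isColimit_cofork h

theorem mono_f {S : ShortComplex C} (hS : ex.conflation S) : Mono S.f := by
  obtain ⟨h⟩ := (ex.isKernelCokernelPair S hS).1
  exact mono_of_isLimit_fork h

theorem exists_desc {S : ShortComplex C} (hS : ex.conflation S) {W : C} (b : S.X₂ ⟶ W)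
    (hb : S.f ≫ b = 0) : ∃ k : S.X₃ ⟶ W, S.g ≫ k = b := by
  obtain ⟨h⟩ := (ex.isKernelCokernelPair S hS).2
  exact ⟨_, (CokernelCofork.IsColimit.desc' h b hb).2⟩

theorem exists_lift {S : ShortComplex C} (hS : ex.conflation S) {W : C} (b : W ⟶ S.X₂)
    (hb : b ≫ S.g = 0) : ∃ k : W ⟶ S.X₁, k ≫ S.f = b := by
  obtain ⟨h⟩ := (ex.isKernelCokernelPair S hS).1
  exact ⟨_, (KernelFork.IsLimit.lift' h b hb).2⟩

end ExactStructure

section AdmissibleExact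

variable {G : Type w} [Group G] {C : Type u} [Category.{v} C] [Preadditive C]
  [HasFiniteBiproducts C]

/-- An action on an exact category is admissible if each `F g` preserves conflations. -/
def RightAction.IsAdmissible (a : RightAction G C) (ex : ExactStructure C) : Prop :=
  ∀ (g : G) (S : ShortComplex C), ex.conflation S → ex.conflation (S.map (a.F g))

variable {a : RightAction G C} {ex : ExactStructure C}

/-- The class of conflations of `C^G`: those pairs of morphisms whose images in `C` are
conflations. -/
def equivConflation (a : RightAction G C) (ex : ExactStructure C)
    (S : ShortComplex (EquivObj a)) : Prop :=
  ex.conflation (S.map (forget a))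

theorem equivConflation_pair (S : ShortComplex (EquivObj a)) (hS : equivConflation a ex S)
    (ha : a.IsAdmissible ex) : IsKernelCokernelPair S := by
  have hm : Mono S.f.hom := ExactStructure.mono_f hS
  have he : Epi S.g.hom := ExactStructure.epi_g hS
  have hm' : Mono S.f := (forget a).mono_of_mono_map hm
  have he' : Epi S.g := (forget a).epi_of_epi_map he
  refine ⟨⟨KernelFork.IsLimit.ofι' _ _ fun {W} k hk => ?_⟩,
    ⟨CokernelCofork.IsColimit.ofπ' _ _ fun {W} k hk => ?_⟩⟩
  · have h : ∃ t : W.obj ⟶ S.X₁.obj, t ≫ S.f.hom = k.hom :=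
      ExactStructure.exists_lift hS k.hom (congrArg EquivHom.hom hk)
    exact ⟨EquivObj.homMk h.choose (fun g => by
        have h1 : h.choose ≫ S.f.hom = k.hom := h.choose_spec
        rw [← cancel_mono S.f.hom, Category.assoc, Category.assoc, h1, ← EquivObj.comm k,
          ← EquivObj.comm S.f, ← Functor.map_comp_assoc, h1]),
      EquivObj.hom_ext h.choose_spec⟩
  · have h : ∃ t : S.X₃.obj ⟶ W.obj, S.g.hom ≫ t = k.hom :=
      ExactStructure.exists_desc hS k.hom (congrArg EquivHom.hom hk)
    exact ⟨EquivObj.homMk h.choose (fun g => by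
        have h1 : S.g.hom ≫ h.choose = k.hom := h.choose_spec
        have he' : Epi ((a.F g).map S.g.hom) := ExactStructure.epi_g (ha g _ hS)
        rw [← cancel_epi ((a.F g).map S.g.hom), ← Functor.map_comp_assoc, h1,
          reassoc_of% (EquivObj.comm S.g g), h1, EquivObj.comm k]),
      EquivObj.hom_ext h.choose_spec⟩

theorem equiv_deflation {Y Z : EquivObj a} (d : Y ⟶ Z) (hd : ex.Deflation d.hom)
    (ha : a.IsAdmissible ex) : IsDeflationOf (equivConflation a ex) d := by
  obtain ⟨X, i, w, hS⟩ := hd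
  have hi : Mono i := ExactStructure.mono_f hS
  have hi' : ∀ g, Mono ((a.F g).map i) := fun g => ExactStructure.mono_f (ha g _ hS)
  have h1 : ∀ g, ∃ t : (a.F g).obj X ⟶ X, t ≫ i = (a.F g).map i ≫ (Y.lam g).hom := fun g =>
    ExactStructure.exists_lift hS _ (by
      rw [Category.assoc, ← EquivObj.comm d g, ← Functor.map_comp_assoc, w, Functor.map_zero,
        zero_comp])
  have h2 : ∀ g, ∃ t : X ⟶ (a.F g).obj X, t ≫ (a.F g).map i = i ≫ (Y.lam g).inv := fun g =>
    ExactStructure.exists_lift (ha g _ hS) (i ≫ (Y.lam g).inv) (by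
      change (i ≫ (Y.lam g).inv) ≫ (a.F g).map d.hom = 0
      rw [← cancel_mono (Z.lam g).hom, Category.assoc, Category.assoc, EquivObj.comm d g,
        Iso.inv_hom_id_assoc, w, zero_comp])
  choose t ht using h1
  choose s hs using h2
  let X' : EquivObj a := EquivObj.ofMono X
    (fun g => ⟨t g, s g, by
      rw [← cancel_mono ((a.F g).map i), Category.assoc, hs, reassoc_of% (ht g)]; simp, by
      rw [← cancel_mono i, Category.assoc, ht, reassoc_of% (hs g)]; simp⟩)
    Y Y i i (fun g => (ht g).symm) (fun g => (ht g).symm)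
    (fun W s t h _ => by rwa [cancel_mono] at h)
  exact ⟨X', EquivObj.homMk i (fun g => (ht g).symm), EquivObj.hom_ext w, hS⟩

theorem equiv_inflation {X Y : EquivObj a} (i : X ⟶ Y) (hi : ex.Inflation i.hom)
    (ha : a.IsAdmissible ex) : IsInflationOf (equivConflation a ex) i := by
  obtain ⟨Z, d, w, hS⟩ := hi
  have hd : Epi d := ExactStructure.epi_g hS
  have hd' : ∀ g, Epi ((a.F g).map d) := fun g => ExactStructure.epi_g (ha g _ hS)
  have h1 : ∀ g, ∃ t : (a.F g).obj Z ⟶ Z, (a.F g).map d ≫ t = (Y.lam g).hom ≫ d := fun g =>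
    ExactStructure.exists_desc (ha g _ hS) ((Y.lam g).hom ≫ d) (by
      change (a.F g).map i.hom ≫ (Y.lam g).hom ≫ d = 0
      rw [reassoc_of% (EquivObj.comm i g), w, comp_zero])
  have h2 : ∀ g, ∃ t : Z ⟶ (a.F g).obj Z, d ≫ t = (Y.lam g).inv ≫ (a.F g).map d := fun g =>
    ExactStructure.exists_desc hS ((Y.lam g).inv ≫ (a.F g).map d) (by
      change i.hom ≫ (Y.lam g).inv ≫ (a.F g).map d = 0
      rw [← cancel_epi (X.lam g).hom, ← reassoc_of% (EquivObj.comm i g), Iso.hom_inv_id_assoc,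
        ← Functor.map_comp, w, Functor.map_zero, comp_zero])
  choose t ht using h1
  choose s hs using h2
  let Z' : EquivObj a := EquivObj.ofEpi Z
    (fun g => ⟨t g, s g, by
      rw [← cancel_epi ((a.F g).map d), reassoc_of% (ht g), hs]; simp, by
      rw [← cancel_epi d, reassoc_of% (hs g), ht]; simp⟩)
    Y Y d d ht ht
    (fun g h W s t e _ => by rwa [cancel_epi] at e)
  exact ⟨Z', EquivObj.homMk d ht, EquivObj.hom_ext w, hS⟩

/-- The exact structure on `C^G` for which a pair of morphisms is a conflation if and only if its
image in `C` is: it is the largest one for which the forgetful functor is exact. -/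
def equivExact (ex : ExactStructure C) (a : RightAction G C) (ha : a.IsAdmissible ex) :
    ExactStructure (EquivObj a) where
  conflation := equivConflation a ex
  isKernelCokernelPair S hS := equivConflation_pair S hS ha
  of_iso S S' e hS := ex.of_iso _ _ ((forget a).mapShortComplex.mapIso e) hS
  ex0 Z hZ := equiv_deflation _ (ex.ex0 _ ((forget a).map_isZero hZ)) ha
  ex1 X Y Z d d' hd hd' := by
    refine equiv_deflation _ (ex.ex1 d.hom d'.hom ?_ ?_) ha
    · obtain ⟨K, i, w, h⟩ := hd
      exact ⟨K.obj, i.hom, congrArg EquivHom.hom w, h⟩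
    · obtain ⟨K, i, w, h⟩ := hd'
      exact ⟨K.obj, i.hom, congrArg EquivHom.hom w, h⟩
  ex2 Y Z Z' f d hd := by
    obtain ⟨K, i, w, h⟩ := hd
    obtain ⟨U, f', d', sq, hd'⟩ :=
      ex.ex2 f.hom d.hom ⟨K.obj, i.hom, congrArg EquivHom.hom w, h⟩
    have sq' : ∀ g, IsPullback ((a.F g).map f') ((a.F g).map d') ((a.F g).map d.hom)
      ((a.F g).map f.hom) := fun g => sq.map (a.F g)
    have e1 : ∀ g, ((a.F g).map f' ≫ (Y.lam g).hom) ≫ d.hom =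
        ((a.F g).map d' ≫ (Z'.lam g).hom) ≫ f.hom := fun g => by
      rw [Category.assoc, Category.assoc, ← EquivObj.comm d g, ← EquivObj.comm f g,
        ← Functor.map_comp_assoc, ← Functor.map_comp_assoc, sq.w]
    have e2 : ∀ g, (f' ≫ (Y.lam g).inv) ≫ (a.F g).map d.hom =
        (d' ≫ (Z'.lam g).inv) ≫ (a.F g).map f.hom := fun g => by
      rw [← cancel_mono (Z.lam g).hom]
      simp only [Category.assoc, EquivObj.comm, Iso.inv_hom_id_assoc]
      exact sq.w
    let U' : EquivObj a := EquivObj.ofMono U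
      (fun g => ⟨sq.lift _ _ (e1 g), (sq' g).lift _ _ (e2 g),
        by apply (sq' g).hom_ext <;> simp, by apply sq.hom_ext <;> simp⟩)
      Y Z' f' d' (fun g => by simp) (fun g => by simp) (fun W s t h h' => sq.hom_ext h h')
    let p : U' ⟶ Y := EquivObj.homMk f' (fun g => by simp [U', EquivObj.ofMono])
    let q : U' ⟶ Z' := EquivObj.homMk d' (fun g => by simp [U', EquivObj.ofMono])
    exact ⟨U', p, q, EquivObj.isPullback p q d f sq, equiv_deflation q hd' ha⟩
  ex2op X X' Y h i hi := by
    obtain ⟨K, d, w, hS⟩ := hi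
    obtain ⟨U, h', i', sq, hi'⟩ :=
      ex.ex2op h.hom i.hom ⟨K.obj, d.hom, congrArg EquivHom.hom w, hS⟩
    have sq' : ∀ g, IsPushout ((a.F g).map i.hom) ((a.F g).map h.hom) ((a.F g).map h')
      ((a.F g).map i') := fun g => sq.map (a.F g)
    have e1 : ∀ g, (a.F g).map i.hom ≫ (Y.lam g).hom ≫ h' =
        (a.F g).map h.hom ≫ (X'.lam g).hom ≫ i' := fun g => by
      rw [reassoc_of% (EquivObj.comm i g), reassoc_of% (EquivObj.comm h g), sq.w]
    have e2 : ∀ g, i.hom ≫ (Y.lam g).inv ≫ (a.F g).map h' =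
        h.hom ≫ (X'.lam g).inv ≫ (a.F g).map i' := fun g => by
      rw [← cancel_epi (X.lam g).hom, ← reassoc_of% (EquivObj.comm i g),
        ← reassoc_of% (EquivObj.comm h g), Iso.hom_inv_id_assoc, Iso.hom_inv_id_assoc, (sq' g).w]
    let U' : EquivObj a := EquivObj.ofEpi U
      (fun g => ⟨(sq' g).desc _ _ (e1 g), sq.desc _ _ (e2 g),
        by apply (sq' g).hom_ext <;> simp, by apply sq.hom_ext <;> simp⟩)
      Y X' h' i' (fun g => by simp) (fun g => by simp)
      (fun g h W s t h1 h2 => ((sq' h).map (a.F g)).hom_ext h1 h2)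
    let p : Y ⟶ U' := EquivObj.homMk h' (fun g => by simp [U', EquivObj.ofEpi])
    let q : X' ⟶ U' := EquivObj.homMk i' (fun g => by simp [U', EquivObj.ofEpi])
    exact ⟨U', p, q, EquivObj.isPushout i h p q sq, equiv_inflation q hi' ha⟩

end AdmissibleExact

/-! ### The stable category -/

namespace ExactStructure

attribute [local instance] hasBinaryBiproducts_of_finite_biproducts

variable {C : Type u} [Category.{v} C] [Preadditive C] [HasFiniteBiproducts C]
  (ex : ExactStructure C)

/-- The morphism `f` factors through an injective object. -/
def FactorsInj {X Y : C} (f : X ⟶ Y) : Prop :=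
  ∃ (I : C) (p : X ⟶ I) (q : I ⟶ Y), ex.IsInjective I ∧ p ≫ q = f

variable {ex}

theorem IsInjective.biprod {I J : C} (hI : ex.IsInjective I) (hJ : ex.IsInjective J) :
    ex.IsInjective (I ⊞ J) := fun X Y i f hi => by
  obtain ⟨s, hs⟩ := hI i (f ≫ biprod.fst) hi
  obtain ⟨t, ht⟩ := hJ i (f ≫ biprod.snd) hi
  exact ⟨biprod.lift s t, by apply biprod.hom_ext <;> simp [hs, ht]⟩

theorem IsInjective.of_iso {I J : C} (hI : ex.IsInjective I) (e : I ≅ J) : ex.IsInjective J :=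
  fun X Y i f hi => by
    obtain ⟨s, hs⟩ := hI i (f ≫ e.inv) hi
    exact ⟨s ≫ e.hom, by rw [reassoc_of% hs, e.inv_hom_id, Category.comp_id]⟩

theorem FactorsInj.add {X Y : C} {f f' : X ⟶ Y} (h : ex.FactorsInj f) (h' : ex.FactorsInj f') :
    ex.FactorsInj (f + f') := by
  obtain ⟨I, p, q, hI, rfl⟩ := h
  obtain ⟨J, p', q', hJ, rfl⟩ := h'
  exact ⟨I ⊞ J, biprod.lift p p', biprod.desc q q', hI.biprod hJ, biprod.lift_desc⟩

theorem FactorsInj.neg {X Y : C} {f : X ⟶ Y} (h : ex.FactorsInj f) : ex.FactorsInj (-f) := by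
  obtain ⟨I, p, q, hI, rfl⟩ := h
  exact ⟨I, p, -q, hI, by simp⟩

open ZeroObject in
variable (ex) in
theorem FactorsInj.zero (X Y : C) : ex.FactorsInj (0 : X ⟶ Y) :=
  ⟨0, 0, 0, fun _ _ _ _ _ => ⟨0, (isZero_zero C).eq_of_tgt _ _⟩, by simp⟩

theorem FactorsInj.comp {W X Y Z : C} (l : W ⟶ X) {f : X ⟶ Y} (h : ex.FactorsInj f)
    (r : Y ⟶ Z) : ex.FactorsInj (l ≫ f ≫ r) := by
  obtain ⟨I, p, q, hI, rfl⟩ := h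
  exact ⟨I, l ≫ p, q ≫ r, hI, by simp⟩

variable (ex)

/-- Two parallel morphisms are identified in the stable category if their difference factors
through an injective object. -/
def stableRel : HomRel C := fun _ _ f f' => ex.FactorsInj (f - f')

instance : Congruence ex.stableRel where
  comp_left f g g' h := by
    change ex.FactorsInj _
    simpa [stableRel, ← Preadditive.comp_sub] using FactorsInj.comp f h (𝟙 _)
  comp_right g h := by
    change ex.FactorsInj _
    simpa [stableRel, ← Preadditive.sub_comp] using FactorsInj.comp (𝟙 _) h g
  equivalence :=
    { refl := fun f => by simpa [stableRel] using FactorsInj.zero ex _ _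
      symm := fun h => by simpa [stableRel] using FactorsInj.neg h
      trans := fun h h' => by simpa [stableRel] using FactorsInj.add h h' }

/-- The stable category: the objects are those of `C`, and `Hom(X, Y)` is the quotient of the
group of morphisms in `C` by the subgroup of those which factor through an injective object. -/
abbrev Stable := CategoryTheory.Quotient ex.stableRel

/-- The canonical functor from `C` to its stable category. -/
abbrev toStable : C ⥤ ex.Stable := CategoryTheory.Quotient.functor ex.stableRel

theorem stableRel_add ⦃X Y : C⦄ (f₁ f₂ g₁ g₂ : X ⟶ Y) (h : ex.stableRel f₁ f₂)
    (h' : ex.stableRel g₁ g₂) : ex.stableRel (f₁ + g₁) (f₂ + g₂) := by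
  change ex.FactorsInj _
  rw [add_sub_add_comm]
  exact FactorsInj.add h h'

instance : Preadditive ex.Stable := CategoryTheory.Quotient.preadditive _ ex.stableRel_add

instance : ex.toStable.Additive := CategoryTheory.Quotient.functor_additive _ ex.stableRel_add

/-- The stable category is additive. -/
instance : HasFiniteBiproducts ex.Stable where
  out n := ⟨fun F => by
    have := HasBiproductsOfShape.has_biproduct (C := C) (J := Fin n) (fun j => (F j).as)
    exact HasBiproduct.mk
      { bicone := ex.toStable.mapBicone (biproduct.bicone fun j => (F j).as)
        isBilimit := isBilimitOfPreserves ex.toStable (biproduct.isBilimit fun j => (F j).as) }⟩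

variable {ex}

theorem toStable_eq_zero_iff {X Y : C} (f : X ⟶ Y) :
    ex.toStable.map f = 0 ↔ ex.FactorsInj f := by
  rw [← ex.toStable.map_zero, CategoryTheory.Quotient.functor_map_eq_iff]
  simp [stableRel]

/-- If a morphism of conflations, the second of which has an injective middle term, is stably zero
on the left, then it is stably zero on the right. -/
theorem factorsInj_τ₃ {S₁ S₂ : ShortComplex C} (h₁ : ex.conflation S₁)
    (hI : ex.IsInjective S₂.X₂) (φ : S₁ ⟶ S₂) (hφ : ex.FactorsInj φ.τ₁) :
    ex.FactorsInj φ.τ₃ := by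
  obtain ⟨J, p, q, hJ, hpq⟩ := hφ
  obtain ⟨t, ht⟩ := hJ S₁.f p ⟨_, S₁.g, S₁.zero, h₁⟩
  obtain ⟨k, hk⟩ := exists_desc h₁ (φ.τ₂ - t ≫ q ≫ S₂.f) (by
    rw [Preadditive.comp_sub, ← φ.comm₁₂, ← hpq, reassoc_of% ht, Category.assoc, sub_self])
  have := epi_g h₁
  refine ⟨S₂.X₂, k, S₂.g, hI, ?_⟩
  rw [← cancel_epi S₁.g, reassoc_of% hk, ← φ.comm₂₃]
  simp

theorem toStable_τ₃_eq {S₁ S₂ : ShortComplex C} (h₁ : ex.conflation S₁)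
    (hI : ex.IsInjective S₂.X₂) (φ ψ : S₁ ⟶ S₂)
    (h : ex.toStable.map φ.τ₁ = ex.toStable.map ψ.τ₁) :
    ex.toStable.map φ.τ₃ = ex.toStable.map ψ.τ₃ := by
  rw [CategoryTheory.Quotient.functor_map_eq_iff] at h ⊢
  exact factorsInj_τ₃ h₁ hI (φ - ψ) h

/-- A morphism between the left terms of conflations extends to the conflations, if the middle term
of the second one is injective. -/
theorem exists_extension {S₁ S₂ : ShortComplex C} (h₁ : ex.conflation S₁)
    (hI : ex.IsInjective S₂.X₂) (f : S₁.X₁ ⟶ S₂.X₁) : ∃ φ : S₁ ⟶ S₂, φ.τ₁ = f := by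
  obtain ⟨b, hb⟩ := hI S₁.f (f ≫ S₂.f) ⟨_, S₁.g, S₁.zero, h₁⟩
  obtain ⟨c, hc⟩ := exists_desc h₁ (b ≫ S₂.g) (by rw [reassoc_of% hb, S₂.zero, comp_zero])
  exact ⟨ShortComplex.homMk f b c hb.symm hc.symm, rfl⟩

variable (ex)

/-- A choice of a conflation `X ⟶ I X ⟶ S X` with `I X` injective for each object `X`. -/
structure Choice where
  I : C → C
  S : C → C
  ι : ∀ X, X ⟶ I X
  π : ∀ X, I X ⟶ S X
  zero : ∀ X, ι X ≫ π X = 0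
  conflation : ∀ X, ex.conflation (ShortComplex.mk (ι X) (π X) (zero X))
  injective : ∀ X, ex.IsInjective (I X)

variable {ex}

theorem EnoughInjectives.nonempty_choice (h : ex.EnoughInjectives) : Nonempty ex.Choice := by
  choose I i hI Z d w hS using h
  exact ⟨⟨I, Z, i, d, w, hS, hI⟩⟩

namespace Choice

variable (c : ex.Choice)

/-- The chosen conflation `X ⟶ I X ⟶ S X`. -/
abbrev sc (X : C) : ShortComplex C := ShortComplex.mk (c.ι X) (c.π X) (c.zero X)

/-- Some extension of a morphism to the chosen conflations. -/
def ext {X Y : C} (f : X ⟶ Y) : c.sc X ⟶ c.sc Y :=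
  (exists_extension (S₁ := c.sc X) (S₂ := c.sc Y) (c.conflation X) (c.injective Y) f).choose

theorem ext_τ₁ {X Y : C} (f : X ⟶ Y) : (c.ext f).τ₁ = f :=
  (exists_extension (S₁ := c.sc X) (S₂ := c.sc Y) (c.conflation X) (c.injective Y) f).choose_spec

/-- The translation functor of the stable category: the class of `f : X ⟶ Y` is sent to the class
of the third component of any extension of `f` to a morphism between the chosen conflations. -/
def susp : ex.Stable ⥤ ex.Stable :=
  CategoryTheory.Quotient.lift _
    { obj := fun X => ex.toStable.obj (c.S X)
      map := fun f => ex.toStable.map (c.ext f).τ₃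
      map_id := fun X => (toStable_τ₃_eq (c.conflation X) (c.injective X) (c.ext (𝟙 X)) (𝟙 _)
        (by rw [ext_τ₁]; rfl)).trans (ex.toStable.map_id _)
      map_comp := fun {X Y Z} f g => (toStable_τ₃_eq (c.conflation X) (c.injective Z)
        (c.ext (f ≫ g)) (c.ext f ≫ c.ext g)
        (by rw [ext_τ₁, ShortComplex.comp_τ₁, ext_τ₁, ext_τ₁])).trans (ex.toStable.map_comp _ _) }
    (fun X Y f f' h => toStable_τ₃_eq (c.conflation X) (c.injective Y) (c.ext f) (c.ext f') (by
      rw [ext_τ₁, ext_τ₁]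
      exact CategoryTheory.Quotient.sound _ h))

theorem susp_map {X Y : C} (φ : c.sc X ⟶ c.sc Y) :
    c.susp.map (ex.toStable.map φ.τ₁) = ex.toStable.map φ.τ₃ :=
  toStable_τ₃_eq (c.conflation X) (c.injective Y) (c.ext φ.τ₁) φ (by rw [ext_τ₁])

end Choice

end ExactStructure

/-! ### Triangulated categories -/

section Triangulated

/-- A triangle `X ⟶ Y ⟶ Z ⟶ T X` with respect to a translation functor `T`. -/
structure Tri {D : Type u} [Category.{v} D] (T : D ⥤ D) where
  {X : D}
  {Y : D}
  {Z : D}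
  f : X ⟶ Y
  g : Y ⟶ Z
  h : Z ⟶ T.obj X

/-- Isomorphic triangles. -/
def Tri.Isomorphic {D : Type u} [Category.{v} D] {T : D ⥤ D} (t t' : Tri T) : Prop :=
  ∃ (a : t.X ≅ t'.X) (b : t.Y ≅ t'.Y) (c : t.Z ≅ t'.Z),
    t.f ≫ b.hom = a.hom ≫ t'.f ∧ t.g ≫ c.hom = b.hom ≫ t'.g ∧
      t.h ≫ T.map a.hom = c.hom ≫ t'.h

/-- The class `Δ` of triangles, called exact triangles, makes `D` a pretriangulated category with
translation functor `T`: `D` is additive, `T` is an additive autoequivalence and the axioms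
(TR1), (TR2) and (TR3) hold. -/
structure IsPretriangulatedStructure {D : Type u} [Category.{v} D] [Preadditive D] (T : D ⥤ D)
    (Δ : Set (Tri T)) : Prop where
  hasFiniteBiproducts : HasFiniteBiproducts D
  isEquivalence : T.IsEquivalence
  additive : T.Additive
  of_isomorphic : ∀ t t' : Tri T, t.Isomorphic t' → t ∈ Δ → t' ∈ Δ
  contractible : ∀ X Z : D, IsZero Z → Tri.mk (𝟙 X) (0 : X ⟶ Z) 0 ∈ Δ
  exists_cone : ∀ ⦃X Y : D⦄ (f : X ⟶ Y), ∃ (Z : D) (g : Y ⟶ Z) (h : Z ⟶ T.obj X),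
    Tri.mk f g h ∈ Δ
  rotate_iff : ∀ t : Tri T, t ∈ Δ ↔ Tri.mk t.g t.h (-T.map t.f) ∈ Δ
  complete : ∀ t t' : Tri T, t ∈ Δ → t' ∈ Δ → ∀ (a : t.X ⟶ t'.X) (b : t.Y ⟶ t'.Y),
    t.f ≫ b = a ≫ t'.f →
      ∃ c : t.Z ⟶ t'.Z, t.g ≫ c = b ≫ t'.g ∧ t.h ≫ T.map a = c ≫ t'.h

/-- Triangulated categories: the octahedral axiom (TR4) holds as well. -/
structure IsTriangulatedStructure {D : Type u} [Category.{v} D] [Preadditive D] (T : D ⥤ D)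
    (Δ : Set (Tri T)) : Prop extends IsPretriangulatedStructure T Δ where
  octahedron : ∀ ⦃X₁ X₂ X₃ Z₁₂ Z₂₃ Z₁₃ : D⦄ (u₁₂ : X₁ ⟶ X₂) (u₂₃ : X₂ ⟶ X₃)
    (v₁₂ : X₂ ⟶ Z₁₂) (w₁₂ : Z₁₂ ⟶ T.obj X₁) (v₂₃ : X₃ ⟶ Z₂₃) (w₂₃ : Z₂₃ ⟶ T.obj X₂)
    (v₁₃ : X₃ ⟶ Z₁₃) (w₁₃ : Z₁₃ ⟶ T.obj X₁),
    Tri.mk u₁₂ v₁₂ w₁₂ ∈ Δ → Tri.mk u₂₃ v₂₃ w₂₃ ∈ Δ → Tri.mk (u₁₂ ≫ u₂₃) v₁₃ w₁₃ ∈ Δ →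
      ∃ (m₁ : Z₁₂ ⟶ Z₁₃) (m₃ : Z₁₃ ⟶ Z₂₃), v₁₂ ≫ m₁ = u₂₃ ≫ v₁₃ ∧ m₁ ≫ w₁₃ = w₁₂ ∧
        v₁₃ ≫ m₃ = v₂₃ ∧ w₁₃ ≫ T.map u₁₂ = m₃ ≫ w₂₃ ∧
        Tri.mk m₁ m₃ (w₂₃ ≫ T.map v₁₂) ∈ Δ

/-- An additive functor `F` with a commutating isomorphism `ξ : F ∘ T ≅ T' ∘ F` is exact if it
sends exact triangles to exact triangles. -/
structure IsExactFunctor {D : Type u} [Category.{v} D] [Preadditive D] {T : D ⥤ D}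
    (Δ : Set (Tri T)) {D' : Type u'} [Category.{v'} D'] [Preadditive D'] {T' : D' ⥤ D'}
    (Δ' : Set (Tri T')) (F : D ⥤ D') (ξ : T ⋙ F ≅ F ⋙ T') : Prop where
  additive : F.Additive
  map_mem : ∀ t ∈ Δ, Tri.mk (F.map t.f) (F.map t.g) (F.map t.h ≫ ξ.hom.app t.X) ∈ Δ'

/-- An action of `G` on a triangulated category is admissible if the functors `F g` are exact,
with commutating isomorphisms `θ g : F g ∘ T ≅ T ∘ F g` whose inverses make the translation functor
`T` a `G`-equivariant functor. -/
structure AdmissibleData {G : Type w} [Group G] {D : Type u} [Category.{v} D] [Preadditive D]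
    (a : RightAction G D) {T : D ⥤ D} (Δ : Set (Tri T)) where
  θ : ∀ g, T ⋙ a.F g ≅ a.F g ⋙ T
  exact : ∀ g, IsExactFunctor Δ Δ (a.F g) (θ g)
  equivariant : IsEquivariant a a T (fun g => (θ g).symm)

/-- The translation functor on `D^G` induced by the equivariant translation functor of `D`. -/
def AdmissibleData.translation {G : Type w} [Group G] {D : Type u} [Category.{v} D] [Preadditive D]
    {a : RightAction G D} {T : D ⥤ D} {Δ : Set (Tri T)} (A : AdmissibleData a Δ) :
    EquivObj a ⥤ EquivObj a :=
  A.equivariant.functor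

/-- The equality `ω ∘ T = T ∘ ω`. -/
def AdmissibleData.forgetIso {G : Type w} [Group G] {D : Type u} [Category.{v} D] [Preadditive D]
    {a : RightAction G D} {T : D ⥤ D} {Δ : Set (Tri T)} (A : AdmissibleData a Δ) :
    A.translation ⋙ forget a ≅ forget a ⋙ T :=
  Iso.refl _

/-- The class `Γ` of triangles is a canonical triangulated structure on `D^G`: it is a triangulated
structure for which the forgetful functor to `D` is exact. -/
structure AdmissibleData.IsCanonical {G : Type w} [Group G] {D : Type u} [Category.{v} D]
    [Preadditive D] [HasFiniteBiproducts D] {a : RightAction G D} {T : D ⥤ D} {Δ : Set (Tri T)}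
    (A : AdmissibleData a Δ) (Γ : Set (Tri A.translation)) : Prop where
  isTriangulated : IsTriangulatedStructure A.translation Γ
  forget_exact : IsExactFunctor Γ Δ (forget a) A.forgetIso

/-- The exact triangles of the stable category: the triangles which are isomorphic to
`X ⟶ Y ⟶ Z ⟶ S X` with morphisms the classes of `u`, `v`, `-w`, for a conflation
`X ⟶ Y ⟶ Z` given by `u`, `v` and a morphism from it to the chosen conflation `X ⟶ I X ⟶ S X`
which is the identity of `X` on the left and `w` on the right. -/
def ExactStructure.Choice.exactTriangles {C : Type u} [Category.{v} C] [Preadditive C]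
    [HasFiniteBiproducts C] {ex : ExactStructure C} (c : ex.Choice) : Set (Tri c.susp) :=
  {t | ∃ (X Y Z : C) (u : X ⟶ Y) (v : Y ⟶ Z) (zero : u ≫ v = 0) (b : Y ⟶ c.I X) (w : Z ⟶ c.S X),
    ex.conflation (ShortComplex.mk u v zero) ∧ u ≫ b = c.ι X ∧ b ≫ c.π X = v ≫ w ∧
      (Tri.mk (T := c.susp) (ex.toStable.map u) (ex.toStable.map v)
        (-ex.toStable.map w)).Isomorphic t}

end Triangulated

/-! ### The induced action on the stable category -/

section StableAction

variable {G : Type w} [Group G] {C : Type u} [Category.{v} C] [Preadditive C]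
  [HasFiniteBiproducts C] {a : RightAction G C} {ex : ExactStructure C}

theorem RightAction.IsAdmissible.injective_of_map (ha : a.IsAdmissible ex) (g : G) {I : C}
    (hI : ex.IsInjective ((a.F g).obj I)) : ex.IsInjective I := fun X Y i f hi => by
  obtain ⟨Z, d, w, hS⟩ := hi
  obtain ⟨t, ht⟩ := hI ((a.F g).map i) ((a.F g).map f) ⟨_, _, _, ha g _ hS⟩
  exact ⟨(a.F g).preimage t, (a.F g).map_injective (by simpa using ht)⟩

theorem RightAction.IsAdmissible.map_injective (ha : a.IsAdmissible ex) (g : G) {I : C}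
    (hI : ex.IsInjective I) : ex.IsInjective ((a.F g).obj I) :=
  ha.injective_of_map g⁻¹ (hI.of_iso ((a.unit I).symm ≪≫
    ((a.δ g⁻¹ g 1 (mul_inv_cancel g)).app I).symm))

theorem RightAction.IsAdmissible.map_factorsInj_iff (ha : a.IsAdmissible ex) (g : G) {X Y : C}
    (f : X ⟶ Y) : ex.FactorsInj ((a.F g).map f) ↔ ex.FactorsInj f := by
  refine ⟨fun ⟨J, p, q, hJ, e⟩ => ?_, fun ⟨J, p, q, hJ, e⟩ =>
    ⟨_, (a.F g).map p, (a.F g).map q, ha.map_injective g hJ, by rw [← Functor.map_comp, e]⟩⟩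
  let i := (a.F g).objObjPreimageIso J
  exact ⟨(a.F g).objPreimage J, (a.F g).preimage (p ≫ i.inv), (a.F g).preimage (i.hom ≫ q),
    ha.injective_of_map g (hJ.of_iso i.symm), (a.F g).map_injective (by simpa using e)⟩

/-- The autoequivalence of the stable category induced by `F g`. -/
def stableF (ha : a.IsAdmissible ex) (g : G) : ex.Stable ⥤ ex.Stable :=
  CategoryTheory.Quotient.lift _ (a.F g ⋙ ex.toStable) (fun X Y f f' h =>
    CategoryTheory.Quotient.sound _ (by
      change ex.FactorsInj _
      rw [← Functor.map_sub, ha.map_factorsInj_iff]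
      exact h))

theorem stableF_isEquivalence (ha : a.IsAdmissible ex) (g : G) :
    (stableF ha g).IsEquivalence where
  faithful := ⟨fun {X Y} f f' h => by
    obtain ⟨f, rfl⟩ := ex.toStable.map_surjective f
    obtain ⟨f', rfl⟩ := ex.toStable.map_surjective f'
    have h' : ex.toStable.map ((a.F g).map f) = ex.toStable.map ((a.F g).map f') := h
    rw [CategoryTheory.Quotient.functor_map_eq_iff] at h' ⊢
    change ex.FactorsInj _ at h'
    rw [← Functor.map_sub, ha.map_factorsInj_iff] at h'
    exact h'⟩
  full := ⟨fun {X Y} f => by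
    obtain ⟨f, rfl⟩ := ex.toStable.map_surjective f
    exact ⟨ex.toStable.map ((a.F g).preimage f),
      congrArg ex.toStable.map ((a.F g).map_preimage f)⟩⟩
  essSurj := ⟨fun Y => ⟨ex.toStable.obj ((a.F g).objPreimage Y.as),
    ⟨ex.toStable.mapIso ((a.F g).objObjPreimageIso Y.as)⟩⟩⟩

/-- The action on the stable category induced by an admissible action on an exact category. -/
def stableAction (ha : a.IsAdmissible ex) : RightAction G ex.Stable where
  F g := stableF ha g
  isEquivalence g := stableF_isEquivalence ha g
  δ g h k e := NatIso.ofComponents (fun X => ex.toStable.mapIso ((a.δ g h k e).app X.as)) (by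
    intro X Y f
    obtain ⟨f, rfl⟩ := ex.toStable.map_surjective f
    have := congrArg ex.toStable.map ((a.δ g h k e).hom.naturality f)
    simp only [Functor.map_comp] at this
    exact this)
  cocycle g h l p q r h₁ h₂ h₃ h₄ A := by
    have := congrArg ex.toStable.map (a.cocycle g h l p q r h₁ h₂ h₃ h₄ A.as)
    simp only [Functor.map_comp] at this
    exact this

/-- The canonical functor to the stable category commutes with the actions. -/
def toStableIso (ha : a.IsAdmissible ex) (g : G) :
    a.F g ⋙ ex.toStable ≅ ex.toStable ⋙ (stableAction ha).F g :=
  Iso.refl _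

theorem toStable_isEquivariant (ha : a.IsAdmissible ex) :
    IsEquivariant a (stableAction ha) ex.toStable (toStableIso ha) where
  comp g h k e A := by
    refine (Category.id_comp _).trans (Eq.trans ?_ (Category.comp_id _).symm)
    refine (congrArg (fun t => t ≫ _) (((stableAction ha).F g).map_id _)).trans ?_
    exact Category.id_comp _
  unit A := by
    refine (Category.id_comp _).trans ?_
    apply ((stableAction ha).F 1).map_injective
    refine (((stableAction ha).F 1).map_preimage _).trans ?_
    exact congrArg ex.toStable.map ((a.F 1).map_preimage _).symm

/-- The functor `C^G ⥤ (stable category of C)^G` induced by the canonical functor. -/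
def toStableEquiv (ha : a.IsAdmissible ex) : EquivObj a ⥤ EquivObj (stableAction ha) :=
  (toStable_isEquivariant ha).functor

/-- The commutating isomorphisms of an admissible action on the stable category are the induced
ones: `θ g` at `X` is the class of the third component of any morphism to the chosen conflation
`F g X ⟶ I (F g X) ⟶ S (F g X)` from the image under `F g` of the chosen conflation
`X ⟶ I X ⟶ S X` which is the identity of `F g X` on the left. -/
def IsInduced (ha : a.IsAdmissible ex) (c : ex.Choice)
    (A : AdmissibleData (stableAction ha) c.exactTriangles) : Prop :=
  ∀ (g : G) (X : C) (s : (a.F g).obj (c.I X) ⟶ c.I ((a.F g).obj X))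
    (t : (a.F g).obj (c.S X) ⟶ c.S ((a.F g).obj X)),
    (a.F g).map (c.ι X) ≫ s = c.ι ((a.F g).obj X) →
    s ≫ c.π ((a.F g).obj X) = (a.F g).map (c.π X) ≫ t →
      (A.θ g).hom.app (ex.toStable.obj X) = ex.toStable.map t

end StableAction

/-- An equivalence up to retracts: a fully faithful functor such that each object of the target is
a retract of an object in the essential image. -/
structure IsEquivalenceUpToRetracts {C : Type u} [Category.{v} C] {D : Type u'} [Category.{v'} D]
    (F : C ⥤ D) : Prop where
  full : F.Full
  faithful : F.Faithful
  dense : ∀ Y : D, ∃ Z : D, F.essImage Z ∧ Nonempty (Retract Y Z)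

end Equivariantization

end

noncomputable section

namespace Equivariantization

universe v u v' u' w

/-! ### Triangles -/

section Triangles

variable {D : Type u} [Category.{v} D] {T : D ⥤ D}

/-! Averaging is the main tool. For equivariant objects `X`, `Y` the group acts on the morphisms
between the underlying objects, with the morphisms of the equivariant category as invariants. Since
$|G|$ is invertible, summing over the group and dividing by $|G|$ projects onto the invariants,
linearly with respect to equivariant morphisms (`average_comp`, `comp_average`). Hence a lifting,
extension or fill-in problem with equivariant data that is solvable without the action is solvable
equivariantly. The second tool is induction: the biproduct of the $F_gX$ is equivariant (`induced`),
and each equivariant object is a retract of the object induced from it, because the composite of the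
two canonical maps is $|G|$ (`Induced.exists_retract`).

Frobenius property: by averaging, an equivariant object with projective underlying object is
projective. Inducing a deflation from a projective gives enough of these, and splitting the
resulting deflation shows that conversely a projective equivariant object has projective underlying
object. The same holds for injectives, so the coincidence of both classes is inherited from
$\mathcal{E}$.

Happel's theorem: up to isomorphism the exact triangles are those of pushouts of $X\to\mathcal{I}X$,
and on such cones the axioms are explicit. For the octahedral axiom the second morphism may be taken
to be an inflation, since a direct summand may be added to its target. The coherence of the induced
action has one source: morphisms into a conflation with injective middle term that agree on the left
agree stably on the right (`toStable_map_eq`).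

Comparison functor $K$: it is full by averaging a representative, faithful by averaging a
factorization through an injective, and dense up to retracts because stabilization carries induced
objects to induced objects.

Canonical structure: the exact triangles must be those whose underlying triangle is exact. Fill-ins
come from averaging, but cones and octahedra do not. A morphism $f$ is a retract of some $Kf'$. The
idempotent of the first two vertices extends to an endomorphism of the cone of $Kf'$, which can be
corrected to an idempotent; underneath, it splits, with the cone of the underlying morphism as
image, and this image inherits the equivariant structure (`canonicalTriangles_exists_cone`).
Octahedra exist over the image of $K$, and the octahedral axiom descends to direct summands
(`HasOctahedron.of_fst`, `HasOctahedron.of_snd`, `HasOctahedron.of_thd`). Uniqueness is the five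
lemma. -/

/-- Three morphisms which form a morphism of triangles. -/
structure Tri.IsHom (t t' : Tri T) (a : t.X ⟶ t'.X) (b : t.Y ⟶ t'.Y) (c : t.Z ⟶ t'.Z) : Prop where
  comm₁ : t.f ≫ b = a ≫ t'.f
  comm₂ : t.g ≫ c = b ≫ t'.g
  comm₃ : t.h ≫ T.map a = c ≫ t'.h

theorem Tri.IsHom.comp {t t' t'' : Tri T} {a : t.X ⟶ t'.X} {b : t.Y ⟶ t'.Y} {c : t.Z ⟶ t'.Z}
    {a' : t'.X ⟶ t''.X} {b' : t'.Y ⟶ t''.Y} {c' : t'.Z ⟶ t''.Z} (h : t.IsHom t' a b c)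
    (h' : t'.IsHom t'' a' b' c') : t.IsHom t'' (a ≫ a') (b ≫ b') (c ≫ c') where
  comm₁ := by rw [reassoc_of% h.comm₁, h'.comm₁, Category.assoc]
  comm₂ := by rw [reassoc_of% h.comm₂, h'.comm₂, Category.assoc]
  comm₃ := by rw [T.map_comp, reassoc_of% h.comm₃, h'.comm₃, Category.assoc]

theorem Tri.IsHom.isomorphic {t t' : Tri T} {a : t.X ⟶ t'.X} {b : t.Y ⟶ t'.Y} {c : t.Z ⟶ t'.Z}
    (h : t.IsHom t' a b c) (ha : IsIso a) (hb : IsIso b) (hc : IsIso c) : t.Isomorphic t' :=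
  ⟨asIso a, asIso b, asIso c, h.comm₁, h.comm₂, h.comm₃⟩

theorem Tri.Isomorphic.exists_isHom {t t' : Tri T} (h : t.Isomorphic t') :
    ∃ (a : t.X ≅ t'.X) (b : t.Y ≅ t'.Y) (c : t.Z ≅ t'.Z), t.IsHom t' a.hom b.hom c.hom := by
  obtain ⟨a, b, c, h₁, h₂, h₃⟩ := h
  exact ⟨a, b, c, h₁, h₂, h₃⟩

theorem Tri.IsHom.symm {t t' : Tri T} {a : t.X ≅ t'.X} {b : t.Y ≅ t'.Y} {c : t.Z ≅ t'.Z}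
    (h : t.IsHom t' a.hom b.hom c.hom) : t'.IsHom t a.inv b.inv c.inv where
  comm₁ := by rw [← cancel_epi a.hom, ← reassoc_of% h.comm₁]; simp
  comm₂ := by rw [← cancel_epi b.hom, ← reassoc_of% h.comm₂]; simp
  comm₃ := by
    rw [← cancel_epi c.hom, ← reassoc_of% h.comm₃, ← T.map_comp]; simp

theorem Tri.Isomorphic.refl (t : Tri T) : t.Isomorphic t :=
  ⟨Iso.refl _, Iso.refl _, Iso.refl _, by simp, by simp, by simp⟩

theorem Tri.Isomorphic.trans {t t' t'' : Tri T} (h : t.Isomorphic t') (h' : t'.Isomorphic t'') :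
    t.Isomorphic t'' := by
  obtain ⟨a, b, c, h⟩ := h.exists_isHom
  obtain ⟨a', b', c', h'⟩ := h'.exists_isHom
  exact (h.comp h').isomorphic inferInstance inferInstance inferInstance

variable [Preadditive D]

/-- The rotated triangle. -/
abbrev Tri.rot (t : Tri T) : Tri T := Tri.mk t.g t.h (-T.map t.f)

theorem Tri.IsHom.rot {t t' : Tri T} {a : t.X ⟶ t'.X} {b : t.Y ⟶ t'.Y} {c : t.Z ⟶ t'.Z}
    (h : t.IsHom t' a b c) : t.rot.IsHom t'.rot b c (T.map a) where
  comm₁ := h.comm₂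
  comm₂ := h.comm₃
  comm₃ := by
    change (-T.map t.f) ≫ T.map b = T.map a ≫ (-T.map t'.f)
    rw [Preadditive.neg_comp, Preadditive.comp_neg, ← T.map_comp, ← T.map_comp, h.comm₁]

/-- A triangle for which the long sequences of the contravariant functors `Hom(-, W)` are exact
between `Hom(T Y, W)` and `Hom(X, W)`. -/
structure Tri.CoExact (t : Tri T) : Prop where
  f_g : t.f ≫ t.g = 0
  g_h : t.g ≫ t.h = 0
  h_f : t.h ≫ T.map t.f = 0
  exists_Z : ∀ {W : D} (k : t.Y ⟶ W), t.f ≫ k = 0 → ∃ l : t.Z ⟶ W, t.g ≫ l = k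
  exists_TX : ∀ {W : D} (k : t.Z ⟶ W), t.g ≫ k = 0 → ∃ l : T.obj t.X ⟶ W, t.h ≫ l = k
  exists_TY : ∀ {W : D} (k : T.obj t.X ⟶ W), t.h ≫ k = 0 →
    ∃ l : T.obj t.Y ⟶ W, T.map t.f ≫ l = k

/-- Five lemma in its contravariant half, done by hand: exactness makes `c` an epimorphism (`inj`),
and a one-sided inverse is built by extending `inv b ≫ t.g` along `t'.g` and correcting it by a term
through `t'.h`. -/
theorem Tri.CoExact.isIso {t t' : Tri T} (ht : t.CoExact) (ht' : t'.CoExact) {a : t.X ⟶ t'.X}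
    {b : t.Y ⟶ t'.Y} {c : t.Z ⟶ t'.Z} (H : t.IsHom t' a b c) (ha : IsIso a) (hb : IsIso b) :
    IsIso c := by
  have inj : ∀ {W : D} (k : t'.Z ⟶ W), c ≫ k = 0 → k = 0 := by
    intro W k hk
    obtain ⟨k', rfl⟩ := ht'.exists_TX k (by
      rw [← cancel_epi b, ← reassoc_of% H.comm₂, hk, comp_zero, comp_zero])
    rw [← reassoc_of% H.comm₃] at hk
    obtain ⟨l, hl⟩ := ht.exists_TY _ hk
    have : k' = T.map t'.f ≫ T.map (inv b) ≫ l := by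
      rw [← cancel_epi (T.map a), ← hl, ← Functor.map_comp_assoc, ← H.comm₁, Functor.map_comp_assoc,
        ← T.map_comp_assoc b, IsIso.hom_inv_id, T.map_id, Category.id_comp]
    rw [this, reassoc_of% ht'.h_f, zero_comp]
  obtain ⟨k₁, hk₁⟩ := ht'.exists_Z (inv b ≫ t.g) (by
    rw [← cancel_epi a, ← reassoc_of% H.comm₁, IsIso.hom_inv_id_assoc, ht.f_g, comp_zero])
  obtain ⟨k₂, hk₂⟩ := ht.exists_TX (c ≫ k₁ - 𝟙 _) (by
    rw [Preadditive.comp_sub, reassoc_of% H.comm₂, hk₁, IsIso.hom_inv_id_assoc, Category.comp_id,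
      sub_self])
  have h1 : c ≫ (k₁ - t'.h ≫ T.map (inv a) ≫ k₂) = 𝟙 _ := by
    rw [Preadditive.comp_sub, ← reassoc_of% H.comm₃, ← Functor.map_comp_assoc, IsIso.hom_inv_id,
      T.map_id, Category.id_comp, hk₂, sub_sub_cancel]
  refine ⟨_, h1, ?_⟩
  rw [← sub_eq_zero]
  apply inj
  rw [Preadditive.comp_sub, reassoc_of% h1, Category.comp_id, sub_self]

/-- A triangle which is a retract, up to an isomorphism, of a coexact triangle is coexact. -/
theorem Tri.CoExact.of_retract {t t' : Tri T} (ht' : t'.CoExact) {a : t.X ⟶ t'.X} {b : t.Y ⟶ t'.Y}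
    {c : t.Z ⟶ t'.Z} (H : t.IsHom t' a b c) {a' : t'.X ⟶ t.X} {b' : t'.Y ⟶ t.Y}
    {c' : t'.Z ⟶ t.Z} (H' : t'.IsHom t a' b' c') (ha : a ≫ a' = 𝟙 _) (hb : b ≫ b' = 𝟙 _)
    (hc : c ≫ c' = 𝟙 _) : t.CoExact where
  f_g := by
    rw [← Category.comp_id t.g, ← hc, reassoc_of% H.comm₂, reassoc_of% H.comm₁,
      reassoc_of% ht'.f_g, zero_comp, comp_zero]
  g_h := by
    have h1 := H.comm₃
    have : t.h = c ≫ t'.h ≫ T.map a' := by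
      rw [← reassoc_of% h1, ← T.map_comp, ha, T.map_id, Category.comp_id]
    rw [this, reassoc_of% H.comm₂, reassoc_of% ht'.g_h, zero_comp, comp_zero]
  h_f := by
    rw [← Category.comp_id (T.map t.f), ← T.map_id, ← hb, T.map_comp, ← Functor.map_comp_assoc,
      H.comm₁, Functor.map_comp_assoc, reassoc_of% H.comm₃, reassoc_of% ht'.h_f, zero_comp,
      comp_zero]
  exists_Z k hk := by
    obtain ⟨l, hl⟩ := ht'.exists_Z (b' ≫ k) (by rw [reassoc_of% H'.comm₁, hk, comp_zero])
    exact ⟨c ≫ l, by rw [reassoc_of% H.comm₂, hl, reassoc_of% hb]⟩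
  exists_TX k hk := by
    obtain ⟨l, hl⟩ := ht'.exists_TX (c' ≫ k) (by rw [reassoc_of% H'.comm₂, hk, comp_zero])
    exact ⟨T.map a ≫ l, by rw [reassoc_of% H.comm₃, hl, reassoc_of% hc]⟩
  exists_TY k hk := by
    obtain ⟨l, hl⟩ := ht'.exists_TY (T.map a' ≫ k) (by rw [reassoc_of% H'.comm₃, hk, comp_zero])
    exact ⟨T.map b ≫ l, by
      rw [← Functor.map_comp_assoc, H.comm₁, Functor.map_comp_assoc, hl, ← Functor.map_comp_assoc,
        ha, T.map_id, Category.id_comp]⟩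

end Triangles

/-! ### Pretriangulated structures -/

section Pretriangulated

variable {D : Type u} [Category.{v} D] [Preadditive D] {T : D ⥤ D} {Δ : Set (Tri T)}

/-- The axioms of a pretriangulated structure, where exact triangles are only supposed to be stable
under rotation in one direction. -/
structure IsForwardPretriangulated (T : D ⥤ D) (Δ : Set (Tri T)) : Prop where
  hasFiniteBiproducts : HasFiniteBiproducts D
  isEquivalence : T.IsEquivalence
  additive : T.Additive
  of_isomorphic : ∀ t t' : Tri T, t.Isomorphic t' → t ∈ Δ → t' ∈ Δ
  contractible : ∀ X Z : D, IsZero Z → Tri.mk (𝟙 X) (0 : X ⟶ Z) 0 ∈ Δ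
  exists_cone : ∀ ⦃X Y : D⦄ (f : X ⟶ Y), ∃ (Z : D) (g : Y ⟶ Z) (h : Z ⟶ T.obj X),
    Tri.mk f g h ∈ Δ
  rotate : ∀ t : Tri T, t ∈ Δ → t.rot ∈ Δ
  complete : ∀ t t' : Tri T, t ∈ Δ → t' ∈ Δ → ∀ (a : t.X ⟶ t'.X) (b : t.Y ⟶ t'.Y),
    t.f ≫ b = a ≫ t'.f → ∃ c : t.Z ⟶ t'.Z, t.IsHom t' a b c

namespace IsForwardPretriangulated

/-- The contractible triangle on `t.X` maps to `t` by the identity and `t.f`, so `t.f ≫ t.g` factors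
through a zero object. -/
theorem f_g (hT : IsForwardPretriangulated T Δ) {t : Tri T} (ht : t ∈ Δ) : t.f ≫ t.g = 0 := by
  have := hT.hasFiniteBiproducts
  have hz : HasZeroObject D := inferInstance
  obtain ⟨O, hO⟩ := hz
  obtain ⟨c, hc⟩ := hT.complete (Tri.mk (𝟙 t.X) (0 : t.X ⟶ O) 0) t (hT.contractible _ _ hO) ht
    (𝟙 _) t.f rfl
  have := hc.comm₂
  dsimp at this
  rw [← this, zero_comp]

theorem zero_id_mem (hT : IsForwardPretriangulated T Δ) {O : D} (hO : IsZero O) (W : D) :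
    Tri.mk (0 : O ⟶ W) (𝟙 W) (0 : W ⟶ T.obj O) ∈ Δ := by
  have := hT.isEquivalence
  have := hT.additive
  let e := T.objObjPreimageIso W
  have h := hT.rotate _ (hT.rotate _ (hT.contractible (T.objPreimage W) O hO))
  refine hT.of_isomorphic _ _ ?_ h
  -- Two rotations turn the identity of the contractible triangle into its negative, whence the sign
  -- on the third vertex only.
  refine ⟨Iso.refl _, e, ⟨-e.hom, -e.inv, by simp, by simp⟩, ?_, ?_, ?_⟩
  · exact hO.eq_of_src _ _
  · simp
  · exact (T.map_isZero hO).eq_of_tgt _ _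

/-- A morphism `k` that kills `t.f` is the middle component of a morphism from `t` to the triangle
`0 ⟶ W ⟶ W`; its third component is the factorization. -/
theorem exists_Z (hT : IsForwardPretriangulated T Δ) {t : Tri T} (ht : t ∈ Δ) {W : D}
    (k : t.Y ⟶ W) (hk : t.f ≫ k = 0) : ∃ l : t.Z ⟶ W, t.g ≫ l = k := by
  have := hT.hasFiniteBiproducts
  have hz : HasZeroObject D := inferInstance
  obtain ⟨O, hO⟩ := hz
  obtain ⟨c, hc⟩ := hT.complete t _ ht (hT.zero_id_mem hO W) 0 k (by simp [hk])
  exact ⟨c, by simpa using hc.comm₂⟩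

theorem coExact (hT : IsForwardPretriangulated T Δ) {t : Tri T} (ht : t ∈ Δ) : t.CoExact where
  f_g := hT.f_g ht
  g_h := hT.f_g (hT.rotate t ht)
  h_f := by simpa using hT.f_g (hT.rotate _ (hT.rotate t ht))
  exists_Z := hT.exists_Z ht
  exists_TX := hT.exists_Z (hT.rotate t ht)
  exists_TY k hk := by
    obtain ⟨l, hl⟩ := hT.exists_Z (hT.rotate _ (hT.rotate t ht)) k hk
    exact ⟨-l, by simpa using hl⟩

theorem toPretriangulated (hT : IsForwardPretriangulated T Δ) : IsPretriangulatedStructure T Δ where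
  hasFiniteBiproducts := hT.hasFiniteBiproducts
  isEquivalence := hT.isEquivalence
  additive := hT.additive
  of_isomorphic := hT.of_isomorphic
  contractible := hT.contractible
  exists_cone := hT.exists_cone
  complete t t' ht ht' a b h := by
    obtain ⟨c, hc⟩ := hT.complete t t' ht ht' a b h
    exact ⟨c, hc.comm₂, hc.comm₃⟩
  rotate_iff t := by
    have := hT.isEquivalence
    refine ⟨hT.rotate t, fun ht => ?_⟩
    -- For the inverse rotation, a cone of `t.f` and `t` itself are compared after three rotations,
    -- where both triangles are known to be exact and start with `-T.map t.f`. The isomorphism of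
    -- the third vertices descends because `T` is fully faithful.
    obtain ⟨Z, g, h, hm⟩ := hT.exists_cone t.f
    have h₁ := hT.rotate _ (hT.rotate _ ht)
    have h₂ := hT.rotate _ (hT.rotate _ (hT.rotate _ hm))
    obtain ⟨c, hc⟩ := hT.complete _ _ h₂ h₁ (𝟙 (T.obj t.X)) (𝟙 (T.obj t.Y)) (by simp)
    have hi : IsIso c := (hT.coExact h₂).isIso (hT.coExact h₁) hc inferInstance inferInstance
    have e₁ := hc.comm₂
    have e₂ := hc.comm₃
    dsimp at e₁ e₂ c
    have hi' : IsIso (T.map (T.preimage c)) := by rw [T.map_preimage]; exact hi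
    have hi'' : IsIso (T.preimage c) := isIso_of_reflects_iso _ T
    refine hT.of_isomorphic _ _ ?_ hm
    refine ⟨Iso.refl _, Iso.refl _, asIso (T.preimage c), by simp, ?_, ?_⟩
    · apply T.map_injective
      simpa using e₁
    · apply T.map_injective
      simpa using e₂

end IsForwardPretriangulated

namespace IsPretriangulatedStructure

theorem toForward (hT : IsPretriangulatedStructure T Δ) : IsForwardPretriangulated T Δ where
  hasFiniteBiproducts := hT.hasFiniteBiproducts
  isEquivalence := hT.isEquivalence
  additive := hT.additive
  of_isomorphic := hT.of_isomorphic
  contractible := hT.contractible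
  exists_cone := hT.exists_cone
  complete t t' ht ht' a b h := by
    obtain ⟨c, h₂, h₃⟩ := hT.complete t t' ht ht' a b h
    exact ⟨c, h, h₂, h₃⟩
  rotate t := (hT.rotate_iff t).1

theorem coExact (hT : IsPretriangulatedStructure T Δ) {t : Tri T} (ht : t ∈ Δ) : t.CoExact :=
  hT.toForward.coExact ht

theorem exists_isHom (hT : IsPretriangulatedStructure T Δ) {t t' : Tri T} (ht : t ∈ Δ)
    (ht' : t' ∈ Δ) (a : t.X ⟶ t'.X) (b : t.Y ⟶ t'.Y)
    (h : t.f ≫ b = a ≫ t'.f) : ∃ c : t.Z ⟶ t'.Z, t.IsHom t' a b c :=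
  hT.toForward.complete t t' ht ht' a b h

theorem isIso (hT : IsPretriangulatedStructure T Δ) {t t' : Tri T} (ht : t ∈ Δ)
    (ht' : t' ∈ Δ) {a : t.X ⟶ t'.X} {b : t.Y ⟶ t'.Y} {c : t.Z ⟶ t'.Z} (H : t.IsHom t' a b c)
    (ha : IsIso a) (hb : IsIso b) : IsIso c :=
  (hT.coExact ht).isIso (hT.coExact ht') H ha hb

/-- Recognition principle: to see that a candidate is exact, it is enough to check its coexactness
and to map a known exact triangle to it, isomorphically on the first two vertices. -/
theorem mem_of_isHom (hT : IsPretriangulatedStructure T Δ) {t t' : Tri T} (ht : t ∈ Δ)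
    (ht' : t'.CoExact) {a : t.X ⟶ t'.X} {b : t.Y ⟶ t'.Y} {c : t.Z ⟶ t'.Z} (H : t.IsHom t' a b c)
    (ha : IsIso a) (hb : IsIso b) :
    t' ∈ Δ :=
  hT.of_isomorphic _ _ (H.isomorphic ha hb ((hT.coExact ht).isIso ht' H ha hb)) ht

/-- A retract of an exact triangle is exact. -/
theorem mem_of_retract (hT : IsPretriangulatedStructure T Δ) {t t' : Tri T} (ht' : t' ∈ Δ)
    {a : t.X ⟶ t'.X} {b : t.Y ⟶ t'.Y}
    {c : t.Z ⟶ t'.Z} (H : t.IsHom t' a b c) {a' : t'.X ⟶ t.X} {b' : t'.Y ⟶ t.Y}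
    {c' : t'.Z ⟶ t.Z} (H' : t'.IsHom t a' b' c') (ha : a ≫ a' = 𝟙 _) (hb : b ≫ b' = 𝟙 _)
    (hc : c ≫ c' = 𝟙 _) : t ∈ Δ := by
  obtain ⟨Z, g, h, hm⟩ := hT.exists_cone t.f
  obtain ⟨d, hd⟩ := hT.exists_isHom (t := Tri.mk t.f g h) hm ht' a b H.comm₁
  have hd' := hd.comp H'
  refine hT.mem_of_isHom hm ((hT.coExact ht').of_retract H H' ha hb hc) hd' ?_ ?_
  · rw [ha]; exact (inferInstance : IsIso (𝟙 t.X))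
  · rw [hb]; exact (inferInstance : IsIso (𝟙 t.Y))

end IsPretriangulatedStructure

end Pretriangulated

/-! ### Octahedra -/

section Octahedra

/-- The morphisms `i`, `p`, `j`, `q` exhibit `B` as a biproduct of `A` and `C`. -/
structure IsBiprod {D : Type u} [Category.{v} D] [Preadditive D] {A B C : D} (i : A ⟶ B)
    (p : B ⟶ A) (j : C ⟶ B) (q : B ⟶ C) : Prop where
  i_p : i ≫ p = 𝟙 A
  j_q : j ≫ q = 𝟙 C
  i_q : i ≫ q = 0
  j_p : j ≫ p = 0
  total : p ≫ i + q ≫ j = 𝟙 B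

attribute [local instance] hasBinaryBiproducts_of_finite_biproducts

variable {D : Type u} [Category.{v} D] [Preadditive D] {T : D ⥤ D} {Δ : Set (Tri T)}

theorem IsBiprod.map {D' : Type u'} [Category.{v'} D'] [Preadditive D'] {A B C : D} {i : A ⟶ B}
    {p : B ⟶ A} {j : C ⟶ B} {q : B ⟶ C} (h : IsBiprod i p j q) (F : D ⥤ D') [F.Additive] :
    IsBiprod (F.map i) (F.map p) (F.map j) (F.map q) where
  i_p := by rw [← F.map_comp, h.i_p, F.map_id]
  j_q := by rw [← F.map_comp, h.j_q, F.map_id]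
  i_q := by rw [← F.map_comp, h.i_q, F.map_zero]
  j_p := by rw [← F.map_comp, h.j_p, F.map_zero]
  total := by rw [← F.map_comp, ← F.map_comp, ← F.map_add, h.total, F.map_id]

theorem IsBiprod.hom_ext' {A B C W : D} {i : A ⟶ B} {p : B ⟶ A} {j : C ⟶ B} {q : B ⟶ C}
    (h : IsBiprod i p j q) {s t : B ⟶ W} (h₁ : i ≫ s = i ≫ t) (h₂ : j ≫ s = j ≫ t) : s = t := by
  rw [← Category.id_comp s, ← Category.id_comp t, ← h.total]
  simp only [Preadditive.add_comp, Category.assoc, h₁, h₂]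

namespace IsPretriangulatedStructure

/-- A split monomorphism of a pretriangulated category is the inclusion of a direct summand. -/
theorem exists_complement (hT : IsPretriangulatedStructure T Δ) {X M : D} (s : X ⟶ M) (r : M ⟶ X)
    (h : s ≫ r = 𝟙 X) : ∃ (C : D) (j : C ⟶ M) (q : M ⟶ C), IsBiprod s r j q := by
  obtain ⟨C, q, d, hm⟩ := hT.exists_cone s
  have ht := hT.coExact hm
  have hd : d = 0 := by
    have h1 : d ≫ T.map s = 0 := ht.h_f
    -- `d` kills `T.map s`, which is a split monomorphism. Once `d = 0`, the morphism `q` is an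
    -- epimorphism.
    rw [← Category.comp_id d, ← T.map_id, ← h, T.map_comp, reassoc_of% h1, zero_comp]
  subst hd
  have mono : ∀ {W : D} (k : C ⟶ W), q ≫ k = 0 → k = 0 := fun k hk => by
    obtain ⟨l, hl⟩ := ht.exists_TX k hk
    simpa using hl.symm
  obtain ⟨j, hj⟩ := ht.exists_Z (𝟙 M - r ≫ s) (by simp [reassoc_of% h])
  have hj : q ≫ j = 𝟙 M - r ≫ s := hj
  have hsq : s ≫ q = 0 := ht.f_g
  refine ⟨C, j, q, h, ?_, hsq, ?_, ?_⟩
  · rw [← sub_eq_zero]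
    apply mono
    rw [Preadditive.comp_sub, reassoc_of% hj]
    simp [hsq]
  · apply mono
    rw [reassoc_of% hj]
    simp [h]
  · rw [hj]; abel

/-- The candidate is the sum of the given triangle and `0 ⟶ C ⟶ C`. Its coexactness is checked by
hand and a cone of `f ≫ i` is mapped to it, so that `mem_of_isHom` applies. -/
theorem addRight (hT : IsPretriangulatedStructure T Δ) [HasFiniteBiproducts D] {X Y Z Y' C : D}
    {f : X ⟶ Y} {g : Y ⟶ Z} {h : Z ⟶ T.obj X} (hm : Tri.mk f g h ∈ Δ) {i : Y ⟶ Y'} {p : Y' ⟶ Y}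
    {j : C ⟶ Y'} {q : Y' ⟶ C} (hY : IsBiprod i p j q) :
    Tri.mk (f ≫ i) (biprod.lift (p ≫ g) q) ((biprod.fst : Z ⊞ C ⟶ Z) ≫ h) ∈ Δ := by
  have ht := hT.coExact hm
  have fg : f ≫ g = 0 := ht.f_g
  have gh : g ≫ h = 0 := ht.g_h
  have hf : h ≫ T.map f = 0 := ht.h_f
  obtain ⟨Z₁, g₁, h₁, hm₁⟩ := hT.exists_cone (f ≫ i)
  have ht₁ := hT.coExact hm₁
  obtain ⟨c₁, hc₁⟩ := hT.exists_isHom hm₁ hm (𝟙 X) p (by simp [hY.i_p])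
  obtain ⟨c₂, hc₂⟩ := ht₁.exists_Z q (by simp [hY.i_q])
  have e₂ : g₁ ≫ c₁ = p ≫ g := hc₁.comm₂
  have e₃ : h₁ ≫ T.map (𝟙 X) = c₁ ≫ h := hc₁.comm₃
  have e₄ : g₁ ≫ c₂ = q := hc₂
  refine hT.mem_of_isHom hm₁ (t' := Tri.mk _ _ _) ?_ (a := 𝟙 X) (b := 𝟙 Y')
    (c := biprod.lift c₁ c₂) ⟨by simp, ?_, ?_⟩ inferInstance inferInstance
  · refine ⟨?_, ?_, ?_, fun k hk => ?_, fun k hk => ?_, fun k hk => ?_⟩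
    · apply biprod.hom_ext <;> simp [reassoc_of% hY.i_p, hY.i_q, fg]
    · simp [gh]
    · simp [reassoc_of% hf]
    · obtain ⟨l, hl⟩ := ht.exists_Z (i ≫ k) (by simpa using hk)
      have hl : g ≫ l = i ≫ k := hl
      refine ⟨biprod.desc l (j ≫ k), ?_⟩
      dsimp only at k ⊢
      rw [biprod.lift_desc, Category.assoc, hl, ← Category.assoc, ← Category.assoc,
        ← Preadditive.add_comp, hY.total, Category.id_comp]
    · dsimp only at k hk ⊢
      have hk' : ∀ {W : D} (s : W ⟶ Y'), s ≫ biprod.lift (p ≫ g) q ≫ k = 0 := fun s => by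
        rw [hk, comp_zero]
      have h1 := hk' i
      have h2 := hk' j
      rw [← Category.assoc, show i ≫ biprod.lift (p ≫ g) q = g ≫ biprod.inl by
        apply biprod.hom_ext <;> simp [reassoc_of% hY.i_p, hY.i_q], Category.assoc] at h1
      rw [← Category.assoc, show j ≫ biprod.lift (p ≫ g) q = biprod.inr by
        apply biprod.hom_ext <;> simp [reassoc_of% hY.j_p, hY.j_q]] at h2
      obtain ⟨l, hl⟩ := ht.exists_TX (biprod.inl ≫ k) h1
      have hl : h ≫ l = biprod.inl ≫ k := hl
      refine ⟨l, ?_⟩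
      apply biprod.hom_ext' <;> simp [hl, h2]
    · dsimp only at k hk ⊢
      obtain ⟨l, hl⟩ := ht.exists_TY k (by
        rw [← cancel_epi (biprod.fst : Z ⊞ C ⟶ Z), ← Category.assoc, hk, comp_zero])
      have hl : T.map f ≫ l = k := hl
      exact ⟨T.map p ≫ l, by
        rw [← Functor.map_comp_assoc, Category.assoc, hY.i_p, Category.comp_id, hl]⟩
  · apply biprod.hom_ext <;> simp [e₂, e₄]
  · simpa using e₃

/-- As in `addRight`, now with the summand `C ⟶ 0 ⟶ T C`: enlarging the source by `C` enlarges the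
cone by `T C`. -/
theorem addLeft (hT : IsPretriangulatedStructure T Δ) [HasFiniteBiproducts D] {X Y Z X' C : D}
    {f : X ⟶ Y} {g : Y ⟶ Z} {h : Z ⟶ T.obj X} (hm : Tri.mk f g h ∈ Δ) {i : X ⟶ X'} {p : X' ⟶ X}
    {j : C ⟶ X'} {q : X' ⟶ C} (hX : IsBiprod i p j q) :
    Tri.mk (p ≫ f) (g ≫ (biprod.inl : Z ⟶ Z ⊞ T.obj C))
      (biprod.desc (h ≫ T.map i) (T.map j)) ∈ Δ := by
  have := hT.additive
  have hX' := hX.map T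
  have ht := hT.coExact hm
  have fg : f ≫ g = 0 := ht.f_g
  have gh : g ≫ h = 0 := ht.g_h
  have hf : h ≫ T.map f = 0 := ht.h_f
  obtain ⟨Z₁, g₁, h₁, hm₁⟩ := hT.exists_cone (p ≫ f)
  have ht₁ := hT.coExact hm₁
  have gh₁ : g₁ ≫ h₁ = 0 := ht₁.g_h
  obtain ⟨c₁, hc₁⟩ := hT.exists_isHom hm₁ hm p (𝟙 Y) (by simp)
  have e₂ : g₁ ≫ c₁ = 𝟙 Y ≫ g := hc₁.comm₂
  have e₃ : h₁ ≫ T.map p = c₁ ≫ h := hc₁.comm₃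
  refine hT.mem_of_isHom hm₁ (t' := Tri.mk _ _ _) ?_ (a := 𝟙 X') (b := 𝟙 Y)
    (c := biprod.lift c₁ (h₁ ≫ T.map q)) ⟨by simp, ?_, ?_⟩ inferInstance inferInstance
  · refine ⟨by simp [reassoc_of% fg], by simp [reassoc_of% gh], ?_, fun k hk => ?_, fun k hk => ?_,
      fun k hk => ?_⟩
    · apply biprod.hom_ext' <;> simp [reassoc_of% hX'.i_p, reassoc_of% hX'.j_p, hf]
    · dsimp only at k hk ⊢
      obtain ⟨l, hl⟩ := ht.exists_Z k (by
        rw [← Category.id_comp (f ≫ k), ← hX.i_p]; simpa using i ≫= hk)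
      have hl : g ≫ l = k := hl
      exact ⟨biprod.fst ≫ l, by simp [hl]⟩
    · dsimp only at k hk ⊢
      obtain ⟨l, hl⟩ := ht.exists_TX (biprod.inl ≫ k) (by simpa using hk)
      have hl : h ≫ l = biprod.inl ≫ k := hl
      refine ⟨T.map p ≫ l + T.map q ≫ biprod.inr ≫ k, ?_⟩
      apply biprod.hom_ext' <;> simp [reassoc_of% hX'.i_p, reassoc_of% hX'.j_p,
        reassoc_of% hX'.i_q, reassoc_of% hX'.j_q, hl]
    · dsimp only at k hk ⊢
      have h1 := biprod.inl ≫= hk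
      have h2 := biprod.inr ≫= hk
      simp only [biprod.inl_desc_assoc, biprod.inr_desc_assoc, Category.assoc, comp_zero] at h1 h2
      obtain ⟨l, hl⟩ := ht.exists_TY (T.map i ≫ k) h1
      have hl : T.map f ≫ l = T.map i ≫ k := hl
      refine ⟨l, hX'.hom_ext' ?_ ?_⟩
      · rw [T.map_comp, Category.assoc, reassoc_of% hX'.i_p, hl]
      · rw [T.map_comp, Category.assoc, reassoc_of% hX'.j_p, h2, zero_comp]
  · apply biprod.hom_ext <;> simp [e₂, reassoc_of% gh₁]
  · dsimp only
    rw [biprod.lift_desc, ← reassoc_of% e₃, Category.assoc, ← Preadditive.comp_add, hX'.total]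
    simp

end IsPretriangulatedStructure

/-- The octahedral axiom for the composable morphisms `u₁₂` and `u₂₃`. -/
def HasOctahedron (Δ : Set (Tri T)) {X₁ X₂ X₃ : D} (u₁₂ : X₁ ⟶ X₂) (u₂₃ : X₂ ⟶ X₃) : Prop :=
  ∀ ⦃Z₁₂ Z₂₃ Z₁₃ : D⦄ (v₁₂ : X₂ ⟶ Z₁₂) (w₁₂ : Z₁₂ ⟶ T.obj X₁) (v₂₃ : X₃ ⟶ Z₂₃)
    (w₂₃ : Z₂₃ ⟶ T.obj X₂) (v₁₃ : X₃ ⟶ Z₁₃) (w₁₃ : Z₁₃ ⟶ T.obj X₁),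
    Tri.mk u₁₂ v₁₂ w₁₂ ∈ Δ → Tri.mk u₂₃ v₂₃ w₂₃ ∈ Δ → Tri.mk (u₁₂ ≫ u₂₃) v₁₃ w₁₃ ∈ Δ →
      ∃ (m₁ : Z₁₂ ⟶ Z₁₃) (m₃ : Z₁₃ ⟶ Z₂₃), v₁₂ ≫ m₁ = u₂₃ ≫ v₁₃ ∧ m₁ ≫ w₁₃ = w₁₂ ∧
        v₁₃ ≫ m₃ = v₂₃ ∧ w₁₃ ≫ T.map u₁₂ = m₃ ≫ w₂₃ ∧
        Tri.mk m₁ m₃ (w₂₃ ≫ T.map v₁₂) ∈ Δ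

theorem IsPretriangulatedStructure.isTriangulated (hT : IsPretriangulatedStructure T Δ)
    (h : ∀ ⦃X₁ X₂ X₃ : D⦄ (u₁₂ : X₁ ⟶ X₂) (u₂₃ : X₂ ⟶ X₃), HasOctahedron Δ u₁₂ u₂₃) :
    IsTriangulatedStructure T Δ where
  toIsPretriangulatedStructure := hT
  octahedron _ _ _ _ _ _ u₁₂ u₂₃ v₁₂ w₁₂ v₂₃ w₂₃ v₁₃ w₁₃ h₁₂ h₂₃ h₁₃ :=
    h u₁₂ u₂₃ v₁₂ w₁₂ v₂₃ w₂₃ v₁₃ w₁₃ h₁₂ h₂₃ h₁₃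

namespace HasOctahedron

/-- The octahedral axiom for one choice of exact triangles implies the axiom for all choices. -/
theorem of_exists (hT : IsPretriangulatedStructure T Δ) {X₁ X₂ X₃ Z₁₂ Z₂₃ Z₁₃ : D} {u₁₂ : X₁ ⟶ X₂}
    {u₂₃ : X₂ ⟶ X₃} {v₁₂ : X₂ ⟶ Z₁₂} {w₁₂ : Z₁₂ ⟶ T.obj X₁} {v₂₃ : X₃ ⟶ Z₂₃}
    {w₂₃ : Z₂₃ ⟶ T.obj X₂} {v₁₃ : X₃ ⟶ Z₁₃} {w₁₃ : Z₁₃ ⟶ T.obj X₁}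
    (h₁₂ : Tri.mk u₁₂ v₁₂ w₁₂ ∈ Δ) (h₂₃ : Tri.mk u₂₃ v₂₃ w₂₃ ∈ Δ)
    (h₁₃ : Tri.mk (u₁₂ ≫ u₂₃) v₁₃ w₁₃ ∈ Δ) (m₁ : Z₁₂ ⟶ Z₁₃) (m₃ : Z₁₃ ⟶ Z₂₃)
    (e₁ : v₁₂ ≫ m₁ = u₂₃ ≫ v₁₃) (e₂ : m₁ ≫ w₁₃ = w₁₂) (e₃ : v₁₃ ≫ m₃ = v₂₃)
    (e₄ : w₁₃ ≫ T.map u₁₂ = m₃ ≫ w₂₃) (hm : Tri.mk m₁ m₃ (w₂₃ ≫ T.map v₁₂) ∈ Δ) :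
    HasOctahedron Δ u₁₂ u₂₃ := by
  intro Z₁₂' Z₂₃' Z₁₃' v₁₂' w₁₂' v₂₃' w₂₃' v₁₃' w₁₃' h₁₂' h₂₃' h₁₃'
  -- Two cones of the same morphism are isomorphic, compatibly with both structure morphisms, so an
  -- octahedron can be transported from one choice to any other.
  have key : ∀ {A B Z Z' : D} {f : A ⟶ B} {g : B ⟶ Z} {h : Z ⟶ T.obj A} {g' : B ⟶ Z'}
      {h' : Z' ⟶ T.obj A}, Tri.mk f g h ∈ Δ → Tri.mk f g' h' ∈ Δ →
      ∃ c : Z ≅ Z', g ≫ c.hom = g' ∧ c.hom ≫ h' = h := by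
    intro A B Z Z' f g h g' h' hm hm'
    obtain ⟨c, hc⟩ := hT.exists_isHom hm hm' (𝟙 A) (𝟙 B) (by simp)
    have hi : IsIso c := hT.isIso hm hm' hc inferInstance inferInstance
    exact ⟨@asIso _ _ _ _ c hi, by simpa using hc.comm₂, by simpa using hc.comm₃.symm⟩
  obtain ⟨c₁₂, rfl, rfl⟩ := key h₁₂ h₁₂'
  obtain ⟨c₂₃, rfl, rfl⟩ := key h₂₃ h₂₃'
  obtain ⟨c₁₃, rfl, rfl⟩ := key h₁₃ h₁₃'
  refine ⟨c₁₂.inv ≫ m₁ ≫ c₁₃.hom, c₁₃.inv ≫ m₃ ≫ c₂₃.hom, ?_, ?_, ?_, ?_, ?_⟩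
  · simp [reassoc_of% e₁]
  · simp [e₂]
  · simp [reassoc_of% e₃]
  · rw [← cancel_epi c₁₃.hom]; simpa using e₄
  · refine hT.of_isomorphic _ _ ?_ hm
    exact ⟨c₁₂, c₁₃, c₂₃, by simp, by simp, by simp⟩

variable [HasFiniteBiproducts D]

/-- The octahedral axiom may be checked after the addition of a summand to the first object. -/
theorem of_fst (hT : IsPretriangulatedStructure T Δ) {X₁ X₂ X₃ X₁' C : D} {u₁₂ : X₁ ⟶ X₂}
    {u₂₃ : X₂ ⟶ X₃} {i : X₁ ⟶ X₁'} {p : X₁' ⟶ X₁} {j : C ⟶ X₁'} {q : X₁' ⟶ C}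
    (hX : IsBiprod i p j q) (H : HasOctahedron Δ (p ≫ u₁₂) u₂₃) : HasOctahedron Δ u₁₂ u₂₃ := by
  intro Z₁₂ Z₂₃ Z₁₃ v₁₂ w₁₂ v₂₃ w₂₃ v₁₃ w₁₃ h₁₂ h₂₃ h₁₃
  have := hT.additive
  have hX' := hX.map T
  obtain ⟨m₁, m₃, e₁, e₂, e₃, e₄, hm⟩ := H _ _ _ _ _ _ (hT.addLeft h₁₂ hX) h₂₃
    (by rw [Category.assoc]; exact hT.addLeft h₁₃ hX)
  have z : m₁ ≫ m₃ = 0 := (hT.coExact hm).f_g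
  -- Both cones have gained the summand `T C`, and `m₁` respects the projection to it. The wanted
  -- triangle is what remains after this summand is split off.
  have s₁ : m₁ ≫ biprod.snd = biprod.snd := by
    have := e₂ =≫ T.map q
    rw [Category.assoc, show biprod.desc (w₁₃ ≫ T.map i) (T.map j) ≫ T.map q = biprod.snd by
      apply biprod.hom_ext' <;> simp [hX'.i_q, hX'.j_q],
      show biprod.desc (w₁₂ ≫ T.map i) (T.map j) ≫ T.map q = biprod.snd by
      apply biprod.hom_ext' <;> simp [hX'.i_q, hX'.j_q]] at this
    exact this
  have s₂ : biprod.inl ≫ m₁ = (biprod.inl ≫ m₁ ≫ biprod.fst) ≫ biprod.inl := by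
    apply biprod.hom_ext <;> simp [s₁]
  refine ⟨biprod.inl ≫ m₁ ≫ biprod.fst, biprod.inl ≫ m₃, ?_, ?_, ?_, ?_, ?_⟩
  · have := e₁ =≫ biprod.fst
    simpa using this
  · have := biprod.inl ≫= e₂ =≫ T.map p
    rw [Category.assoc, show biprod.desc (w₁₃ ≫ T.map i) (T.map j) ≫ T.map p =
      biprod.fst ≫ w₁₃ by
      apply biprod.hom_ext' <;> simp [hX'.i_p, hX'.j_p]] at this
    simpa [hX'.i_p] using this
  · simpa using e₃
  · have := biprod.inl ≫= e₄
    simpa [reassoc_of% hX'.i_p] using this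
  · have zr : biprod.inr ≫ m₁ ≫ biprod.fst ≫ biprod.inl ≫ m₃ + biprod.inr ≫ m₃ = 0 := by
      have h1 : biprod.inr ≫ m₁ = biprod.inr ≫ m₁ ≫ biprod.fst ≫ biprod.inl + biprod.inr := by
        apply biprod.hom_ext <;> simp [s₁]
      have h2 := biprod.inr ≫= z
      rw [← Category.assoc, h1] at h2
      simpa using h2
    -- The correction term in `b'` cancels the component of `m₁` from `T C` to `Z₁₃`; without it the
    -- retraction would not be a morphism of triangles.
    refine hT.mem_of_retract hm (a := biprod.inl) (b := biprod.inl) (c := 𝟙 _)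
      (a' := biprod.fst) (b' := biprod.desc (𝟙 _) (-(biprod.inr ≫ m₁ ≫ biprod.fst))) (c' := 𝟙 _)
      ⟨?_, ?_, ?_⟩ ⟨?_, ?_, ?_⟩ ?_ ?_ ?_
    · exact s₂.symm
    · simp
    · simp
    · dsimp only
      apply biprod.hom_ext'
      · rw [reassoc_of% s₂]; simp
      · have h1 : biprod.inr ≫ m₁ = biprod.inr ≫ m₁ ≫ biprod.fst ≫ biprod.inl + biprod.inr := by
          apply biprod.hom_ext <;> simp [s₁]
        rw [reassoc_of% h1]; simp
    · dsimp only
      apply biprod.hom_ext'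
      · simp
      · simp only [Category.comp_id, biprod.inr_desc_assoc, Preadditive.neg_comp, Category.assoc]
        rw [eq_neg_iff_add_eq_zero, add_comm]; exact zr
    · dsimp only
      rw [Category.assoc, ← T.map_comp, Category.assoc, biprod.inl_fst, Category.comp_id,
        Category.id_comp]
    · simp
    · simp
    · simp

/-- The octahedral axiom may be checked after the addition of a summand to the second object. -/
theorem of_snd (hT : IsPretriangulatedStructure T Δ) {X₁ X₂ X₃ X₂' C : D} {u₁₂ : X₁ ⟶ X₂}
    {u₂₃ : X₂ ⟶ X₃} {i : X₂ ⟶ X₂'} {p : X₂' ⟶ X₂} {j : C ⟶ X₂'} {q : X₂' ⟶ C}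
    (hX : IsBiprod i p j q) (H : HasOctahedron Δ (u₁₂ ≫ i) (p ≫ u₂₃)) :
    HasOctahedron Δ u₁₂ u₂₃ := by
  intro Z₁₂ Z₂₃ Z₁₃ v₁₂ w₁₂ v₂₃ w₂₃ v₁₃ w₁₃ h₁₂ h₂₃ h₁₃
  have := hT.additive
  have hX' := hX.map T
  obtain ⟨m₁, m₃, e₁, e₂, e₃, e₄, hm⟩ := H _ _ _ _ v₁₃ w₁₃ (hT.addRight h₁₂ hX)
    (hT.addLeft h₂₃ hX) (by rw [Category.assoc, reassoc_of% hX.i_p]; exact h₁₃)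
  -- The first vertex has gained `C` and the third one `T C`. As `m₁` vanishes on `C` and `m₃` has
  -- no component in `T C`, the wanted triangle is a retract with unchanged middle term.
  have r₁ : biprod.inr ≫ m₁ = 0 := by
    have := j ≫= e₁
    rw [← Category.assoc, show j ≫ biprod.lift (p ≫ v₁₂) q = biprod.inr by
      apply biprod.hom_ext <;> simp [reassoc_of% hX.j_p, hX.j_q]] at this
    simpa [reassoc_of% hX.j_p] using this
  have r₃ : m₃ ≫ biprod.snd = 0 := by
    have := e₄ =≫ T.map q
    rw [Category.assoc, Category.assoc,
      show biprod.desc (w₂₃ ≫ T.map i) (T.map j) ≫ T.map q = biprod.snd by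
      apply biprod.hom_ext' <;> simp [hX'.i_q, hX'.j_q]] at this
    simpa [hX'.i_q] using this.symm
  have r₂ : biprod.lift (p ≫ v₁₂) q ≫ biprod.fst = p ≫ v₁₂ := by simp
  refine ⟨biprod.inl ≫ m₁, m₃ ≫ biprod.fst, ?_, ?_, ?_, ?_, ?_⟩
  · have := i ≫= e₁
    rw [← Category.assoc, show i ≫ biprod.lift (p ≫ v₁₂) q = v₁₂ ≫ biprod.inl by
      apply biprod.hom_ext <;> simp [reassoc_of% hX.i_p, hX.i_q]] at this
    simpa [reassoc_of% hX.i_p] using this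
  · rw [Category.assoc, e₂]; simp
  · rw [reassoc_of% e₃]; simp
  · have := e₄ =≫ T.map p
    rw [Category.assoc, Category.assoc,
      show biprod.desc (w₂₃ ≫ T.map i) (T.map j) ≫ T.map p = biprod.fst ≫ w₂₃ by
      apply biprod.hom_ext' <;> simp [hX'.i_p, hX'.j_p]] at this
    simpa [hX'.i_p] using this
  · refine hT.mem_of_retract hm (a := biprod.inl) (b := 𝟙 _) (c := biprod.inl)
      (a' := biprod.fst) (b' := 𝟙 _) (c' := biprod.fst)
      ⟨by simp, ?_, ?_⟩ ⟨?_, by simp, ?_⟩ ?_ ?_ ?_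
    · apply biprod.hom_ext <;> simp [r₃]
    · simp only [biprod.inl_desc_assoc, Category.assoc, ← T.map_comp]
      congr 2
      apply biprod.hom_ext <;> simp [reassoc_of% hX.i_p, hX.i_q]
    · apply biprod.hom_ext' <;> simp [r₁]
    · dsimp only
      rw [Category.assoc, ← T.map_comp, r₂, T.map_comp]
      apply biprod.hom_ext' <;> simp [reassoc_of% hX'.i_p, reassoc_of% hX'.j_p]
    · simp
    · simp
    · simp

/-- The octahedral axiom may be checked after the addition of a summand to the third object. -/
theorem of_thd (hT : IsPretriangulatedStructure T Δ) {X₁ X₂ X₃ X₃' C : D} {u₁₂ : X₁ ⟶ X₂}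
    {u₂₃ : X₂ ⟶ X₃} {i : X₃ ⟶ X₃'} {p : X₃' ⟶ X₃} {j : C ⟶ X₃'} {q : X₃' ⟶ C}
    (hX : IsBiprod i p j q) (H : HasOctahedron Δ u₁₂ (u₂₃ ≫ i)) : HasOctahedron Δ u₁₂ u₂₃ := by
  intro Z₁₂ Z₂₃ Z₁₃ v₁₂ w₁₂ v₂₃ w₂₃ v₁₃ w₁₃ h₁₂ h₂₃ h₁₃
  obtain ⟨m₁, m₃, e₁, e₂, e₃, e₄, hm⟩ := H _ _ _ _ _ _ h₁₂ (hT.addRight h₂₃ hX)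
    (by rw [← Category.assoc]; exact hT.addRight h₁₃ hX)
  have z : m₁ ≫ m₃ = 0 := (hT.coExact hm).f_g
  have li : ∀ {Z : D} (v : X₃ ⟶ Z), i ≫ biprod.lift (p ≫ v) q = v ≫ biprod.inl := fun v => by
    apply biprod.hom_ext <;> simp [reassoc_of% hX.i_p, hX.i_q]
  have lj : ∀ {Z : D} (v : X₃ ⟶ Z), j ≫ biprod.lift (p ≫ v) q = biprod.inr := fun v => by
    apply biprod.hom_ext <;> simp [reassoc_of% hX.j_p, hX.j_q]
  have r₁ : biprod.inr ≫ m₃ = biprod.inr := by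
    have := j ≫= e₃
    rwa [← Category.assoc, lj, lj] at this
  have r₂ : m₁ ≫ biprod.fst ≫ biprod.inl ≫ m₃ ≫ biprod.snd + m₁ ≫ biprod.snd = 0 := by
    have h1 : m₃ ≫ biprod.snd = biprod.fst ≫ biprod.inl ≫ m₃ ≫ biprod.snd + biprod.snd := by
      apply biprod.hom_ext' <;> simp [reassoc_of% r₁]
    have h2 := z =≫ biprod.snd
    rw [Category.assoc, h1] at h2
    simpa using h2
  refine ⟨m₁ ≫ biprod.fst, biprod.inl ≫ m₃ ≫ biprod.fst, ?_, ?_, ?_, ?_, ?_⟩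
  · rw [reassoc_of% e₁]; simp [reassoc_of% hX.i_p]
  · simpa using e₂
  · have := i ≫= e₃
    rw [← Category.assoc, li, li] at this
    simpa using this =≫ biprod.fst
  · have := biprod.inl ≫= e₄
    simpa using this
  · refine hT.mem_of_retract hm (a := 𝟙 _)
      (b := biprod.lift (𝟙 _) (-(biprod.inl ≫ m₃ ≫ biprod.snd))) (c := biprod.inl)
      (a' := 𝟙 _) (b' := biprod.fst) (c' := biprod.fst)
      ⟨?_, ?_, by simp⟩ ⟨by simp, ?_, by simp⟩ ?_ ?_ ?_
    · apply biprod.hom_ext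
      · simp
      · simp only [biprod.lift_snd, Category.assoc, Preadditive.comp_neg, Category.id_comp]
        rw [neg_eq_iff_add_eq_zero]; exact r₂
    · have h1 : biprod.lift (𝟙 Z₁₃) (-(biprod.inl ≫ m₃ ≫ biprod.snd)) =
          biprod.inl - (biprod.inl ≫ m₃ ≫ biprod.snd) ≫ biprod.inr := by
        apply biprod.hom_ext <;> simp
      dsimp only
      rw [h1]
      apply biprod.hom_ext <;> simp [r₁]
    · apply biprod.hom_ext' <;> simp [reassoc_of% r₁]
    · simp
    · simp
    · simp

end HasOctahedron

end Octahedra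

/-! ### Exact categories -/

namespace ExactStructure

attribute [local instance] hasBinaryBiproducts_of_finite_biproducts

variable {C : Type u} [Category.{v} C] [Preadditive C] [HasFiniteBiproducts C]
  {ex : ExactStructure C}

theorem conflation_of_iso {S S' : ShortComplex C} (hS : ex.conflation S) (e : S ≅ S') :
    ex.conflation S' := ex.of_iso _ _ e hS

/-- Kernels are unique up to isomorphism and conflations are closed under isomorphism, so any kernel
of a deflation completes it. -/
theorem Deflation.conflation {X Y Z : C} {d : Y ⟶ Z} (hd : ex.Deflation d) (i : X ⟶ Y)
    (w : i ≫ d = 0) (hi : Mono i) (hl : ∀ ⦃W : C⦄ (k : W ⟶ Y), k ≫ d = 0 → ∃ l, l ≫ i = k) :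
    ex.conflation (ShortComplex.mk i d w) := by
  obtain ⟨X', i', w', hS⟩ := hd
  have hm : Mono i' := mono_f hS
  obtain ⟨l, hl'⟩ := hl i' w'
  obtain ⟨m, hm'⟩ := exists_lift hS i w
  have hm' : m ≫ i' = i := hm'
  refine conflation_of_iso hS (ShortComplex.isoMk ⟨l, m, ?_, ?_⟩ (Iso.refl _) (Iso.refl _) ?_ ?_)
  · rw [← cancel_mono i', Category.assoc, hm', hl', Category.id_comp]
  · rw [← cancel_mono i, Category.assoc, hl', hm', Category.id_comp]
  · simp [hl']
  · simp

theorem Inflation.conflation {X Y Z : C} {i : X ⟶ Y} (hi : ex.Inflation i) (d : Y ⟶ Z)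
    (w : i ≫ d = 0) (hd : Epi d) (hl : ∀ ⦃W : C⦄ (k : Y ⟶ W), i ≫ k = 0 → ∃ l, d ≫ l = k) :
    ex.conflation (ShortComplex.mk i d w) := by
  obtain ⟨Z', d', w', hS⟩ := hi
  have hm : Epi d' := epi_g hS
  obtain ⟨l, hl'⟩ := hl d' w'
  obtain ⟨m, hm'⟩ := exists_desc hS d w
  have hm' : d' ≫ m = d := hm'
  refine conflation_of_iso hS (ShortComplex.isoMk (Iso.refl _) (Iso.refl _) ⟨m, l, ?_, ?_⟩ ?_ ?_)
  · rw [← cancel_epi d', reassoc_of% hm', hl', Category.comp_id]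
  · rw [← cancel_epi d, reassoc_of% hl', hm', Category.comp_id]
  · simp
  · simp [hm']

theorem Deflation.of_isPullback {P Y Z Z' : C} {f' : P ⟶ Y} {d' : P ⟶ Z'} {d : Y ⟶ Z}
    {f : Z' ⟶ Z} (sq : IsPullback f' d' d f) (hd : ex.Deflation d) : ex.Deflation d' := by
  obtain ⟨P', f'', d'', sq', X, i, w, hS⟩ := ex.ex2 f d hd
  let e := sq'.isoIsPullback _ _ sq
  have he : e.hom ≫ d' = d'' := sq'.isoIsPullback_hom_snd _ _ sq
  exact ⟨X, i ≫ e.hom, by rw [Category.assoc, he, w],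
    conflation_of_iso hS (ShortComplex.isoMk (Iso.refl _) e (Iso.refl _) (by simp) (by simp [he]))⟩

theorem Inflation.of_isPushout {X X' Y P : C} {i : X ⟶ Y} {h : X ⟶ X'} {h' : Y ⟶ P} {i' : X' ⟶ P}
    (sq : IsPushout i h h' i') (hi : ex.Inflation i) : ex.Inflation i' := by
  obtain ⟨P', h'', i'', sq', Z, d, w, hS⟩ := ex.ex2op h i hi
  let e := sq'.isoIsPushout _ _ sq
  have he : i'' ≫ e.hom = i' := sq'.inr_isoIsPushout_hom _ _ sq
  have he' : i' ≫ e.inv = i'' := by rw [← he, Category.assoc, e.hom_inv_id, Category.comp_id]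
  exact ⟨Z, e.inv ≫ d, by rw [reassoc_of% he', w],
    conflation_of_iso hS (ShortComplex.isoMk (Iso.refl _) e (Iso.refl _) (by simp [he]) (by simp))⟩

open ZeroObject

variable (ex)

/-- An isomorphism is a pullback of the identity of the zero object, the only deflation supplied
outright by the axioms. -/
theorem deflation_of_isIso {Y Z : C} (e : Y ⟶ Z) [IsIso e] : ex.Deflation e :=
  Deflation.of_isPullback (f' := (0 : Y ⟶ (0 : C))) (d := 𝟙 (0 : C)) (f := (0 : Z ⟶ (0 : C)))
    (IsPullback.of_vert_isIso ⟨by simp⟩) (ex.ex0 0 (isZero_zero C))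

theorem inflation_of_isIso {X Y : C} (e : X ⟶ Y) [IsIso e] : ex.Inflation e := by
  have h : ex.Inflation (𝟙 (0 : C)) := ⟨0, 𝟙 _, (isZero_zero C).eq_of_src _ _,
    Deflation.conflation (ex.ex0 0 (isZero_zero C)) _ _ inferInstance
      (fun W k _ => ⟨k, Category.comp_id k⟩)⟩
  exact Inflation.of_isPushout (h := (0 : (0 : C) ⟶ X)) (h' := (0 : (0 : C) ⟶ Y))
    (IsPushout.of_horiz_isIso ⟨by simp⟩).flip.flip h

theorem conflation_id_zero (X : C) :
    ex.conflation (ShortComplex.mk (𝟙 X) (0 : X ⟶ (0 : C)) comp_zero) :=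
  Inflation.conflation (ex.inflation_of_isIso (𝟙 X)) _ _
    ⟨fun _ _ _ => (isZero_zero C).eq_of_src _ _⟩
    (fun W k hk => ⟨0, by rw [Category.id_comp] at hk; rw [hk, comp_zero]⟩)

theorem deflation_snd (X Y : C) : ex.Deflation (biprod.snd : X ⊞ Y ⟶ Y) :=
  Deflation.of_isPullback (IsPullback.of_has_biproduct X Y) ⟨_, _, _, ex.conflation_id_zero X⟩

variable {ex}

theorem Deflation.comp {X Y Z : C} {d : X ⟶ Y} {d' : Y ⟶ Z} (hd : ex.Deflation d)
    (hd' : ex.Deflation d') : ex.Deflation (d ≫ d') := ex.ex1 _ _ hd hd'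

theorem Deflation.iso_comp {X Y Z : C} (e : X ⟶ Y) [IsIso e] {d : Y ⟶ Z} (hd : ex.Deflation d) :
    ex.Deflation (e ≫ d) := (ex.deflation_of_isIso e).comp hd

theorem Inflation.comp_iso {X Y Z : C} {i : X ⟶ Y} (hi : ex.Inflation i) (e : Y ⟶ Z) [IsIso e] :
    ex.Inflation (i ≫ e) := by
  obtain ⟨W, d, w, hS⟩ := hi
  exact ⟨W, inv e ≫ d, by simp [w], conflation_of_iso hS (ShortComplex.isoMk (Iso.refl _) (asIso e)
    (Iso.refl _) (by simp) (by simp))⟩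

/-- A morphism from a biproduct is a deflation if its second component is. -/
theorem Deflation.desc {P P' X : C} {d : P' ⟶ X} (hd : ex.Deflation d) (e : P ⟶ X) :
    ex.Deflation (biprod.desc e d) := by
  have h1 : ex.Deflation (biprod.map (𝟙 P) d) := by
    refine Deflation.of_isPullback (f' := (biprod.snd : P ⊞ P' ⟶ P')) (f := biprod.snd) ?_ hd
    refine ⟨⟨by simp⟩, ⟨PullbackCone.IsLimit.mk _
      (fun s => biprod.lift (s.snd ≫ biprod.fst) s.fst) (fun s => ?_) (fun s => ?_)
      (fun s m h1 h2 => ?_)⟩⟩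
    · simp
    · apply biprod.hom_ext <;> simp [s.condition]
    · apply biprod.hom_ext
      · have := h2 =≫ biprod.fst
        simpa using this
      · simpa using h1
  -- The morphism factors as `id ⊞ d`, a shear automorphism of `P ⊞ X` and the projection to `X`.
  have h2 : biprod.desc e d = biprod.map (𝟙 P) d ≫
      (biprod.lift biprod.fst (biprod.desc e (𝟙 X))) ≫ biprod.snd := by
    apply biprod.hom_ext' <;> simp
  have h3 : IsIso (biprod.lift (biprod.fst : P ⊞ X ⟶ P) (biprod.desc e (𝟙 X))) :=
    ⟨biprod.lift biprod.fst (biprod.desc (-e) (𝟙 X)), by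
      apply biprod.hom_ext' <;> apply biprod.hom_ext <;> simp, by
      apply biprod.hom_ext' <;> apply biprod.hom_ext <;> simp⟩
  rw [h2]
  exact h1.comp ((ex.deflation_snd P X).iso_comp _)

/-- A pushout of an inflation is an inflation with the same cokernel, so only the cokernel property
of `d'` has to be verified. -/
theorem conflation_pushout {X Y Z X' P : C} {i : X ⟶ Y} {d : Y ⟶ Z} {w : i ≫ d = 0}
    (hS : ex.conflation (ShortComplex.mk i d w)) {h : X ⟶ X'} {h' : Y ⟶ P} {i' : X' ⟶ P}
    {d' : P ⟶ Z} (sq : IsPushout i h h' i') (hd : h' ≫ d' = d) (w' : i' ≫ d' = 0) :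
    ex.conflation (ShortComplex.mk i' d' w') := by
  have he : Epi d := epi_g hS
  refine Inflation.conflation (Inflation.of_isPushout sq ⟨_, _, _, hS⟩) _ _ ⟨fun s t hst => ?_⟩ ?_
  · rw [← cancel_epi d, ← hd, Category.assoc, hst, Category.assoc]
  · intro W k hk
    obtain ⟨l, hl⟩ := exists_desc hS (h' ≫ k) (by
      change i ≫ h' ≫ k = 0
      rw [reassoc_of% sq.w, hk, comp_zero])
    have hl : d ≫ l = h' ≫ k := hl
    refine ⟨l, sq.hom_ext ?_ ?_⟩
    · rw [reassoc_of% hd, hl]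
    · rw [reassoc_of% w', zero_comp, hk]

/-- The pushout of a conflation. -/
theorem exists_pushout {X Y Z X' : C} {i : X ⟶ Y} {d : Y ⟶ Z} {w : i ≫ d = 0}
    (hS : ex.conflation (ShortComplex.mk i d w)) (h : X ⟶ X') :
    ∃ (P : C) (h' : Y ⟶ P) (i' : X' ⟶ P) (d' : P ⟶ Z),
      IsPushout i h h' i' ∧ h' ≫ d' = d ∧ i' ≫ d' = 0 := by
  obtain ⟨P, h', i', sq, hi'⟩ := ex.ex2op h i ⟨_, _, _, hS⟩
  exact ⟨P, h', i', sq.desc d 0 (by simp [w]), sq, sq.inl_desc _ _ _, sq.inr_desc _ _ _⟩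

/-- The conflation of a pushout square. -/
theorem conflation_of_isPushout {X Y Z X' P : C} {i : X ⟶ Y} {d : Y ⟶ Z} {w : i ≫ d = 0}
    (hS : ex.conflation (ShortComplex.mk i d w)) {h : X ⟶ X'} {h' : Y ⟶ P} {i' : X' ⟶ P}
    {d' : P ⟶ Z} (sq : IsPushout i h h' i') (hd : h' ≫ d' = d) (w' : i' ≫ d' = 0) :
    ex.conflation (ShortComplex.mk (biprod.lift i h) (biprod.desc h' (-i'))
      (by rw [biprod.lift_desc, sq.w]; simp)) := by
  have hi : Mono i := mono_f hS
  have hS' := conflation_pushout hS sq hd w'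
  have hi' : Mono i' := mono_f hS'
  -- Over `Z` the object `Y ⊞ X'` is the pullback of `d` and `d'`. Hence its map to `P` is a
  -- deflation, being a base change of `d`.
  have hp : IsPullback (biprod.fst : Y ⊞ X' ⟶ Y) (biprod.desc h' (-i')) d d' := by
    refine ⟨⟨by apply biprod.hom_ext' <;> simp [hd, w']⟩, ⟨?_⟩⟩
    have hl : ∀ s : PullbackCone d d', ∃ l, l ≫ i' = s.snd - s.fst ≫ h' := fun s =>
      exists_lift hS' (s.snd - s.fst ≫ h') (by
        change _ ≫ d' = 0
        rw [Preadditive.sub_comp, Category.assoc, hd, s.condition, sub_self])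
    choose l hl using hl
    refine PullbackCone.IsLimit.mk _ (fun s => biprod.lift s.fst (-l s)) (fun s => by simp)
      (fun s => by simp [hl]) (fun s m h1 h2 => ?_)
    apply biprod.hom_ext
    · simpa using h1
    · rw [← cancel_mono i', biprod.lift_snd, Preadditive.neg_comp, hl, ← h2, ← h1]
      have : biprod.desc h' (-i') = biprod.fst ≫ h' - biprod.snd ≫ i' := by
        apply biprod.hom_ext' <;> simp
      rw [this]
      simp
  refine Deflation.conflation (Deflation.of_isPullback hp ⟨_, _, _, hS⟩) _ _ ⟨fun s t hst => ?_⟩ ?_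
  · have := hst =≫ biprod.fst
    simpa [cancel_mono] using this
  · intro W k hk
    have hk' := hk =≫ d'
    rw [Category.assoc, ← hp.w, zero_comp] at hk'
    obtain ⟨l, hl⟩ := exists_lift hS (k ≫ biprod.fst) (by simpa using hk')
    have hl : l ≫ i = k ≫ biprod.fst := hl
    refine ⟨l, ?_⟩
    apply biprod.hom_ext
    · simp [hl]
    · rw [Category.assoc, biprod.lift_snd, ← cancel_mono i', Category.assoc, ← sq.w,
        reassoc_of% hl]
      have : biprod.desc h' (-i') = biprod.fst ≫ h' - biprod.snd ≫ i' := by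
        apply biprod.hom_ext' <;> simp
      rw [this, Preadditive.comp_sub, sub_eq_zero] at hk
      simpa using hk

/-- A morphism to a biproduct is an inflation if its first component is. -/
theorem Inflation.lift {X Y X' : C} {i : X ⟶ Y} (hi : ex.Inflation i) (h : X ⟶ X') :
    ex.Inflation (biprod.lift i h) := by
  obtain ⟨Z, d, w, hS⟩ := hi
  obtain ⟨P, h', i', d', sq, hd, w'⟩ := exists_pushout hS h
  exact ⟨_, _, _, conflation_of_isPushout hS sq hd w'⟩

theorem Deflation.of_isBiprod {A B M X : C} {i : A ⟶ M} {p : M ⟶ A} {j : B ⟶ M} {q : M ⟶ B}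
    (hM : IsBiprod i p j q) {d : M ⟶ X} (hd : ex.Deflation (i ≫ d)) : ex.Deflation d := by
  have h : IsIso (biprod.lift q p) := ⟨biprod.desc j i, by
    rw [biprod.lift_desc, add_comm]; exact hM.total, by
    apply biprod.hom_ext' <;> apply biprod.hom_ext <;> simp [hM.i_p, hM.j_q, hM.i_q, hM.j_p]⟩
  have : d = biprod.lift q p ≫ biprod.desc (j ≫ d) (i ≫ d) := by
    rw [biprod.lift_desc, add_comm, ← Category.assoc, ← Category.assoc, ← Preadditive.add_comp,
      hM.total, Category.id_comp]
  rw [this]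
  exact (hd.desc _).iso_comp _

theorem Inflation.of_isBiprod {A B M X : C} {i : A ⟶ M} {p : M ⟶ A} {j : B ⟶ M} {q : M ⟶ B}
    (hM : IsBiprod i p j q) {d : X ⟶ M} (hd : ex.Inflation (d ≫ p)) : ex.Inflation d := by
  have h : IsIso (biprod.desc i j) := ⟨biprod.lift p q, by
    apply biprod.hom_ext' <;> apply biprod.hom_ext <;> simp [hM.i_p, hM.j_q, hM.i_q, hM.j_p], by
    rw [biprod.lift_desc]; exact hM.total⟩
  have : d = biprod.lift (d ≫ p) (d ≫ q) ≫ biprod.desc i j := by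
    rw [biprod.lift_desc, Category.assoc, Category.assoc, ← Preadditive.comp_add, hM.total,
      Category.comp_id]
  rw [this]
  exact (hd.lift _).comp_iso _

/-! ### Injective and projective objects -/

theorem IsInjective.of_retract {I J : C} (hI : ex.IsInjective I) (s : J ⟶ I) (r : I ⟶ J)
    (h : s ≫ r = 𝟙 J) : ex.IsInjective J := fun X Y i f hi => by
  obtain ⟨t, ht⟩ := hI i (f ≫ s) hi
  exact ⟨t ≫ r, by rw [reassoc_of% ht, h, Category.comp_id]⟩

theorem IsProjective.of_retract {I J : C} (hI : ex.IsProjective I) (s : J ⟶ I) (r : I ⟶ J)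
    (h : s ≫ r = 𝟙 J) : ex.IsProjective J := fun X Y d f hd => by
  obtain ⟨t, ht⟩ := hI d (r ≫ f) hd
  exact ⟨s ≫ t, by rw [Category.assoc, ht, reassoc_of% h]⟩

theorem IsInjective.biproduct {J : Type w} [Finite J] {A : J → C}
    (h : ∀ j, ex.IsInjective (A j)) : ex.IsInjective (⨁ A) := fun X Y i f hi => by
  choose t ht using fun j => h j i (f ≫ biproduct.π A j) hi
  exact ⟨biproduct.lift t, biproduct.hom_ext _ _ fun j => by simp [ht]⟩

/-- A stably zero morphism extends along every inflation, not just along one into an injective; this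
supplies homotopies with a prescribed source. -/
theorem FactorsInj.exists_of_inflation {X Y J : C} {f : X ⟶ Y} (hf : ex.FactorsInj f)
    {i : X ⟶ J} (hi : ex.Inflation i) : ∃ t : J ⟶ Y, i ≫ t = f := by
  obtain ⟨I, p, q, hI, rfl⟩ := hf
  obtain ⟨s, hs⟩ := hI i p hi
  exact ⟨s ≫ q, by rw [reassoc_of% hs]⟩

/-- Dual statement, where the injective through which `f` factors is used as a projective. -/
theorem FactorsInj.exists_of_deflation (hF : ex.IsFrobenius) {X Y J : C} {f : X ⟶ Y}
    (hf : ex.FactorsInj f) {d : J ⟶ Y} (hd : ex.Deflation d) : ∃ t : X ⟶ J, t ≫ d = f := by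
  obtain ⟨I, p, q, hI, rfl⟩ := hf
  obtain ⟨s, hs⟩ := (hF.projective_iff_injective I).2 hI d q hd
  exact ⟨p ≫ s, by rw [Category.assoc, hs]⟩

/-- A morphism between the right terms of conflations extends to the conflations, if the middle term
of the first one is projective. -/
theorem exists_extension_left {S₁ S₂ : ShortComplex C} (h₂ : ex.conflation S₂)
    (hP : ex.IsProjective S₁.X₂) (f : S₁.X₃ ⟶ S₂.X₃) : ∃ φ : S₁ ⟶ S₂, φ.τ₃ = f := by
  obtain ⟨b, hb⟩ := hP S₂.g (S₁.g ≫ f) ⟨_, S₂.f, S₂.zero, h₂⟩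
  obtain ⟨c, hc⟩ := exists_lift h₂ (S₁.f ≫ b) (by
    rw [Category.assoc, hb, ← Category.assoc, S₁.zero, zero_comp])
  exact ⟨ShortComplex.homMk c b f hc hb, rfl⟩

/-- Converse of `factorsInj_τ₃`, obtained from lifts along deflations; it gives the faithfulness of
the translation functor. -/
theorem factorsInj_τ₁ (hF : ex.IsFrobenius) {S₁ S₂ : ShortComplex C} (h₂ : ex.conflation S₂)
    (hI : ex.IsInjective S₁.X₂) (φ : S₁ ⟶ S₂) (hφ : ex.FactorsInj φ.τ₃) :
    ex.FactorsInj φ.τ₁ := by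
  obtain ⟨t, ht⟩ := hφ.exists_of_deflation hF (d := S₂.g) ⟨_, S₂.f, S₂.zero, h₂⟩
  obtain ⟨k, hk⟩ := exists_lift h₂ (φ.τ₂ - S₁.g ≫ t) (by
    rw [Preadditive.sub_comp, Category.assoc, ht, φ.comm₂₃, sub_self])
  have := mono_f h₂
  refine ⟨S₁.X₂, S₁.f, k, hI, ?_⟩
  rw [← cancel_mono S₂.f, Category.assoc, hk, φ.comm₁₂, Preadditive.comp_sub, ← Category.assoc,
    S₁.zero, zero_comp, sub_zero]

/-- If two conflations have injective middle terms, then a morphism between them that is an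
isomorphism on the left is a stable isomorphism on the right. -/
theorem isIso_toStable_τ₃ {S₁ S₂ : ShortComplex C} (h₁ : ex.conflation S₁) (h₂ : ex.conflation S₂)
    (hI₁ : ex.IsInjective S₁.X₂) (hI₂ : ex.IsInjective S₂.X₂) (φ : S₁ ⟶ S₂) [IsIso φ.τ₁] :
    IsIso (ex.toStable.map φ.τ₃) := by
  obtain ⟨ψ, hψ⟩ := exists_extension h₂ hI₁ (inv φ.τ₁)
  refine ⟨ex.toStable.map ψ.τ₃, ?_, ?_⟩
  · rw [← Functor.map_comp, ← ShortComplex.comp_τ₃, ← ex.toStable.map_id, ← ShortComplex.id_τ₃]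
    exact toStable_τ₃_eq h₁ hI₁ _ _ (by simp [hψ])
  · rw [← Functor.map_comp, ← ShortComplex.comp_τ₃, ← ex.toStable.map_id, ← ShortComplex.id_τ₃]
    exact toStable_τ₃_eq h₂ hI₂ _ _ (by simp [hψ])

theorem toStable_eq_iff {X Y : C} (f g : X ⟶ Y) :
    ex.toStable.map f = ex.toStable.map g ↔ ex.FactorsInj (f - g) :=
  CategoryTheory.Quotient.functor_map_eq_iff _ _ _

end ExactStructure

/-! ### The stable category of a Frobenius category is triangulated -/

namespace ExactStructure

attribute [local instance] hasBinaryBiproducts_of_finite_biproducts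

variable {C : Type u} [Category.{v} C] [Preadditive C] [HasFiniteBiproducts C]
  {ex : ExactStructure C}

namespace Choice

variable (c : ex.Choice)

theorem susp_map_eq {X Y : C} {f : X ⟶ Y} {b : c.I X ⟶ c.I Y} {t : c.S X ⟶ c.S Y}
    (h₁ : f ≫ c.ι Y = c.ι X ≫ b) (h₂ : b ≫ c.π Y = c.π X ≫ t) :
    c.susp.map (ex.toStable.map f) = ex.toStable.map t :=
  c.susp_map (ShortComplex.homMk (S₁ := c.sc X) (S₂ := c.sc Y) f b t h₁ h₂)

theorem exists_ext {X Y : C} (f : X ⟶ Y) : ∃ (b : c.I X ⟶ c.I Y) (t : c.S X ⟶ c.S Y),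
    f ≫ c.ι Y = c.ι X ≫ b ∧ b ≫ c.π Y = c.π X ≫ t := by
  have h₁ := (c.ext f).comm₁₂
  rw [c.ext_τ₁] at h₁
  exact ⟨(c.ext f).τ₂, (c.ext f).τ₃, h₁, (c.ext f).comm₂₃⟩

theorem susp_additive : c.susp.Additive where
  map_add {X Y} f g := by
    obtain ⟨f, rfl⟩ := ex.toStable.map_surjective f
    obtain ⟨g, rfl⟩ := ex.toStable.map_surjective g
    obtain ⟨b, t, h₁, h₂⟩ := c.exists_ext f
    obtain ⟨b', t', h₁', h₂'⟩ := c.exists_ext g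
    rw [← Functor.map_add, c.susp_map_eq h₁ h₂, c.susp_map_eq h₁' h₂',
      c.susp_map_eq (f := f + g) (b := b + b') (t := t + t') (by simp [h₁, h₁'])
        (by simp [h₂, h₂']), Functor.map_add]
    rfl

/-- The objects `c.I X` are also projective, so morphisms of conflations can be built and compared
from the right as well as from the left. For surjectivity on objects, the kernel `X` of a deflation
from a projective onto `Z` satisfies `S X ≅ Z` stably, since both conflations starting at `X` have
injective middle terms. -/
theorem susp_isEquivalence (hF : ex.IsFrobenius) : c.susp.IsEquivalence where
  faithful := ⟨fun {X Y} f g h => by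
    obtain ⟨f, rfl⟩ := ex.toStable.map_surjective f
    obtain ⟨g, rfl⟩ := ex.toStable.map_surjective g
    rw [← c.ext_τ₁ f, ← c.ext_τ₁ g, c.susp_map, c.susp_map] at h
    replace h := (toStable_eq_iff _ _).1 h
    have := factorsInj_τ₁ hF (c.conflation _) (c.injective _) (c.ext f - c.ext g) h
    rw [toStable_eq_iff]
    simpa [c.ext_τ₁] using this⟩
  full := ⟨fun {X Y} f => by
    obtain ⟨f, rfl⟩ := ex.toStable.map_surjective (X := c.S X.as) (Y := c.S Y.as) f
    obtain ⟨φ, hφ⟩ := exists_extension_left (S₁ := c.sc X.as) (c.conflation Y.as)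
      ((hF.projective_iff_injective _).2 (c.injective X.as)) f
    exact ⟨ex.toStable.map φ.τ₁, by rw [← hφ]; exact c.susp_map φ⟩⟩
  essSurj := ⟨fun Z => by
    obtain ⟨P, d, hP, X, i, w, hS⟩ := hF.enoughProjectives Z.as
    obtain ⟨φ, hφ⟩ := exists_extension (S₂ := ShortComplex.mk i d w) (c.conflation X)
      ((hF.projective_iff_injective _).1 hP) (𝟙 X)
    have h1 : IsIso φ.τ₁ := by rw [hφ]; exact (inferInstance : IsIso (𝟙 X))
    have h2 := isIso_toStable_τ₃ (c.conflation X) hS (c.injective X)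
      ((hF.projective_iff_injective _).1 hP) φ
    exact ⟨ex.toStable.obj X, ⟨@asIso _ _ _ _ _ h2⟩⟩⟩

/-- The triangle of the stable category given by three morphisms. -/
abbrev tri {X Y Z : C} (u : X ⟶ Y) (v : Y ⟶ Z) (w : Z ⟶ c.S X) : Tri c.susp :=
  Tri.mk (T := c.susp) (ex.toStable.map u) (ex.toStable.map v) (ex.toStable.map w)

theorem tri_mem {X Y Z : C} {u : X ⟶ Y} {v : Y ⟶ Z} {zero : u ≫ v = 0} {b : Y ⟶ c.I X}
    {w : Z ⟶ c.S X} (hS : ex.conflation (ShortComplex.mk u v zero)) (h₁ : u ≫ b = c.ι X)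
    (h₂ : b ≫ c.π X = v ≫ w) : c.tri u v (-w) ∈ c.exactTriangles :=
  ⟨X, Y, Z, u, v, zero, b, w, hS, h₁, h₂, by rw [tri, Functor.map_neg]; exact Tri.Isomorphic.refl _⟩

/-- The cone of a morphism `f : X ⟶ Y`, i.e. the pushout of `f` and `X ⟶ I X`. -/
structure IsCone {X Y P : C} (f : X ⟶ Y) (a : c.I X ⟶ P) (g : Y ⟶ P) (h : P ⟶ c.S X) : Prop where
  sq : IsPushout (c.ι X) f a g
  a_h : a ≫ h = c.π X
  g_h : g ≫ h = 0

theorem exists_isCone {X Y : C} (f : X ⟶ Y) :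
    ∃ (P : C) (a : c.I X ⟶ P) (g : Y ⟶ P) (h : P ⟶ c.S X), c.IsCone f a g h := by
  obtain ⟨P, a, g, h, sq, h₁, h₂⟩ := exists_pushout (c.conflation X) f
  exact ⟨P, a, g, h, sq, h₁, h₂⟩

variable {c}

/-- The pushout square yields a conflation from `X` to `I X ⊞ Y` to `P`, and `I X ⊞ Y` is stably
isomorphic to `Y`. -/
theorem IsCone.mem {X Y P : C} {f : X ⟶ Y} {a : c.I X ⟶ P} {g : Y ⟶ P} {h : P ⟶ c.S X}
    (H : c.IsCone f a g h) : c.tri f g h ∈ c.exactTriangles := by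
  have hS := conflation_of_isPushout (c.conflation X) H.sq H.a_h H.g_h
  refine ⟨_, _, _, _, _, _, biprod.fst, h, hS, by simp, ?_, ?_⟩
  · apply biprod.hom_ext' <;> simp [H.a_h, H.g_h]
  · have hi : (biprod.inl : c.I X ⟶ c.I X ⊞ Y) ≫ biprod.fst = 𝟙 _ := biprod.inl_fst
    -- The isomorphism `-𝟙` of `P` absorbs two signs: that of `-g` in the conflation and that of the
    -- third morphism in `exactTriangles`.
    refine ⟨Iso.refl _, ⟨ex.toStable.map biprod.snd, ex.toStable.map biprod.inr, ?_, ?_⟩,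
      ⟨-𝟙 _, -𝟙 _, by simp, by simp⟩, ?_, ?_, ?_⟩
    · rw [← Functor.map_comp, ← ex.toStable.map_id, toStable_eq_iff]
      refine ⟨c.I X, biprod.fst, -biprod.inl, c.injective X, ?_⟩
      rw [← biprod.total, sub_add_cancel_right, Preadditive.comp_neg]
    · rw [← Functor.map_comp, biprod.inr_snd, ex.toStable.map_id]
    · change ex.toStable.map _ ≫ ex.toStable.map _ = 𝟙 _ ≫ ex.toStable.map f
      rw [← Functor.map_comp, biprod.lift_snd, Category.id_comp]
    · change ex.toStable.map _ ≫ (-𝟙 _) = ex.toStable.map _ ≫ ex.toStable.map _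
      rw [Preadditive.comp_neg, Category.comp_id, ← Functor.map_neg, ← Functor.map_comp,
        toStable_eq_iff]
      refine ⟨c.I X, biprod.fst, -a, c.injective X, ?_⟩
      apply biprod.hom_ext' <;> simp
    · change (-ex.toStable.map h) ≫ c.susp.map (𝟙 _) = (-𝟙 _) ≫ ex.toStable.map h
      rw [c.susp.map_id, Preadditive.neg_comp (𝟙 _), Category.id_comp]
      exact Category.comp_id _

/-- Each exact triangle is isomorphic to the triangle of a cone. -/
theorem exists_isCone_isomorphic {t : Tri c.susp} (ht : t ∈ c.exactTriangles) :
    ∃ (X Y P : C) (f : X ⟶ Y) (a : c.I X ⟶ P) (g : Y ⟶ P) (h : P ⟶ c.S X),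
      c.IsCone f a g h ∧ (c.tri f g h).Isomorphic t := by
  obtain ⟨X, Y, Z, u, v, zero, b, w, hS, h₁, h₂, ht⟩ := ht
  obtain ⟨P, a, g, h, H⟩ := c.exists_isCone u
  refine ⟨X, Y, P, u, a, g, h, H, Tri.Isomorphic.trans ?_ ht⟩
  have hv : Epi v := epi_g hS
  -- `p` collapses `I X`. It has the strict section `s`, and `𝟙 - p ≫ s = r ≫ a` factors through `I
  -- X`, so `p` is a stable isomorphism from the cone to `Z`.
  let p : P ⟶ Z := H.sq.desc 0 v (by simp [zero])
  have ap : a ≫ p = 0 := H.sq.inl_desc _ _ _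
  have gp : g ≫ p = v := H.sq.inr_desc _ _ _
  let r : P ⟶ c.I X := H.sq.desc (𝟙 _) b (by simp [h₁])
  have ar : a ≫ r = 𝟙 _ := H.sq.inl_desc _ _ _
  have gr : g ≫ r = b := H.sq.inr_desc _ _ _
  obtain ⟨s, hs⟩ := exists_desc hS (g - b ≫ a) (by
    change u ≫ _ = 0
    rw [Preadditive.comp_sub, reassoc_of% h₁, H.sq.w, sub_self])
  have hs : v ≫ s = g - b ≫ a := hs
  have ps : p ≫ s = 𝟙 _ - r ≫ a := by
    apply H.sq.hom_ext
    · rw [reassoc_of% ap, zero_comp, Preadditive.comp_sub, reassoc_of% ar, Category.comp_id,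
        sub_self]
    · rw [reassoc_of% gp, Preadditive.comp_sub, reassoc_of% gr, hs, Category.comp_id]
  have sp : s ≫ p = 𝟙 _ := by
    rw [← cancel_epi v, reassoc_of% hs, Preadditive.sub_comp, gp, Category.assoc, ap, comp_zero,
      sub_zero, Category.comp_id]
  refine ⟨Iso.refl _, Iso.refl _, ⟨ex.toStable.map p, ex.toStable.map s, ?_, ?_⟩, ?_, ?_, ?_⟩
  · rw [← Functor.map_comp, ← ex.toStable.map_id, toStable_eq_iff]
    exact ⟨c.I X, r, -a, c.injective X, by rw [ps]; simp⟩
  · rw [← Functor.map_comp, sp, ex.toStable.map_id]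
  · simp
  · change ex.toStable.map g ≫ ex.toStable.map p = 𝟙 _ ≫ ex.toStable.map v
    rw [← Functor.map_comp, gp, Category.id_comp]
  · change ex.toStable.map h ≫ c.susp.map (𝟙 _) = ex.toStable.map p ≫ (-ex.toStable.map w)
    rw [c.susp.map_id]
    refine (Category.comp_id _).trans ?_
    rw [← Functor.map_neg, ← Functor.map_comp, toStable_eq_iff]
    refine ⟨c.I X, r, c.π X, c.injective X, H.sq.hom_ext ?_ ?_⟩
    · simp [reassoc_of% ar, reassoc_of% ap, H.a_h]
    · simp [reassoc_of% gr, reassoc_of% gp, H.g_h, h₂]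

/-- A stably commutative square commutes up to a morphism that factors through `c.ι X`. Adding this
homotopy `t` on the `I X` part makes the induced morphism of pushouts well defined. -/
theorem IsCone.complete {X Y P X' Y' P' : C} {f : X ⟶ Y} {a : c.I X ⟶ P} {g : Y ⟶ P}
    {h : P ⟶ c.S X} (H : c.IsCone f a g h) {f' : X' ⟶ Y'} {a' : c.I X' ⟶ P'} {g' : Y' ⟶ P'}
    {h' : P' ⟶ c.S X'} (H' : c.IsCone f' a' g' h') (α : ex.toStable.obj X ⟶ ex.toStable.obj X')
    (β : ex.toStable.obj Y ⟶ ex.toStable.obj Y')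
    (e : ex.toStable.map f ≫ β = α ≫ ex.toStable.map f') :
    ∃ γ, (c.tri f g h).IsHom (c.tri f' g' h') α β γ := by
  obtain ⟨α, rfl⟩ := ex.toStable.map_surjective α
  obtain ⟨β, rfl⟩ := ex.toStable.map_surjective β
  have e₀ := e
  rw [← Functor.map_comp, ← Functor.map_comp, toStable_eq_iff] at e
  obtain ⟨t, ht⟩ := e.exists_of_inflation (i := c.ι X) ⟨_, _, _, c.conflation X⟩
  obtain ⟨α₁, α₂, h₁, h₂⟩ := c.exists_ext α
  let γ : P ⟶ P' := H.sq.desc (α₁ ≫ a' + t ≫ g') (β ≫ g') (by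
    rw [Preadditive.comp_add, reassoc_of% ht, ← reassoc_of% h₁, H'.sq.w]
    simp)
  have aγ : a ≫ γ = α₁ ≫ a' + t ≫ g' := H.sq.inl_desc _ _ _
  have gγ : g ≫ γ = β ≫ g' := H.sq.inr_desc _ _ _
  refine ⟨ex.toStable.map γ, e₀, ?_, ?_⟩
  · change ex.toStable.map _ ≫ ex.toStable.map _ = ex.toStable.map _ ≫ ex.toStable.map _
    rw [← Functor.map_comp, gγ, Functor.map_comp]
  · change ex.toStable.map _ ≫ c.susp.map (ex.toStable.map α) =
      ex.toStable.map _ ≫ ex.toStable.map _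
    rw [c.susp_map_eq h₁ h₂]
    refine (ex.toStable.map_comp _ _).symm.trans (Eq.trans ?_ (ex.toStable.map_comp _ _))
    congr 1
    apply H.sq.hom_ext
    · rw [reassoc_of% H.a_h, reassoc_of% aγ, Preadditive.add_comp, Category.assoc, Category.assoc,
        H'.a_h, H'.g_h, h₂, comp_zero, add_zero]
    · rw [reassoc_of% H.g_h, reassoc_of% gγ, H'.g_h, zero_comp, comp_zero]

/-- The pushout of `X ⟶ I X ⟶ S X` along `f` is the conflation from `Y` to `P` to `S X`, whose
comparison with the chosen conflation of `Y` ends in a representative of `S f`. The sign in the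
definition of exact triangles is the one in the rotation. -/
theorem IsCone.rot_mem {X Y P : C} {f : X ⟶ Y} {a : c.I X ⟶ P} {g : Y ⟶ P} {h : P ⟶ c.S X}
    (H : c.IsCone f a g h) : (c.tri f g h).rot ∈ c.exactTriangles := by
  obtain ⟨f₁, f₂, h₁, h₂⟩ := c.exists_ext f
  let b : P ⟶ c.I Y := H.sq.desc f₁ (c.ι Y) h₁.symm
  have ab : a ≫ b = f₁ := H.sq.inl_desc _ _ _
  have gb : g ≫ b = c.ι Y := H.sq.inr_desc _ _ _
  have := c.tri_mem (conflation_pushout (c.conflation X) H.sq H.a_h H.g_h) (b := b) (w := f₂) gb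
    (H.sq.hom_ext (by rw [reassoc_of% ab, reassoc_of% H.a_h, h₂])
      (by rw [reassoc_of% gb, reassoc_of% H.g_h, c.zero, zero_comp]))
  rw [tri, Functor.map_neg, ← c.susp_map_eq h₁ h₂] at this
  exact this

-- Up to isomorphism every exact triangle is the triangle of a cone, which reduces rotation and
-- completion to `IsCone.rot_mem` and `IsCone.complete`. Rotation is needed in one direction only.
open ZeroObject in
theorem isPretriangulated (hF : ex.IsFrobenius) :
    IsPretriangulatedStructure c.susp c.exactTriangles := by
  apply IsForwardPretriangulated.toPretriangulated
  refine ⟨inferInstance, c.susp_isEquivalence hF, c.susp_additive, ?_, ?_, ?_, ?_, ?_⟩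
  · rintro t t' h ⟨X, Y, Z, u, v, zero, b, w, hS, h₁, h₂, ht⟩
    exact ⟨X, Y, Z, u, v, zero, b, w, hS, h₁, h₂, ht.trans h⟩
  · intro X Z hZ
    refine ⟨_, _, _, _, _, _, c.ι X.as, 0, ex.conflation_id_zero X.as, by simp, by simp [c.zero],
      ?_⟩
    have hz : IsZero (ex.toStable.obj (0 : C)) := ex.toStable.map_isZero (isZero_zero C)
    refine ⟨Iso.refl _, Iso.refl _, hz.iso hZ, ?_, hZ.eq_of_tgt _ _, hz.eq_of_src _ _⟩
    change ex.toStable.map (𝟙 _) ≫ 𝟙 _ = 𝟙 _ ≫ 𝟙 _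
    rw [ex.toStable.map_id]
  · intro X Y f
    obtain ⟨f, rfl⟩ := ex.toStable.map_surjective (X := X.as) (Y := Y.as) f
    obtain ⟨P, a, g, h, H⟩ := c.exists_isCone f
    exact ⟨_, _, _, H.mem⟩
  · intro t ht
    obtain ⟨X, Y, P, f, a, g, h, H, ht⟩ := exists_isCone_isomorphic ht
    obtain ⟨X', Y', Z', u, v, zero, b, w, hS, h₁, h₂, hr⟩ := H.rot_mem
    obtain ⟨α, β, γ, h⟩ := ht.exists_isHom
    exact ⟨X', Y', Z', u, v, zero, b, w, hS, h₁, h₂, hr.trans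
      (h.rot.isomorphic inferInstance inferInstance inferInstance)⟩
  · intro t t' ht ht' α β e
    obtain ⟨X, Y, P, f, a, g, h, H, ht⟩ := exists_isCone_isomorphic ht
    obtain ⟨X', Y', P', f', a', g', h', H', ht'⟩ := exists_isCone_isomorphic ht'
    obtain ⟨i, j, k, hi⟩ := ht.exists_isHom
    obtain ⟨i', j', k', hi'⟩ := ht'.exists_isHom
    obtain ⟨γ, hγ⟩ := H.complete H' (i.hom ≫ α ≫ i'.inv) (j.hom ≫ β ≫ j'.inv) (by
      have h1 := hi.comm₁
      have h2 := hi'.symm.comm₁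
      dsimp only at h1 h2
      rw [reassoc_of% h1, reassoc_of% e, h2, Category.assoc, Category.assoc])
    have := (hi.symm.comp hγ).comp hi'
    refine ⟨k.inv ≫ γ ≫ k'.hom, ?_⟩
    simpa using this

/-- The octahedral axiom for a morphism and an inflation. -/
theorem hasOctahedron_of_inflation (hF : ex.IsFrobenius) {X Y Z : C} (f : X ⟶ Y) (v : Y ⟶ Z)
    (hv : ex.Inflation v) :
    HasOctahedron c.exactTriangles (ex.toStable.map f) (ex.toStable.map v) := by
  obtain ⟨W, d, zero, hS⟩ := hv
  obtain ⟨P₁, a, g, h, H⟩ := c.exists_isCone f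
  -- Pushing `Y ⟶ Z ⟶ W` out along `g` gives the whole octahedron: by pasting of pushouts `P` is the
  -- cone of `f ≫ v`, and `P₁ ⟶ P ⟶ W` is a conflation.
  obtain ⟨P, z, m₁, m₃, sq, hz, zero'⟩ := exists_pushout hS g
  have hS' := conflation_pushout hS sq hz zero'
  have sq' := H.sq.paste_vert sq.flip
  obtain ⟨b, hb⟩ := c.injective Y v (c.ι Y) ⟨_, _, _, hS⟩
  obtain ⟨w, hw⟩ := exists_desc hS (b ≫ c.π Y) (by
    change v ≫ _ = 0
    rw [reassoc_of% hb, c.zero])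
  have hw : d ≫ w = b ≫ c.π Y := hw
  let k : P ⟶ c.S X := sq'.desc (c.π X) 0 (by simp [c.zero])
  have ak : (a ≫ m₁) ≫ k = c.π X := sq'.inl_desc _ _ _
  have zk : z ≫ k = 0 := sq'.inr_desc _ _ _
  have H₁₃ : c.IsCone (f ≫ v) (a ≫ m₁) z k := ⟨sq', ak, zk⟩
  have h₁₃ := H₁₃.mem
  obtain ⟨f₁, f₂, ef₁, ef₂⟩ := c.exists_ext f
  obtain ⟨g₁, g₂, eg₁, eg₂⟩ := c.exists_ext g
  refine HasOctahedron.of_exists (isPretriangulated hF) H.mem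
    (c.tri_mem hS hb hw.symm) (m₁ := ex.toStable.map m₁) (m₃ := ex.toStable.map m₃)
    (v₁₃ := ex.toStable.map z) (w₁₃ := ex.toStable.map k) (by rw [← Functor.map_comp]; exact h₁₃)
    ?_ ?_ ?_ ?_ ?_
  · rw [← Functor.map_comp, ← Functor.map_comp, sq.w]
  · refine (ex.toStable.map_comp _ _).symm.trans ?_
    congr 1
    apply H.sq.hom_ext
    · rw [H.a_h, ← ak, Category.assoc]
    · rw [← reassoc_of% sq.w, zk, H.g_h, comp_zero]
  · rw [← Functor.map_comp, hz]
  · rw [c.susp_map_eq ef₁ ef₂]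
    refine (ex.toStable.map_comp _ _).symm.trans (Eq.trans ?_ (ex.toStable.map_comp _ _))
    rw [toStable_eq_iff]
    -- The two sides agree only stably: their difference is `l ≫ c.π Y`.
    let l : P ⟶ c.I Y := sq'.desc f₁ b (by rw [Category.assoc, hb, ef₁])
    have al : (a ≫ m₁) ≫ l = f₁ := sq'.inl_desc _ _ _
    have zl : z ≫ l = b := sq'.inr_desc _ _ _
    refine ⟨c.I Y, l, c.π Y, c.injective Y, sq'.hom_ext ?_ ?_⟩
    · rw [← Category.assoc, al, Preadditive.comp_sub, ← Category.assoc, ak, Category.assoc,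
        reassoc_of% zero', zero_comp, comp_zero, sub_zero, ef₂]
    · rw [reassoc_of% zl, Preadditive.comp_sub, reassoc_of% zk, reassoc_of% hz,
        Preadditive.comp_neg, zero_comp, zero_sub, neg_neg, hw]
  -- `b'` extends `c.ι P₁` along `m₁` and identifies the connecting morphism of `P₁ ⟶ P ⟶ W` with `w
  -- ≫ g₂`, that is, `w` followed by the translate of `g`.
  · let b' : P ⟶ c.I P₁ := sq.desc (b ≫ g₁) (c.ι P₁) (by rw [reassoc_of% hb, eg₁])
    have zb : z ≫ b' = b ≫ g₁ := sq.inl_desc _ _ _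
    have mb : m₁ ≫ b' = c.ι P₁ := sq.inr_desc _ _ _
    have := c.tri_mem hS' (b := b') (w := w ≫ g₂) mb (sq.hom_ext
      (by rw [reassoc_of% zb, reassoc_of% hz, eg₂, reassoc_of% hw])
      (by rw [reassoc_of% mb, reassoc_of% zero', c.zero, zero_comp]))
    rw [c.susp_map_eq eg₁ eg₂]
    refine Eq.mp ?_ this
    rw [tri, ← Preadditive.neg_comp, Functor.map_comp]
    rfl

variable (c) in
/-- The stable category of a Frobenius category is triangulated. -/
theorem isTriangulated (hF : ex.IsFrobenius) :
    IsTriangulatedStructure c.susp c.exactTriangles := by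
  refine (isPretriangulated hF).isTriangulated fun X Y Z f g => ?_
  obtain ⟨f, rfl⟩ := ex.toStable.map_surjective (X := X.as) (Y := Y.as) f
  obtain ⟨g, rfl⟩ := ex.toStable.map_surjective (X := Y.as) (Y := Z.as) g
  have hB : IsBiprod (biprod.inr : Z.as ⟶ c.I Y.as ⊞ Z.as) biprod.snd biprod.inl biprod.fst :=
    ⟨biprod.inr_snd, biprod.inl_fst, biprod.inr_fst, biprod.inl_snd, by
      rw [add_comm]; exact biprod.total⟩
  -- Adding the stably trivial summand `I Y` to the target replaces `g` by the inflation `(ι, g)`.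
  refine HasOctahedron.of_thd (isPretriangulated hF) (hB.map ex.toStable) ?_
  have := hasOctahedron_of_inflation (c := c) hF f (biprod.lift (c.ι Y.as) g)
    (Inflation.lift ⟨_, _, _, c.conflation Y.as⟩ g)
  have e : ex.toStable.map (biprod.lift (c.ι Y.as) g) =
      ex.toStable.map g ≫ ex.toStable.map biprod.inr := by
    rw [← Functor.map_comp, toStable_eq_iff]
    refine ⟨c.I Y.as, c.ι Y.as, biprod.inl, c.injective _, ?_⟩
    apply biprod.hom_ext <;> simp
  rw [e] at this
  exact this

end Choice

end ExactStructure

/-! ### Averages of morphisms -/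

section Averages

attribute [local instance] Fintype.ofFinite

variable {G : Type w} [Group G] {C : Type u} [Category.{v} C] {a : RightAction G C}

theorem RightAction.δ_naturality (a : RightAction G C) (g h k : G) (e : h * g = k) {A B : C}
    (f : A ⟶ B) : (a.F g).map ((a.F h).map f) ≫ (a.δ g h k e).hom.app B =
      (a.δ g h k e).hom.app A ≫ (a.F k).map f :=
  (a.δ g h k e).hom.naturality f

/-- The action of `g` on the morphisms of `C` between the objects underlying two equivariant
objects. -/
def conj (X Y : EquivObj a) (g : G) (f : X.obj ⟶ Y.obj) : X.obj ⟶ Y.obj :=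
  (X.lam g).inv ≫ (a.F g).map f ≫ (Y.lam g).hom

theorem map_comp_lam {X Y : EquivObj a} (g : G) (f : X.obj ⟶ Y.obj) :
    (a.F g).map f ≫ (Y.lam g).hom = (X.lam g).hom ≫ conj X Y g f := by
  simp [conj]

/-- The compatibilities `lam_mul` of both objects and the naturality of `δ` make `conj` a right
action of the group on morphisms. -/
theorem conj_conj {X Y : EquivObj a} (g h : G) (f : X.obj ⟶ Y.obj) :
    conj X Y h (conj X Y g f) = conj X Y (g * h) f := by
  have h1 := X.lam_mul h g _ rfl
  have h2 := Y.lam_mul h g _ rfl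
  rw [← cancel_epi (X.lam h).hom, ← map_comp_lam, ← cancel_epi ((a.F h).map (X.lam g).hom),
    ← Functor.map_comp_assoc, ← map_comp_lam, Functor.map_comp, Category.assoc, h2,
    reassoc_of% h1, ← map_comp_lam, reassoc_of% (a.δ_naturality h g _ rfl f)]

theorem conj_hom {X Y : EquivObj a} (g : G) (f : X ⟶ Y) : conj X Y g f.hom = f.hom :=
  f.invariant g

theorem conj_comp {X Y Z : EquivObj a} (g : G) (f : X.obj ⟶ Y.obj) (k : Y.obj ⟶ Z.obj) :
    conj X Z g (f ≫ k) = conj X Y g f ≫ conj Y Z g k := by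
  simp [conj]

variable [Preadditive C] [HasFiniteBiproducts C]

theorem conj_sum {ι : Type*} {X Y : EquivObj a} (g : G) (s : Finset ι)
    (f : ι → (X.obj ⟶ Y.obj)) : conj X Y g (∑ i ∈ s, f i) = ∑ i ∈ s, conj X Y g (f i) := by
  simp only [conj, Functor.map_sum, Preadditive.sum_comp, Preadditive.comp_sum]

theorem conj_nsmul {X Y : EquivObj a} (g : G) (n : ℕ) (f : X.obj ⟶ Y.obj) :
    conj X Y g (n • f) = n • conj X Y g f := by
  simp only [conj, Functor.map_nsmul, Preadditive.nsmul_comp, Preadditive.comp_nsmul]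

theorem InvertibleIn.cancel {n : ℕ} {D : Type u} [Category.{v} D] [Preadditive D]
    (hn : InvertibleIn n D) {X Y : D} {f g : X ⟶ Y} (h : n • f = n • g) : f = g :=
  (hn (n • g)).unique h rfl

variable [Finite G]

/-- The sum of all translates is invariant, by reindexing with right multiplication; its quotient by
$|G|$ is invariant because division is unique. -/
theorem exists_average (hG : InvertibleIn (Nat.card G) C) {X Y : EquivObj a} (f : X.obj ⟶ Y.obj) :
    ∃ f' : X ⟶ Y, Nat.card G • f'.hom = ∑ g : G, conj X Y g f := by
  obtain ⟨k, hk, -⟩ := hG (∑ g : G, conj X Y g f)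
  refine ⟨⟨k, fun h => hG.cancel ?_⟩, hk⟩
  change Nat.card G • conj X Y h k = _
  rw [← conj_nsmul, hk, conj_sum]
  simp only [conj_conj]
  exact Fintype.sum_equiv (Equiv.mulRight h) _ _ (fun _ => rfl)

/-- The average of a morphism under the action of the group. -/
def average (hG : InvertibleIn (Nat.card G) C) {X Y : EquivObj a} (f : X.obj ⟶ Y.obj) : X ⟶ Y :=
  (exists_average hG f).choose

variable (hG : InvertibleIn (Nat.card G) C)

theorem nsmul_average {X Y : EquivObj a} (f : X.obj ⟶ Y.obj) :
    Nat.card G • (average hG f).hom = ∑ g : G, conj X Y g f :=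
  (exists_average hG f).choose_spec

theorem average_eq {X Y : EquivObj a} {f : X.obj ⟶ Y.obj} {k : X ⟶ Y}
    (h : Nat.card G • k.hom = ∑ g : G, conj X Y g f) : average hG f = k :=
  EquivObj.hom_ext (hG.cancel ((nsmul_average hG f).trans h.symm))

theorem average_hom {X Y : EquivObj a} (f : X ⟶ Y) : average hG f.hom = f :=
  average_eq hG (by simp [conj_hom])

/-- Equivariant morphisms are fixed by `conj`, hence can be pulled out of the sum. This turns
solutions of equations in `C` into equivariant ones. -/
theorem average_comp {X Y Z : EquivObj a} (u : X ⟶ Y) (f : Y.obj ⟶ Z.obj) :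
    average hG (u.hom ≫ f) = u ≫ average hG f :=
  average_eq hG (by
    rw [EquivObj.comp_hom, ← Preadditive.comp_nsmul, nsmul_average, Preadditive.comp_sum]
    simp only [conj_comp, conj_hom])

theorem comp_average {X Y Z : EquivObj a} (f : X.obj ⟶ Y.obj) (u : Y ⟶ Z) :
    average hG (f ≫ u.hom) = average hG f ≫ u :=
  average_eq hG (by
    rw [EquivObj.comp_hom, ← Preadditive.nsmul_comp, nsmul_average, Preadditive.sum_comp]
    simp only [conj_comp, conj_hom])

end Averages

/-! ### Induced equivariant objects -/

theorem biproduct_total {C : Type u} [Category.{v} C] [Preadditive C] [HasFiniteBiproducts C]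
    {J : Type w} [Fintype J] (A : J → C) : ∑ j, biproduct.π A j ≫ biproduct.ι A j = 𝟙 (⨁ A) := by
  refine biproduct.hom_ext' _ _ fun j => ?_
  rw [Preadditive.comp_sum, Finset.sum_eq_single j]
  · rw [biproduct.ι_π_self_assoc, Category.comp_id]
  · intro k _ hk
    rw [← Category.assoc, biproduct.ι_π_ne _ hk.symm, zero_comp]
  · simp

section Induced

attribute [local instance] Fintype.ofFinite

variable {G : Type w} [Group G] [Finite G] {C : Type u} [Category.{v} C] [Preadditive C]

/-- The equivariant object induced by `X`: the biproduct of the objects `F g X`, permuted by the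
action. -/
structure Induced (a : RightAction G C) (X : C) where
  M : EquivObj a
  i : ∀ g, (a.F g).obj X ⟶ M.obj
  p : ∀ g, M.obj ⟶ (a.F g).obj X
  i_p : ∀ g, i g ≫ p g = 𝟙 _
  i_p_ne : ∀ g h, g ≠ h → i g ≫ p h = 0
  total : ∑ g, p g ≫ i g = 𝟙 _
  i_lam : ∀ (h g r : G) (e : g * h = r),
    (a.F h).map (i g) ≫ (M.lam h).hom = (a.δ h g r e).hom.app X ≫ i r

namespace Induced

variable {a : RightAction G C} {X : C} (I : Induced a X)

theorem i_sum {W : C} (f : ∀ g, (a.F g).obj X ⟶ W) (g : G) :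
    I.i g ≫ ∑ h, I.p h ≫ f h = f g := by
  rw [Preadditive.comp_sum, Finset.sum_eq_single g]
  · rw [← Category.assoc, I.i_p, Category.id_comp]
  · intro h _ hh
    rw [← Category.assoc, I.i_p_ne g h hh.symm, zero_comp]
  · simp

theorem sum_p {W : C} (f : ∀ g, W ⟶ (a.F g).obj X) (g : G) :
    (∑ h, f h ≫ I.i h) ≫ I.p g = f g := by
  rw [Preadditive.sum_comp, Finset.sum_eq_single g]
  · rw [Category.assoc, I.i_p, Category.comp_id]
  · intro h _ hh
    rw [Category.assoc, I.i_p_ne h g hh, comp_zero]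
  · simp

variable [HasFiniteBiproducts C]

theorem map_hom_ext {W : C} (k : G) {s t : (a.F k).obj I.M.obj ⟶ W}
    (h : ∀ g, (a.F k).map (I.i g) ≫ s = (a.F k).map (I.i g) ≫ t) : s = t := by
  rw [← Category.id_comp s, ← Category.id_comp t, ← (a.F k).map_id, ← I.total]
  simp only [Functor.map_sum, Functor.map_comp, Preadditive.sum_comp, Category.assoc, h]

/-- The morphism from an induced object given by a morphism in `C`. -/
def desc {Y : EquivObj a} (f : X ⟶ Y.obj) : I.M ⟶ Y :=
  EquivObj.homMk (∑ g, I.p g ≫ (a.F g).map f ≫ (Y.lam g).hom) (fun h => I.map_hom_ext h (by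
    intro g
    rw [← Functor.map_comp_assoc, I.i_sum (fun g => (a.F g).map f ≫ (Y.lam g).hom),
      ← Category.assoc ((a.F h).map (I.i g)), I.i_lam h g _ rfl, Category.assoc,
      I.i_sum (fun g => (a.F g).map f ≫ (Y.lam g).hom), Functor.map_comp, Category.assoc,
      Y.lam_mul h g _ rfl, reassoc_of% (a.δ_naturality h g _ rfl f)]))

theorem i_desc {Y : EquivObj a} (f : X ⟶ Y.obj) (g : G) :
    I.i g ≫ (I.desc f).hom = (a.F g).map f ≫ (Y.lam g).hom :=
  I.i_sum (fun g => (a.F g).map f ≫ (Y.lam g).hom) g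

/-- The morphism to an induced object given by a morphism in `C`. -/
def lift {Y : EquivObj a} (f : Y.obj ⟶ X) : Y ⟶ I.M :=
  EquivObj.homMk (∑ g, ((Y.lam g).inv ≫ (a.F g).map f) ≫ I.i g) (fun h => by
    rw [Functor.map_sum, Preadditive.sum_comp, Preadditive.comp_sum]
    refine Fintype.sum_equiv (Equiv.mulRight h) _ _ (fun g => ?_)
    have h2 := Y.lam_mul h g _ rfl
    rw [← cancel_epi ((a.F h).map (Y.lam g).hom), reassoc_of% h2]
    simp only [Functor.map_comp, Category.assoc, I.i_lam h g _ rfl, Equiv.coe_mulRight,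
      Iso.hom_inv_id_assoc]
    rw [← Functor.map_comp_assoc, Iso.hom_inv_id, (a.F h).map_id, Category.id_comp,
      reassoc_of% (a.δ_naturality h g _ rfl f)])

theorem lift_p {Y : EquivObj a} (f : Y.obj ⟶ X) (g : G) :
    (I.lift f).hom ≫ I.p g = (Y.lam g).inv ≫ (a.F g).map f :=
  I.sum_p (fun g => (Y.lam g).inv ≫ (a.F g).map f) g

/-- Each equivariant object is a retract of the induced one. -/
theorem exists_retract (hG : InvertibleIn (Nat.card G) C) {Y : EquivObj a}
    (I : Induced a Y.obj) : ∃ (s : Y ⟶ I.M) (r : I.M ⟶ Y), s ≫ r = 𝟙 Y := by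
  -- Each `g` contributes the identity, in the form of `(Y.lam g).inv` followed by `(Y.lam g).hom`.
  have h : (I.lift (𝟙 Y.obj)).hom ≫ (I.desc (𝟙 Y.obj)).hom = Nat.card G • 𝟙 _ := by
    change (∑ g, ((Y.lam g).inv ≫ (a.F g).map _) ≫ I.i g) ≫ _ = _
    simp only [Preadditive.sum_comp, Category.assoc, I.i_desc]
    simp
  obtain ⟨k, hk, -⟩ := hG (I.desc (𝟙 Y.obj)).hom
  have hk' : (I.lift (𝟙 Y.obj)).hom ≫ k = 𝟙 _ := hG.cancel (by
    rw [← Preadditive.comp_nsmul, hk, h])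
  exact ⟨I.lift (𝟙 Y.obj), average hG k, by
    rw [← average_comp, hk']; exact average_hom hG (𝟙 Y)⟩

end Induced

variable [HasFiniteBiproducts C] (a : RightAction G C) (X : C)

/-- The objects `F g X`. -/
abbrev RightAction.orbit (g : G) : C := (a.F g).obj X

/-- The action of `h` on the induced object. -/
def inducedLam (h : G) :
    (a.F h).obj (⨁ a.orbit X) ≅ ⨁ a.orbit X where
  hom := ∑ g, (a.F h).map (biproduct.π (a.orbit X) g) ≫ (a.δ h g _ rfl).hom.app X ≫
    biproduct.ι (a.orbit X) (g * h)
  inv := ∑ g, biproduct.π (a.orbit X) (g * h) ≫ (a.δ h g _ rfl).inv.app X ≫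
    (a.F h).map (biproduct.ι (a.orbit X) g)
  hom_inv_id := by
    rw [Preadditive.sum_comp]
    trans ∑ g, (a.F h).map (biproduct.π (a.orbit X) g ≫ biproduct.ι (a.orbit X) g)
    · refine Finset.sum_congr rfl fun g _ => ?_
      rw [Preadditive.comp_sum, Finset.sum_eq_single g]
      · simp
      · intro k _ hk
        simp only [Category.assoc]
        rw [biproduct.ι_π_ne_assoc _ (fun e => hk (mul_right_cancel e).symm)]
        simp
      · simp
    · rw [← Functor.map_sum, biproduct_total, (a.F h).map_id]
  inv_hom_id := by
    rw [Preadditive.sum_comp]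
    trans ∑ g, biproduct.π (a.orbit X) (g * h) ≫ biproduct.ι (a.orbit X) (g * h)
    · refine Finset.sum_congr rfl fun g _ => ?_
      rw [Preadditive.comp_sum, Finset.sum_eq_single g]
      · simp only [Category.assoc]
        rw [← Functor.map_comp_assoc, biproduct.ι_π_self, (a.F h).map_id, Category.id_comp,
          Iso.inv_hom_id_app_assoc]
      · intro k _ hk
        simp only [Category.assoc]
        rw [← Functor.map_comp_assoc, biproduct.ι_π_ne _ hk.symm]
        simp
      · simp
    · rw [← biproduct_total]
      exact Fintype.sum_equiv (Equiv.mulRight h) _ _ (fun _ => rfl)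

/-- Describes the action by its restriction to summands, with a free index `r` so that the cocycle
condition can be used without transport along associativity. -/
theorem map_ι_inducedLam (h g r : G) (e : g * h = r) :
    (a.F h).map (biproduct.ι (a.orbit X) g) ≫ (inducedLam a X h).hom =
      (a.δ h g r e).hom.app X ≫ biproduct.ι (a.orbit X) r := by
  subst e
  rw [inducedLam, Preadditive.comp_sum, Finset.sum_eq_single g]
  · rw [← Functor.map_comp_assoc, biproduct.ι_π_self, (a.F h).map_id, Category.id_comp]
  · intro k _ hk
    rw [← Functor.map_comp_assoc, biproduct.ι_π_ne _ hk.symm]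
    simp
  · simp

/-- The induced equivariant object. -/
def induced : Induced a X where
  M :=
    { obj := ⨁ a.orbit X
      lam := inducedLam a X
      lam_mul := fun g h k e => by
        -- The functors are additive, so morphisms out of `F g (F h (⨁ …))` are determined by the
        -- images of the inclusions.
        have key : ∀ {W : C} {s t : (a.F g).obj ((a.F h).obj (⨁ a.orbit X)) ⟶ W},
            (∀ l, (a.F g).map ((a.F h).map (biproduct.ι (a.orbit X) l)) ≫ s =
              (a.F g).map ((a.F h).map (biproduct.ι (a.orbit X) l)) ≫ t) → s = t := by
          intro W s t hst
          rw [← Category.id_comp s, ← Category.id_comp t, ← (a.F g).map_id, ← (a.F h).map_id,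
            ← biproduct_total]
          simp only [Functor.map_sum, Functor.map_comp, Preadditive.sum_comp, Category.assoc, hst]
        apply key
        intro l
        -- On the summand with index `l` the required identity is the 2-cocycle condition for `g`,
        -- `h`, `l` at `X`.
        rw [← Functor.map_comp_assoc, map_ι_inducedLam a X h l _ rfl, Functor.map_comp,
          Category.assoc, map_ι_inducedLam a X g _ (l * k) (by rw [← e, mul_assoc]),
          reassoc_of% (a.cocycle g h l (l * h) k (l * k) rfl (by rw [← e, mul_assoc]) e rfl X),
          reassoc_of% (a.δ_naturality g h k e (biproduct.ι (a.orbit X) l)),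
          map_ι_inducedLam a X k l _ rfl] }
  i g := biproduct.ι (a.orbit X) g
  p g := biproduct.π (a.orbit X) g
  i_p g := biproduct.ι_π_self _ _
  i_p_ne g h hgh := biproduct.ι_π_ne _ hgh
  total := biproduct_total _
  i_lam := map_ι_inducedLam a X

end Induced

/-- A summand of a finite biproduct has a complement. -/
theorem exists_isBiprod_ι {C : Type u} [Category.{v} C] [Preadditive C] [HasFiniteBiproducts C]
    {J : Type w} [Finite J] (A : J → C) (j₀ : J) :
    ∃ (B : C) (j : B ⟶ ⨁ A) (q : ⨁ A ⟶ B), IsBiprod (biproduct.ι A j₀) (biproduct.π A j₀) j q := by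
  classical
  refine ⟨⨁ (fun k : {k // k ≠ j₀} => A k), biproduct.desc (fun k => biproduct.ι A k),
    biproduct.lift (fun k => biproduct.π A k), biproduct.ι_π_self _ _, ?_, ?_, ?_, ?_⟩
  · refine biproduct.hom_ext' _ _ fun k => biproduct.hom_ext _ _ fun l => ?_
    by_cases h : k = l
    · subst h; simp
    · have h' : (k : J) ≠ l := fun e => h (Subtype.ext e)
      simp [biproduct.ι_π_ne _ h, biproduct.ι_π_ne _ h']
  · refine biproduct.hom_ext _ _ fun l => ?_
    simp [biproduct.ι_π_ne _ l.2.symm]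
  · refine biproduct.hom_ext' _ _ fun l => ?_
    simp [biproduct.ι_π_ne _ l.2]
  · refine biproduct.hom_ext' _ _ fun l => ?_
    rw [Preadditive.comp_add, Category.comp_id]
    by_cases h : l = j₀
    · subst h
      have : biproduct.ι A l ≫ biproduct.lift (fun k : {k // k ≠ l} => biproduct.π A k) = 0 := by
        refine biproduct.hom_ext _ _ fun m => ?_
        simp [biproduct.ι_π_ne _ m.2.symm]
      rw [reassoc_of% this, zero_comp, add_zero]
      simp
    · have : biproduct.ι A l ≫ biproduct.lift (fun k : {k // k ≠ j₀} => biproduct.π A k) =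
          biproduct.ι (fun k : {k // k ≠ j₀} => A k) ⟨l, h⟩ := by
        refine biproduct.hom_ext _ _ fun m => ?_
        by_cases hm : (⟨l, h⟩ : {k // k ≠ j₀}) = m
        · subst hm; simp
        · have h' : l ≠ m := fun e => hm (Subtype.ext e)
          rw [biproduct.ι_π_ne _ hm]
          simp [biproduct.ι_π_ne _ h']
      rw [reassoc_of% this, ← Category.assoc, biproduct.ι_π_ne _ h]
      simp

/-! ### The Frobenius category of equivariant objects -/

section EquivariantFrobenius

variable {G : Type w} [Group G] {C : Type u} [Category.{v} C] [Preadditive C]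
  [HasFiniteBiproducts C] {a : RightAction G C} {ex : ExactStructure C}
  (ha : a.IsAdmissible ex)

theorem equivExact_deflation_iff {X Y : EquivObj a} (d : X ⟶ Y) :
    (equivExact ex a ha).Deflation d ↔ ex.Deflation d.hom :=
  ⟨fun ⟨K, i, w, h⟩ => ⟨K.obj, i.hom, congrArg EquivHom.hom w, h⟩,
    fun h => equiv_deflation d h ha⟩

theorem equivExact_inflation_iff {X Y : EquivObj a} (i : X ⟶ Y) :
    (equivExact ex a ha).Inflation i ↔ ex.Inflation i.hom :=
  ⟨fun ⟨K, d, w, h⟩ => ⟨K.obj, d.hom, congrArg EquivHom.hom w, h⟩,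
    fun h => equiv_inflation i h ha⟩

variable [Finite G]

/-- A lift that exists between the underlying objects becomes equivariant by averaging. -/
theorem equivExact_isProjective (hG : InvertibleIn (Nat.card G) C) {P : EquivObj a}
    (hP : ex.IsProjective P.obj) : (equivExact ex a ha).IsProjective P := fun X Y d f hd => by
  obtain ⟨t, ht⟩ := hP d.hom f.hom ((equivExact_deflation_iff ha d).1 hd)
  exact ⟨average hG t, by rw [← comp_average, ht, average_hom]⟩

theorem equivExact_isInjective (hG : InvertibleIn (Nat.card G) C) {I : EquivObj a}
    (hI : ex.IsInjective I.obj) : (equivExact ex a ha).IsInjective I := fun X Y i f hi => by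
  obtain ⟨t, ht⟩ := hI i.hom f.hom ((equivExact_inflation_iff ha i).1 hi)
  exact ⟨average hG t, by rw [← average_comp, ht, average_hom]⟩

/-- The object is induced from a projective `P` with a deflation `d` onto the underlying object. The
adjoint morphism is a deflation because its restriction to the summand of `1` is `F 1` of `d`
followed by an isomorphism. -/
theorem exists_deflation_obj (hE : ex.IsFrobenius) (X : EquivObj a) :
    ∃ (P : EquivObj a) (d : P ⟶ X), ex.IsProjective P.obj ∧ (equivExact ex a ha).Deflation d := by
  obtain ⟨P, d, hP, K, i, w, hd⟩ := hE.enoughProjectives X.obj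
  refine ⟨(induced a P).M, (induced a P).desc d, ?_, ?_⟩
  · rw [hE.projective_iff_injective] at hP ⊢
    exact ExactStructure.IsInjective.biproduct fun g => ha.map_injective g hP
  · rw [equivExact_deflation_iff]
    obtain ⟨B, j, q, hB⟩ := exists_isBiprod_ι (a.orbit P) 1
    refine ExactStructure.Deflation.of_isBiprod hB ?_
    have := (induced a P).i_desc d 1
    change ex.Deflation ((induced a P).i 1 ≫ _)
    rw [this]
    exact ExactStructure.Deflation.comp ⟨_, _, _, ha 1 _ hd⟩ (ex.deflation_of_isIso _)

theorem exists_inflation_obj (hE : ex.IsFrobenius) (X : EquivObj a) :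
    ∃ (I : EquivObj a) (i : X ⟶ I), ex.IsInjective I.obj ∧ (equivExact ex a ha).Inflation i := by
  obtain ⟨I, i, hI, K, d, w, hd⟩ := hE.enoughInjectives X.obj
  refine ⟨(induced a I).M, (induced a I).lift i, ?_, ?_⟩
  · exact ExactStructure.IsInjective.biproduct fun g => ha.map_injective g hI
  · rw [equivExact_inflation_iff]
    obtain ⟨B, j, q, hB⟩ := exists_isBiprod_ι (a.orbit I) 1
    refine ExactStructure.Inflation.of_isBiprod hB ?_
    have := (induced a I).lift_p i 1
    change ex.Inflation (_ ≫ (induced a I).p 1)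
    rw [this]
    refine ⟨_, (a.F 1).map d, ?_, ExactStructure.conflation_of_iso (ha 1 _ hd)
      (ShortComplex.isoMk (X.lam 1) (Iso.refl _) (Iso.refl _) ?_ ?_)⟩
    · rw [Category.assoc, ← Functor.map_comp, w, Functor.map_zero, comp_zero]
    · exact (Iso.hom_inv_id_assoc _ _).trans (Category.comp_id _).symm
    · exact (Category.id_comp _).trans (Category.comp_id _).symm

theorem equivExact_enoughProjectives (hE : ex.IsFrobenius) (hG : InvertibleIn (Nat.card G) C) :
    (equivExact ex a ha).EnoughProjectives := fun X => by
  obtain ⟨P, d, hP, hd⟩ := exists_deflation_obj ha hE X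
  exact ⟨P, d, equivExact_isProjective ha hG hP, hd⟩

theorem equivExact_enoughInjectives (hE : ex.IsFrobenius) (hG : InvertibleIn (Nat.card G) C) :
    (equivExact ex a ha).EnoughInjectives := fun X => by
  obtain ⟨I, i, hI, hi⟩ := exists_inflation_obj ha hE X
  exact ⟨I, i, equivExact_isInjective ha hG hI, hi⟩

/-- The deflation of `exists_deflation_obj` onto a projective splits, so the underlying object is a
retract of a projective. -/
theorem isProjective_obj (hE : ex.IsFrobenius) {P : EquivObj a}
    (hP : (equivExact ex a ha).IsProjective P) : ex.IsProjective P.obj := by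
  obtain ⟨Q, d, hQ, hd⟩ := exists_deflation_obj ha hE P
  obtain ⟨t, ht⟩ := hP d (𝟙 P) hd
  exact hQ.of_retract t.hom d.hom (congrArg EquivHom.hom ht)

theorem isInjective_obj (hE : ex.IsFrobenius) {I : EquivObj a}
    (hI : (equivExact ex a ha).IsInjective I) : ex.IsInjective I.obj := by
  obtain ⟨Q, i, hQ, hi⟩ := exists_inflation_obj ha hE I
  obtain ⟨t, ht⟩ := hI i (𝟙 I) hi
  exact hQ.of_retract i.hom t.hom (congrArg EquivHom.hom ht)

theorem equivExact_isFrobenius (hE : ex.IsFrobenius) (hG : InvertibleIn (Nat.card G) C) :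
    (equivExact ex a ha).IsFrobenius where
  enoughProjectives := equivExact_enoughProjectives ha hE hG
  enoughInjectives := equivExact_enoughInjectives ha hE hG
  projective_iff_injective _ :=
    ⟨fun h => equivExact_isInjective ha hG
      ((hE.projective_iff_injective _).1 (isProjective_obj ha hE h)),
    fun h => equivExact_isProjective ha hG
      ((hE.projective_iff_injective _).2 (isInjective_obj ha hE h))⟩

end EquivariantFrobenius

/-! ### Functors between stable categories -/

section MapTriangles

variable {D : Type u} [Category.{v} D] {T : D ⥤ D} {D' : Type u'} [Category.{v'} D'] {T' : D' ⥤ D'}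

/-- The image of a triangle. -/
abbrev Tri.map (F : D ⥤ D') (ξ : T ⋙ F ≅ F ⋙ T') (t : Tri T) : Tri T' :=
  Tri.mk (F.map t.f) (F.map t.g) (F.map t.h ≫ ξ.hom.app t.X)

theorem Tri.IsHom.map {t t' : Tri T} {a : t.X ⟶ t'.X} {b : t.Y ⟶ t'.Y} {c : t.Z ⟶ t'.Z}
    (h : t.IsHom t' a b c) (F : D ⥤ D') (ξ : T ⋙ F ≅ F ⋙ T') :
    (t.map F ξ).IsHom (t'.map F ξ) (F.map a) (F.map b) (F.map c) where
  comm₁ := by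
    change F.map _ ≫ F.map _ = F.map _ ≫ F.map _
    rw [← F.map_comp, h.comm₁, F.map_comp]
  comm₂ := by
    change F.map _ ≫ F.map _ = F.map _ ≫ F.map _
    rw [← F.map_comp, h.comm₂, F.map_comp]
  comm₃ := by
    have h1 := ξ.hom.naturality a
    dsimp only [Functor.comp_map, Functor.comp_obj] at h1
    change (F.map t.h ≫ ξ.hom.app t.X) ≫ T'.map (F.map a) = F.map c ≫ F.map t'.h ≫ _
    rw [Category.assoc, ← h1, ← F.map_comp_assoc, h.comm₃, F.map_comp_assoc]

theorem Tri.Isomorphic.map {t t' : Tri T} (h : t.Isomorphic t') (F : D ⥤ D')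
    (ξ : T ⋙ F ≅ F ⋙ T') : (t.map F ξ).Isomorphic (t'.map F ξ) := by
  obtain ⟨a, b, c, h⟩ := h.exists_isHom
  exact (h.map F ξ).isomorphic inferInstance inferInstance inferInstance

end MapTriangles

section StableFunctors

open ExactStructure

/-- Two morphisms of conflations, the second of which has an injective middle term, which agree
stably on the left agree stably on the right. -/
theorem toStable_map_eq {C : Type u} [Category.{v} C] [Preadditive C] [HasFiniteBiproducts C]
    {ex : ExactStructure C} {X Y Z X' Y' Z' : C} {u : X ⟶ Y} {v : Y ⟶ Z} {zero : u ≫ v = 0}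
    (hS : ex.conflation (ShortComplex.mk u v zero)) {u' : X' ⟶ Y'} {v' : Y' ⟶ Z'}
    (zero' : u' ≫ v' = 0) (hI : ex.IsInjective Y') {f : X ⟶ X'} {b b' : Y ⟶ Y'} {t t' : Z ⟶ Z'}
    (h₁ : u ≫ b = f ≫ u') (h₂ : v ≫ t = b ≫ v') (h₁' : u ≫ b' = f ≫ u')
    (h₂' : v ≫ t' = b' ≫ v') : ex.toStable.map t = ex.toStable.map t' :=
  toStable_τ₃_eq (S₂ := ShortComplex.mk u' v' zero') hS hI
    (ShortComplex.homMk f b t h₁.symm h₂.symm) (ShortComplex.homMk f b' t' h₁'.symm h₂'.symm) rfl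

variable {B : Type u'} [Category.{v'} B] [Preadditive B] [HasFiniteBiproducts B]
  {C : Type u} [Category.{v} C] [Preadditive C] [HasFiniteBiproducts C]
  {ex' : ExactStructure B} {ex : ExactStructure C} {Φ : B ⥤ C} [Φ.Additive]

variable (ex' ex Φ) in
/-- The functor `Φ` preserves conflations and injective objects. -/
structure PreservesConflationsInjectives : Prop where
  conflation : ∀ S, ex'.conflation S → ex.conflation (S.map Φ)
  injective : ∀ I, ex'.IsInjective I → ex.IsInjective (Φ.obj I)

theorem PreservesConflationsInjectives.map (hΦ : PreservesConflationsInjectives ex' ex Φ)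
    {X Y Z : B} {u : X ⟶ Y} {v : Y ⟶ Z} {zero : u ≫ v = 0}
    (hS : ex'.conflation (ShortComplex.mk u v zero)) :
    ex.conflation (ShortComplex.mk (Φ.map u) (Φ.map v)
      (by rw [← Φ.map_comp, zero, Φ.map_zero])) :=
  hΦ.conflation _ hS

/-- The functor between the stable categories induced by `Φ`. -/
def stableMap (hΦ : PreservesConflationsInjectives ex' ex Φ) : ex'.Stable ⥤ ex.Stable :=
  CategoryTheory.Quotient.lift _ (Φ ⋙ ex.toStable) (fun X Y f f' h =>
    CategoryTheory.Quotient.sound _ (by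
      obtain ⟨I, p, q, hI, e⟩ := h
      exact ⟨Φ.obj I, Φ.map p, Φ.map q, hΦ.injective I hI, by
        rw [← Φ.map_comp, e, Φ.map_sub]⟩))

theorem stableMap_map (hΦ : PreservesConflationsInjectives ex' ex Φ) {X Y : B} (f : X ⟶ Y) :
    (stableMap hΦ).map (ex'.toStable.map f) = ex.toStable.map (Φ.map f) := rfl

theorem exists_comparison (hΦ : PreservesConflationsInjectives ex' ex Φ) (c' : ex'.Choice)
    (c : ex.Choice) (X : B) :
    ∃ t : Φ.obj (c'.S X) ⟶ c.S (Φ.obj X), ∃ b : Φ.obj (c'.I X) ⟶ c.I (Φ.obj X),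
      Φ.map (c'.ι X) ≫ b = c.ι (Φ.obj X) ∧ Φ.map (c'.π X) ≫ t = b ≫ c.π (Φ.obj X) := by
  obtain ⟨b, hb⟩ := c.injective (Φ.obj X) (Φ.map (c'.ι X)) (c.ι (Φ.obj X))
    ⟨_, _, _, hΦ.map (c'.conflation X)⟩
  obtain ⟨t, ht⟩ := exists_desc (hΦ.map (c'.conflation X)) (b ≫ c.π (Φ.obj X)) (by
    change Φ.map (c'.ι X) ≫ _ = 0
    rw [reassoc_of% hb, c.zero])
  exact ⟨t, b, hb, ht⟩

variable (hΦ : PreservesConflationsInjectives ex' ex Φ) (c' : ex'.Choice) (c : ex.Choice)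

/-- The third component of a morphism from the image of a chosen conflation to the chosen conflation
of the image. -/
def comparison (X : B) : Φ.obj (c'.S X) ⟶ c.S (Φ.obj X) :=
  (exists_comparison hΦ c' c X).choose

theorem comparison_spec (X : B) : ∃ b : Φ.obj (c'.I X) ⟶ c.I (Φ.obj X),
    Φ.map (c'.ι X) ≫ b = c.ι (Φ.obj X) ∧
      Φ.map (c'.π X) ≫ comparison hΦ c' c X = b ≫ c.π (Φ.obj X) :=
  (exists_comparison hΦ c' c X).choose_spec

/-- The image of a chosen conflation still has an injective middle term, and the comparison is the
identity on the left. -/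
theorem isIso_comparison (X : B) : IsIso (ex.toStable.map (comparison hΦ c' c X)) := by
  obtain ⟨b, h₁, h₂⟩ := comparison_spec hΦ c' c X
  let φ : ShortComplex.mk (Φ.map (c'.ι X)) (Φ.map (c'.π X))
      (by rw [← Φ.map_comp, c'.zero, Φ.map_zero]) ⟶ c.sc (Φ.obj X) :=
    ShortComplex.homMk (𝟙 _) b (comparison hΦ c' c X) (by simp [h₁]) h₂.symm
  have : IsIso φ.τ₁ := (inferInstance : IsIso (𝟙 (Φ.obj X)))
  exact isIso_toStable_τ₃ (hΦ.map (c'.conflation X)) (c.conflation _)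
    (hΦ.injective _ (c'.injective X)) (c.injective _) φ

/-- The induced functor commutes with the translation functors. -/
def comparisonIso : c'.susp ⋙ stableMap hΦ ≅ stableMap hΦ ⋙ c.susp :=
  NatIso.ofComponents
    (fun X => @asIso ex.Stable _ (ex.toStable.obj (Φ.obj (c'.S X.as)))
      (ex.toStable.obj (c.S (Φ.obj X.as))) _ (isIso_comparison hΦ c' c X.as)) (by
    intro X Y f
    obtain ⟨f, rfl⟩ := ex'.toStable.map_surjective (X := X.as) (Y := Y.as) f
    obtain ⟨b, t, h₁, h₂⟩ := c'.exists_ext f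
    obtain ⟨b', t', h₁', h₂'⟩ := c.exists_ext (Φ.map f)
    obtain ⟨x, hx, hx'⟩ := comparison_spec hΦ c' c X.as
    obtain ⟨y, hy, hy'⟩ := comparison_spec hΦ c' c Y.as
    have key : ex.toStable.map (Φ.map t ≫ comparison hΦ c' c Y.as) =
        ex.toStable.map (comparison hΦ c' c X.as ≫ t') := by
      refine toStable_map_eq (hΦ.map (c'.conflation X.as)) (c.zero (Φ.obj Y.as)) (c.injective _)
        (f := Φ.map f) (b := Φ.map b ≫ y) (b' := x ≫ b') ?_ ?_ ?_ ?_
      · rw [← Functor.map_comp_assoc, ← h₁, Functor.map_comp_assoc, hy]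
      · rw [← Functor.map_comp_assoc, ← h₂, Functor.map_comp_assoc, hy', Category.assoc]
      · rw [reassoc_of% hx, h₁']
      · rw [reassoc_of% hx', ← h₂', Category.assoc]
    rw [Functor.map_comp, Functor.map_comp] at key
    change (stableMap hΦ).map (c'.susp.map (ex'.toStable.map f)) ≫ ex.toStable.map _ =
      ex.toStable.map _ ≫ c.susp.map (ex.toStable.map (Φ.map f))
    rw [c'.susp_map_eq h₁ h₂, c.susp_map_eq h₁' h₂']
    exact key)

theorem stableMap_additive : (stableMap hΦ).Additive where
  map_add {X Y} f g := by
    obtain ⟨f, rfl⟩ := ex'.toStable.map_surjective (X := X.as) (Y := Y.as) f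
    obtain ⟨g, rfl⟩ := ex'.toStable.map_surjective (X := X.as) (Y := Y.as) g
    rw [← Functor.map_add, stableMap_map, stableMap_map, stableMap_map, Functor.map_add,
      Functor.map_add]
    rfl

/-- `Φ` carries the conflation of an exact triangle to a conflation; composing the images of `b` and
`w` with the comparison yields the data required for the chosen conflation of `Φ.obj X`. -/
theorem stableMap_isExact :
    IsExactFunctor c'.exactTriangles c.exactTriangles (stableMap hΦ) (comparisonIso hΦ c' c) where
  additive := stableMap_additive hΦ
  map_mem t ht := by
    obtain ⟨X, Y, Z, u, v, zero, b, w, hS, h₁, h₂, ht⟩ := ht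
    obtain ⟨x, hx, hx'⟩ := comparison_spec hΦ c' c X
    refine ⟨_, _, _, _, _, _, Φ.map b ≫ x, Φ.map w ≫ comparison hΦ c' c X, hΦ.map hS, ?_, ?_,
      Tri.Isomorphic.trans ?_ (ht.map _ (comparisonIso hΦ c' c))⟩
    · rw [← hx, ← h₁, Φ.map_comp, Category.assoc]
    · rw [Category.assoc, ← hx', ← Functor.map_comp_assoc, h₂, Functor.map_comp_assoc]
    · have := stableMap_additive hΦ
      refine ⟨Iso.refl _, Iso.refl _, Iso.refl _, ?_, ?_, ?_⟩
      · exact (Category.comp_id _).trans (Category.id_comp _).symm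
      · exact (Category.comp_id _).trans (Category.id_comp _).symm
      · change (-ex.toStable.map (Φ.map w ≫ comparison hΦ c' c X)) ≫ c.susp.map (𝟙 _) =
          𝟙 _ ≫ (stableMap hΦ).map (-ex'.toStable.map w) ≫ ex.toStable.map (comparison hΦ c' c X)
        rw [c.susp.map_id, Category.id_comp]
        refine (Category.comp_id _).trans ?_
        rw [Functor.map_comp, ← Preadditive.neg_comp]
        refine congrArg (fun s => s ≫ ex.toStable.map (comparison hΦ c' c X)) ?_
        have h := (stableMap hΦ).map_neg (f := ex'.toStable.map w)
        exact h.symm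

/-- The comparison isomorphism is computed by any comparison morphism. -/
theorem toStable_comparison {X : B} {s : Φ.obj (c'.I X) ⟶ c.I (Φ.obj X)}
    {t : Φ.obj (c'.S X) ⟶ c.S (Φ.obj X)} (h₁ : Φ.map (c'.ι X) ≫ s = c.ι (Φ.obj X))
    (h₂ : s ≫ c.π (Φ.obj X) = Φ.map (c'.π X) ≫ t) :
    ex.toStable.map (comparison hΦ c' c X) = ex.toStable.map t := by
  obtain ⟨x, hx, hx'⟩ := comparison_spec hΦ c' c X
  exact toStable_map_eq (hΦ.map (c'.conflation X)) (c.zero _) (c.injective _) (f := 𝟙 _)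
    (by simp [hx]) hx' (by simp [h₁]) h₂.symm

end StableFunctors

/-! ### The admissible action on the stable category -/

section StableAdmissible

open ExactStructure

variable {G : Type w} [Group G] {C : Type u} [Category.{v} C] [Preadditive C]
  [HasFiniteBiproducts C] {a : RightAction G C} {ex : ExactStructure C}

theorem RightAction.IsAdmissible.preserves (ha : a.IsAdmissible ex) (g : G) :
    PreservesConflationsInjectives ex ex (a.F g) :=
  ⟨ha g, fun _ h => ha.map_injective g h⟩

theorem RightAction.unit_naturality {C : Type u} [Category.{v} C] (a : RightAction G C)
    {X Y : C} (f : X ⟶ Y) :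
    (a.F 1).map f ≫ (a.unit Y).hom = (a.unit X).hom ≫ f := by
  apply (a.F 1).map_injective
  rw [Functor.map_comp, Functor.map_comp]
  have h : ∀ Z, (a.F 1).map (a.unit Z).hom = (a.δ 1 1 1 (one_mul 1)).hom.app Z := fun Z =>
    (a.F 1).map_preimage _
  rw [h, h, a.δ_naturality]

theorem stableAction_unit (ha : a.IsAdmissible ex) (X : C) :
    ((stableAction ha).unit (ex.toStable.obj X)).hom = ex.toStable.map (a.unit X).hom :=
  (Category.id_comp _).symm.trans ((toStable_isEquivariant ha).unit X)

/-- Equivariance is demanded of the inverses of the `θ g`, whereas the comparison morphisms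
represent the `θ g` themselves; this passes from one form to the other. -/
theorem inv_comp_inv_comp_eq {D : Type u} [Category.{v} D] {A₁ A₂ A₃ B₁ B₂ : D} (x : A₂ ≅ A₁)
    (y : A₃ ≅ A₂) (k : B₁ ≅ B₂) (d : A₃ ⟶ B₁) (s : A₁ ⟶ B₂)
    (h : d ≫ k.hom = y.hom ≫ x.hom ≫ s) : x.inv ≫ y.inv ≫ d = s ≫ k.inv := by
  rw [Iso.inv_comp_eq, Iso.inv_comp_eq, ← Category.assoc, ← Category.assoc, Iso.eq_comp_inv, h,
    Category.assoc]

/-- The action on the stable category is admissible, with the induced commutating isomorphisms. -/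
def stableAdmissible (ha : a.IsAdmissible ex) (c : ex.Choice) :
    AdmissibleData (stableAction ha) c.exactTriangles where
  θ g := comparisonIso (ha.preserves g) c c
  exact g := stableMap_isExact (ha.preserves g) c c
  equivariant :=
    { comp := fun g h k e A => by
        obtain ⟨b, t, h₁, h₂⟩ := c.exists_ext (X := (a.F g).obj ((a.F h).obj A.as))
          (Y := (a.F k).obj A.as) ((a.δ g h k e).hom.app A.as)
        obtain ⟨x, hx, hx'⟩ := comparison_spec (ha.preserves k) c c A.as
        obtain ⟨y, hy, hy'⟩ := comparison_spec (ha.preserves h) c c A.as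
        obtain ⟨z, hz, hz'⟩ := comparison_spec (ha.preserves g) c c ((a.F h).obj A.as)
        -- Both composites are third components of morphisms of conflations over the same component
        -- `δ` on the left, hence stably equal.
        have key : ex.toStable.map ((a.δ g h k e).hom.app (c.S A.as) ≫
              comparison (ha.preserves k) c c A.as) =
            ex.toStable.map ((a.F g).map (comparison (ha.preserves h) c c A.as) ≫
              comparison (ha.preserves g) c c ((a.F h).obj A.as) ≫ t) := by
          refine toStable_map_eq ((ha.preserves g).map ((ha.preserves h).map (c.conflation A.as)))
            (c.zero ((a.F k).obj A.as)) (c.injective _) (f := (a.δ g h k e).hom.app A.as)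
            (b := (a.δ g h k e).hom.app (c.I A.as) ≫ x) (b' := (a.F g).map y ≫ z ≫ b) ?_ ?_ ?_ ?_
          · rw [reassoc_of% (a.δ_naturality g h k e), hx]
          · rw [reassoc_of% (a.δ_naturality g h k e), hx', Category.assoc]
          · rw [← Functor.map_comp_assoc, hy, reassoc_of% hz, h₁]
          · rw [← Functor.map_comp_assoc, hy', Functor.map_comp_assoc, reassoc_of% hz', ← h₂,
              Category.assoc, Category.assoc]
        rw [Functor.map_comp, Functor.map_comp, Functor.map_comp] at key
        refine inv_comp_inv_comp_eq ((comparisonIso (ha.preserves g) c c).app _)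
          (((stableAction ha).F g).mapIso ((comparisonIso (ha.preserves h) c c).app A))
          ((comparisonIso (ha.preserves k) c c).app A) _ _ (key.trans ?_)
        have := c.susp_map_eq h₁ h₂
        rw [← this]
        rfl
      unit := fun A => by
        obtain ⟨b, t, h₁, h₂⟩ := c.exists_ext (a.unit A.as).hom
        obtain ⟨x, hx, hx'⟩ := comparison_spec (ha.preserves 1) c c A.as
        -- The same argument, with the unit of the action as common left component.
        have key : ex.toStable.map (a.unit (c.S A.as)).hom =
            ex.toStable.map (comparison (ha.preserves 1) c c A.as ≫ t) := by
          refine toStable_map_eq ((ha.preserves 1).map (c.conflation A.as)) (c.zero A.as)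
            (c.injective _) (f := (a.unit A.as).hom) (b := (a.unit (c.I A.as)).hom) (b' := x ≫ b)
            (a.unit_naturality _) (a.unit_naturality _) ?_ ?_
          · rw [reassoc_of% hx, h₁]
          · rw [reassoc_of% hx', ← h₂, Category.assoc]
        rw [Functor.map_comp] at key
        refine (Iso.inv_comp_eq ((comparisonIso (ha.preserves 1) c c).app A)).2 ?_
        refine (stableAction_unit ha (c.S A.as)).trans (key.trans ?_)
        have h := stableAction_unit ha A.as
        have := c.susp_map_eq h₁ h₂
        rw [← this, ← h]
        rfl }

theorem stableAdmissible_isInduced (ha : a.IsAdmissible ex) (c : ex.Choice) :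
    IsInduced ha c (stableAdmissible ha c) := fun g _ _ _ h₁ h₂ =>
  toStable_comparison (ha.preserves g) c c h₁ h₂

/-- For uniqueness, if `n` times a morphism factors as `p ≫ q` through an injective, then the
morphism itself is `p` followed by the quotient of `q` by `n`. -/
theorem InvertibleIn.stable {n : ℕ} (h : InvertibleIn n C) (ex : ExactStructure C) :
    InvertibleIn n ex.Stable := by
  intro X Y f
  obtain ⟨f, rfl⟩ := ex.toStable.map_surjective (X := X.as) (Y := Y.as) f
  obtain ⟨g, hg, -⟩ := h f
  refine ⟨ex.toStable.map g, by rw [← hg, Functor.map_nsmul], fun k hk => ?_⟩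
  obtain ⟨k, rfl⟩ := ex.toStable.map_surjective (X := X.as) (Y := Y.as) k
  rw [← hg, ← Functor.map_nsmul, toStable_eq_iff] at hk
  rw [toStable_eq_iff]
  obtain ⟨I, p, q, hI, e⟩ := hk
  obtain ⟨q', rfl, -⟩ := h q
  refine ⟨I, p, q', hI, h.cancel ?_⟩
  rw [← Preadditive.comp_nsmul, e, nsmul_sub]

end StableAdmissible

/-! ### The comparison functor -/

section ComparisonFunctor

open ExactStructure

attribute [local instance] Fintype.ofFinite

variable {G : Type w} [Group G] {C : Type u} [Category.{v} C] [Preadditive C]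
  [HasFiniteBiproducts C] {a : RightAction G C} {ex : ExactStructure C}

theorem EquivObj.isIso_of_isIso_hom {D : Type u} [Category.{v} D] {b : RightAction G D}
    {X Y : EquivObj b} (f : X ⟶ Y) (h : IsIso f.hom) : IsIso f := by
  refine ⟨EquivObj.homMk (inv f.hom) (fun g => ?_), EquivObj.hom_ext (IsIso.hom_inv_id _),
    EquivObj.hom_ext (IsIso.inv_hom_id _)⟩
  rw [← cancel_epi ((b.F g).map f.hom), ← Functor.map_comp_assoc, IsIso.hom_inv_id, (b.F g).map_id,
    Category.id_comp, reassoc_of% (EquivObj.comm f g), IsIso.hom_inv_id, Category.comp_id]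

theorem toStableEquiv_lam (ha : a.IsAdmissible ex) (X : EquivObj a) (g : G) :
    (((toStableEquiv ha).obj X).lam g).hom = ex.toStable.map (X.lam g).hom :=
  Category.id_comp _

/-- Compatibility of the comparison for the forgetful functor with the actions: both sides are third
components over `(X.lam g).hom`. -/
theorem comparison_forget_comm (ha : a.IsAdmissible ex) (c : ex.Choice)
    (c' : (equivExact ex a ha).Choice) (X : EquivObj a) {m : (c'.S X).obj ⟶ c.S X.obj}
    {x : (c'.I X).obj ⟶ c.I X.obj} (hx : (c'.ι X).hom ≫ x = c.ι X.obj)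
    (hx' : (c'.π X).hom ≫ m = x ≫ c.π X.obj) (g : G) {b : c.I ((a.F g).obj X.obj) ⟶ c.I X.obj}
    {t : c.S ((a.F g).obj X.obj) ⟶ c.S X.obj}
    (h₁ : c.ι ((a.F g).obj X.obj) ≫ b = (X.lam g).hom ≫ c.ι X.obj)
    (h₂ : c.π ((a.F g).obj X.obj) ≫ t = b ≫ c.π X.obj) :
    ex.toStable.map ((a.F g).map m) ≫ ex.toStable.map (comparison (ha.preserves g) c c X.obj) ≫
        ex.toStable.map t =
      ex.toStable.map ((c'.S X).lam g).hom ≫ ex.toStable.map m := by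
  obtain ⟨y, hy, hy'⟩ := comparison_spec (ha.preserves g) c c X.obj
  have hS : ex.conflation (ShortComplex.mk (c'.ι X).hom (c'.π X).hom
      (congrArg EquivHom.hom (c'.zero X))) := c'.conflation X
  rw [← Functor.map_comp, ← Functor.map_comp, ← Functor.map_comp]
  refine toStable_map_eq ((ha.preserves g).map hS) (c.zero X.obj) (c.injective _)
    (f := (X.lam g).hom) (b := (a.F g).map x ≫ y ≫ b) (b' := ((c'.I X).lam g).hom ≫ x)
    ?_ ?_ ?_ ?_
  · rw [← Functor.map_comp_assoc, hx, reassoc_of% hy, h₁]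
  · rw [← Functor.map_comp_assoc, hx', Functor.map_comp_assoc, reassoc_of% hy', h₂,
      Category.assoc, Category.assoc]
  · rw [reassoc_of% (EquivObj.comm (c'.ι X) g), hx]
  · rw [reassoc_of% (EquivObj.comm (c'.π X) g), hx', Category.assoc]

variable [Finite G] (ha : a.IsAdmissible ex) (hE : ex.IsFrobenius)

theorem forget_preserves (hE : ex.IsFrobenius) :
    PreservesConflationsInjectives (equivExact ex a ha) ex (forget a) :=
  ⟨fun _ h => h, fun _ h => isInjective_obj ha hE h⟩

/-- The functor from the stable category of equivariant objects to the category of equivariant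
objects of the stable category. -/
def stableComparison : (equivExact ex a ha).Stable ⥤ EquivObj (stableAction ha) :=
  CategoryTheory.Quotient.lift _ (toStableEquiv ha) (fun _ _ f f' h => EquivObj.hom_ext
    ((toStable_eq_iff f.hom f'.hom).2 (by
      obtain ⟨I, p, q, hI, e⟩ := h
      exact ⟨I.obj, p.hom, q.hom, isInjective_obj ha hE hI, congrArg EquivHom.hom e⟩)))

theorem toStable_stableComparison :
    (equivExact ex a ha).toStable ⋙ stableComparison ha hE = toStableEquiv ha :=
  CategoryTheory.Quotient.lift_spec _ _ _

variable (c : ex.Choice) (c' : (equivExact ex a ha).Choice)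

/-- The commutating morphism of the comparison functor. -/
def stableComparisonHom (X : EquivObj a) :
    (toStableEquiv ha).obj (c'.S X) ⟶
      (stableAdmissible ha c).translation.obj ((toStableEquiv ha).obj X) :=
  EquivObj.homMk (ex.toStable.map (comparison (forget_preserves ha hE) c' c X)) (fun g => by
    obtain ⟨b, t, h₁, h₂⟩ := c.exists_ext (X.lam g).hom
    obtain ⟨x, hx, hx'⟩ := comparison_spec (forget_preserves ha hE) c' c X
    have key := comparison_forget_comm ha c c' X hx hx' g h₁.symm h₂.symm
    rw [toStableEquiv_lam]
    refine Eq.trans ?_ key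
    have h := toStableEquiv_lam ha X g
    have := c.susp_map_eq h₁ h₂
    rw [← this, ← h]
    rfl)

theorem stableComparison_map_hom {X Y : (equivExact ex a ha).Stable} (f : X ⟶ Y) :
    ((stableComparison ha hE).map f).hom = (stableMap (forget_preserves ha hE)).map f := by
  obtain ⟨f, rfl⟩ := (equivExact ex a ha).toStable.map_surjective (X := X.as) (Y := Y.as) f
  rfl

/-- The comparison functor commutes with the translation functors. -/
def stableComparisonIso : c'.susp ⋙ stableComparison ha hE ≅
    stableComparison ha hE ⋙ (stableAdmissible ha c).translation :=
  NatIso.ofComponents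
    (fun X => @asIso _ _ _ _ (stableComparisonHom ha hE c c' X.as)
      (EquivObj.isIso_of_isIso_hom _ (isIso_comparison (forget_preserves ha hE) c' c X.as))) (by
    intro X Y f
    obtain ⟨f, rfl⟩ := (equivExact ex a ha).toStable.map_surjective (X := X.as) (Y := Y.as) f
    have h := (comparisonIso (forget_preserves ha hE) c' c).hom.naturality
      ((equivExact ex a ha).toStable.map f)
    exact EquivObj.hom_ext h)

/-- The triangles of equivariant objects which are exact in the underlying category. -/
def canonicalTriangles {D : Type u'} [Category.{v'} D] [Preadditive D] {b : RightAction G D}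
    {T : D ⥤ D} {Δ : Set (Tri T)} (A : AdmissibleData b Δ) : Set (Tri A.translation) :=
  {t | Tri.mk (T := T) t.f.hom t.g.hom t.h.hom ∈ Δ}

/-- Exactness of a triangle in the target is tested on underlying objects, where the functor is the
one induced by the forgetful functor. -/
theorem stableComparison_isExact : IsExactFunctor c'.exactTriangles
    (canonicalTriangles (stableAdmissible ha c)) (stableComparison ha hE)
    (stableComparisonIso ha hE c c') where
  additive := ⟨fun {X Y} {f g} => by
    have := stableMap_additive (forget_preserves ha hE)
    refine EquivObj.hom_ext ?_
    rw [EquivObj.add_hom, stableComparison_map_hom, stableComparison_map_hom,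
      stableComparison_map_hom]
    exact (stableMap (forget_preserves ha hE)).map_add⟩
  map_mem t ht := by
    have h := (stableMap_isExact (forget_preserves ha hE) c' c).map_mem t ht
    rw [← stableComparison_map_hom ha hE t.f, ← stableComparison_map_hom ha hE t.g,
      ← stableComparison_map_hom ha hE t.h] at h
    exact h

/-- A representative `k` of a stable equivariant morphism need not be invariant, but all its
translates are stably equal to it; so is its average, by division by $|G|$ in the stable category.
-/
theorem stableComparison_full (hG : InvertibleIn (Nat.card G) C) :
    (stableComparison ha hE).Full where
  map_surjective {X Y} f := by
    obtain ⟨k, hk⟩ := ex.toStable.map_surjective (X := X.as.obj) (Y := Y.as.obj) f.hom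
    refine ⟨(equivExact ex a ha).toStable.map (average hG k), EquivObj.hom_ext ?_⟩
    apply (hG.stable ex).cancel
    change Nat.card G • ex.toStable.map (average hG k).hom = Nat.card G • f.hom
    rw [← Functor.map_nsmul, nsmul_average, Functor.map_sum]
    have h : ∀ g : G, ex.toStable.map (conj X.as Y.as g k) = ex.toStable.map k := fun g => by
      have e : ex.toStable.map (X.as.lam g).hom ≫ ex.toStable.map (conj X.as Y.as g k) =
          ex.toStable.map (X.as.lam g).hom ≫ ex.toStable.map k := by
        rw [hk, ← Functor.map_comp, ← map_comp_lam, Functor.map_comp]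
        refine Eq.trans ?_ ((EquivObj.comm f g).trans
          (congrArg (fun s => s ≫ f.hom) (toStableEquiv_lam ha X.as g)))
        rw [← hk]
        exact (congrArg (fun s => ex.toStable.map ((a.F g).map k) ≫ s)
          (toStableEquiv_lam ha Y.as g)).symm
      exact (cancel_epi _).1 e
    rw [Finset.sum_congr rfl (fun g _ => h g), ← hk]
    rw [Finset.sum_const, Finset.card_univ, Fintype.card_eq_nat_card]
    rfl

/-- If the difference vanishes stably after forgetting the action, it extends along an equivariant
inflation into an injective equivariant object. Averaging this extension gives an equivariant
factorization. -/
theorem stableComparison_faithful (hG : InvertibleIn (Nat.card G) C) :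
    (stableComparison ha hE).Faithful where
  map_injective {X Y} f f' h := by
    obtain ⟨f, rfl⟩ := (equivExact ex a ha).toStable.map_surjective (X := X.as) (Y := Y.as) f
    obtain ⟨f', rfl⟩ := (equivExact ex a ha).toStable.map_surjective (X := X.as) (Y := Y.as) f'
    have h1 : ex.FactorsInj (f.hom - f'.hom) :=
      (toStable_eq_iff _ _).1 (congrArg EquivHom.hom h)
    rw [toStable_eq_iff]
    obtain ⟨I, i, hI, hi⟩ := equivExact_enoughInjectives ha hE hG X.as
    obtain ⟨t, ht⟩ := h1.exists_of_inflation ((equivExact_inflation_iff ha i).1 hi)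
    refine ⟨I, i, average hG t, hI, ?_⟩
    rw [← average_comp, ht]
    exact average_hom hG (f - f')

end ComparisonFunctor

/-! ### Exact triangles of equivariant objects -/

section EquivariantTriangles

variable {G : Type w} [Group G] {D : Type u} [Category.{v} D]

section Summand

variable {b : RightAction G D} {M : EquivObj b} (e : M ⟶ M) {U : D} (i : U ⟶ M.obj) (p : M.obj ⟶ U)
  (h : i ≫ p = 𝟙 U) (h' : p ≫ i = e.hom)

theorem map_comp_lam_comp_of_splitting (h : i ≫ p = 𝟙 U) (h' : p ≫ i = e.hom) (g : G) :
    (b.F g).map i ≫ (M.lam g).hom = ((b.F g).map i ≫ (M.lam g).hom ≫ p) ≫ i := by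
  rw [Category.assoc, Category.assoc, h', ← EquivObj.comm e, ← Functor.map_comp_assoc, ← h',
    reassoc_of% h]

theorem map_comp_map_comp_lam_of_splitting (h : i ≫ p = 𝟙 U) (h' : p ≫ i = e.hom) (g : G) :
    (b.F g).map p ≫ (b.F g).map i ≫ (M.lam g).hom ≫ p = (M.lam g).hom ≫ p := by
  rw [← Functor.map_comp_assoc, h', reassoc_of% (EquivObj.comm e g), ← h', Category.assoc, h,
    Category.comp_id]

/-- The equivariant object whose underlying object is the summand cut out by an invariant
idempotent. -/
def EquivObj.summand : EquivObj b where
  obj := U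
  lam g :=
    { hom := (b.F g).map i ≫ (M.lam g).hom ≫ p
      inv := i ≫ (M.lam g).inv ≫ (b.F g).map p
      hom_inv_id := by
        rw [← Category.assoc, ← map_comp_lam_comp_of_splitting e i p h h' g, Category.assoc,
          Iso.hom_inv_id_assoc, ← Functor.map_comp, h, CategoryTheory.Functor.map_id]
      inv_hom_id := by
        rw [Category.assoc, Category.assoc, map_comp_map_comp_lam_of_splitting e i p h h' g,
          Iso.inv_hom_id_assoc, h] }
  lam_mul g k l e' := by
    have h1 := b.δ_naturality g k l e' i
    have h2 := M.lam_mul g k l e'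
    have h3 := map_comp_lam_comp_of_splitting e i p h h' k
    dsimp only
    rw [← Functor.map_comp_assoc, ← h3, Functor.map_comp_assoc, reassoc_of% h2, reassoc_of% h1]

/-- The inclusion of a summand. -/
def EquivObj.summandι : EquivObj.summand e i p h h' ⟶ M :=
  EquivObj.homMk (X := EquivObj.summand e i p h h') i (map_comp_lam_comp_of_splitting e i p h h')

/-- The projection to a summand. -/
def EquivObj.summandπ : M ⟶ EquivObj.summand e i p h h' :=
  EquivObj.homMk (Y := EquivObj.summand e i p h h') p
    (map_comp_map_comp_lam_of_splitting e i p h h')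

end Summand

variable [Preadditive D] {b : RightAction G D} {T : D ⥤ D} {Δ : Set (Tri T)}

theorem AdmissibleData.translation_lam (A : AdmissibleData b Δ) (X : EquivObj b) (g : G) :
    ((A.translation.obj X).lam g).hom = (A.θ g).hom.app X.obj ≫ T.map (X.lam g).hom := rfl

theorem AdmissibleData.θ_naturality (A : AdmissibleData b Δ) (g : G) {X Y : D} (f : X ⟶ Y) :
    (b.F g).map (T.map f) ≫ (A.θ g).hom.app Y = (A.θ g).hom.app X ≫ T.map ((b.F g).map f) :=
  (A.θ g).hom.naturality f

theorem AdmissibleData.θ_inv_naturality (A : AdmissibleData b Δ) (g : G) {X Y : D} (f : X ⟶ Y) :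
    T.map ((b.F g).map f) ≫ (A.θ g).inv.app Y = (A.θ g).inv.app X ≫ (b.F g).map (T.map f) :=
  (A.θ g).inv.naturality f

/-- A preimage of `Y.obj` under `T` receives its equivariant structure through `θ` and full
faithfulness of `T`; the cocycle identity is checked after applying `T`, where it follows from the
equivariance of `T`. -/
theorem AdmissibleData.translation_essSurj (A : AdmissibleData b Δ) (hT : T.IsEquivalence) :
    A.translation.EssSurj where
  mem_essImage Y := by
    let e := T.objObjPreimageIso Y.obj
    let l (g : G) : T.obj ((b.F g).obj (T.objPreimage Y.obj)) ≅ T.obj (T.objPreimage Y.obj) :=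
      ((A.θ g).app _).symm ≪≫ (b.F g).mapIso e ≪≫ Y.lam g ≪≫ e.symm
    have hl : ∀ g, T.map (T.preimage (l g).hom) ≫ e.hom =
        (A.θ g).inv.app _ ≫ (b.F g).map e.hom ≫ (Y.lam g).hom := fun g => by
      rw [T.map_preimage]; simp [l]
    let X : EquivObj b :=
      { obj := T.objPreimage Y.obj
        lam := fun g => T.preimageIso (l g)
        lam_mul := fun g h k e' => by
          apply T.map_injective
          rw [← cancel_mono e.hom]
          have h1 := A.equivariant.comp g h k e' (T.objPreimage Y.obj)
          change (A.θ g).inv.app ((b.F h).obj (T.objPreimage Y.obj)) ≫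
            (b.F g).map ((A.θ h).inv.app (T.objPreimage Y.obj)) ≫ _ = _ ≫ (A.θ k).inv.app _ at h1
          change T.map ((b.F g).map (T.preimage (l h).hom) ≫ T.preimage (l g).hom) ≫ e.hom =
            T.map (_ ≫ T.preimage (l k).hom) ≫ e.hom
          rw [Functor.map_comp_assoc, hl, Functor.map_comp_assoc, hl,
            reassoc_of% (A.θ_inv_naturality g), ← Functor.map_comp_assoc, hl, ← reassoc_of% h1,
            ← reassoc_of% (b.δ_naturality g h k e' e.hom), Functor.map_comp_assoc,
            Functor.map_comp_assoc, Y.lam_mul g h k e'] }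
    let i : A.translation.obj X ⟶ Y := EquivObj.homMk (X := A.translation.obj X) e.hom (fun g => by
      have := hl g
      change _ = ((A.θ g).hom.app _ ≫ T.map (T.preimage (l g).hom)) ≫ e.hom
      rw [Category.assoc, this, Iso.hom_inv_id_app_assoc]
      rfl)
    have : IsIso i := EquivObj.isIso_of_isIso_hom _ (inferInstance : IsIso e.hom)
    exact ⟨X, ⟨asIso i⟩⟩

theorem AdmissibleData.translation_isEquivalence (A : AdmissibleData b Δ) (hT : T.IsEquivalence) :
    A.translation.IsEquivalence where
  faithful := ⟨fun h => EquivObj.hom_ext (T.map_injective (congrArg EquivHom.hom h))⟩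
  full := ⟨fun {X Y} f => by
    have hf := T.map_preimage (X := X.obj) (Y := Y.obj) f.hom
    refine ⟨EquivObj.homMk (T.preimage f.hom) (fun g => T.map_injective ?_),
      EquivObj.hom_ext hf⟩
    have h1 := EquivObj.comm f g
    rw [A.translation_lam, A.translation_lam] at h1
    rw [← cancel_epi ((A.θ g).hom.app X.obj), Functor.map_comp, ← reassoc_of% (A.θ_naturality g),
      Functor.map_comp, hf]
    exact h1.trans (Category.assoc _ _ _)⟩
  essSurj := A.translation_essSurj hT

/-- The underlying triangle of a triangle of equivariant objects. -/
abbrev AdmissibleData.underlying (A : AdmissibleData b Δ) (t : Tri A.translation) : Tri T :=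
  Tri.mk (T := T) t.f.hom t.g.hom t.h.hom

variable {A : AdmissibleData b Δ}

theorem Tri.IsHom.underlying {t t' : Tri A.translation} {f : t.X ⟶ t'.X} {g : t.Y ⟶ t'.Y}
    {h : t.Z ⟶ t'.Z} (H : t.IsHom t' f g h) :
    (A.underlying t).IsHom (A.underlying t') f.hom g.hom h.hom :=
  ⟨congrArg EquivHom.hom H.comm₁, congrArg EquivHom.hom H.comm₂, congrArg EquivHom.hom H.comm₃⟩

theorem Tri.Isomorphic.underlying {t t' : Tri A.translation} (h : t.Isomorphic t') :
    (A.underlying t).Isomorphic (A.underlying t') := by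
  obtain ⟨f, g, h, H⟩ := h.exists_isHom
  exact H.underlying.isomorphic (inferInstanceAs (IsIso ((forget b).map f.hom)))
    (inferInstanceAs (IsIso ((forget b).map g.hom)))
    (inferInstanceAs (IsIso ((forget b).map h.hom)))


theorem mem_canonicalTriangles {t : Tri A.translation} :
    t ∈ canonicalTriangles A ↔ A.underlying t ∈ Δ := Iff.rfl

theorem AdmissibleData.forget_triangle (t : Tri A.translation) :
    Tri.mk (T := T) ((forget b).map t.f) ((forget b).map t.g)
      ((forget b).map t.h ≫ A.forgetIso.hom.app t.X) = A.underlying t :=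
  congrArg (Tri.mk (T := T) t.f.hom t.g.hom) (Category.comp_id _)

/-- Idempotents lift along square zero ideals. -/
theorem idempotent_lift {C : Type u} [Category.{v} C] [Preadditive C] {X : C} (x : X ⟶ X)
    (h : (x ≫ x - x) ≫ (x ≫ x - x) = 0) :
    (3 • (x ≫ x) - 2 • (x ≫ x ≫ x)) ≫ (3 • (x ≫ x) - 2 • (x ≫ x ≫ x)) =
      3 • (x ≫ x) - 2 • (x ≫ x ≫ x) := by
  let y : End X := x
  have h1 : (y * y - y) * (y * y - y) = 0 := h
  -- With $e=3y^2-2y^3$ one has $e^2-e=(4y^2-4y-3)(y^2-y)^2$.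
  have h2 : (3 • (y * y) - 2 • (y * y * y)) * (3 • (y * y) - 2 • (y * y * y)) -
      (3 • (y * y) - 2 • (y * y * y)) = (4 * y * y - 4 * y - 3) * ((y * y - y) * (y * y - y)) := by
    noncomm_ring
  rw [h1, mul_zero, sub_eq_zero] at h2
  exact h2

end EquivariantTriangles

/-! ### Idempotent endomorphisms of exact triangles -/

section Pretriangulated

variable {D : Type u} [Category.{v} D] [Preadditive D] {T : D ⥤ D} {Δ : Set (Tri T)}

/-- An endomorphism of a coexact triangle which vanishes on the first two terms has square zero. -/
theorem Tri.CoExact.comp_eq_zero {t : Tri T} (ht : t.CoExact) {n : t.Z ⟶ t.Z} (h₁ : t.g ≫ n = 0)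
    (h₂ : n ≫ t.h = 0) : n ≫ n = 0 := by
  obtain ⟨l, hl⟩ := ht.exists_TX n h₁
  calc n ≫ n = n ≫ t.h ≫ l := by rw [hl]
    _ = 0 := by rw [reassoc_of% h₂, zero_comp]

/-- If an idempotent endomorphism of an exact triangle is split on the first two terms, then it is
split on the third term by the cone of the summand. -/
theorem IsPretriangulatedStructure.exists_splitting (hT : IsPretriangulatedStructure T Δ)
    {t t' : Tri T} (ht : t ∈ Δ) (ht' : t' ∈ Δ) {a : t.X ⟶ t'.X} {a' : t'.X ⟶ t.X} {b : t.Y ⟶ t'.Y}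
    {b' : t'.Y ⟶ t.Y} (ha : a ≫ a' = 𝟙 _) (hb : b ≫ b' = 𝟙 _) (h : t.f ≫ b = a ≫ t'.f)
    (h' : t'.f ≫ b' = a' ≫ t.f) {e : t'.Z ⟶ t'.Z} (he : t'.IsHom t' (a' ≫ a) (b' ≫ b) e)
    (hee : e ≫ e = e) : ∃ (i : t.Z ⟶ t'.Z) (p : t'.Z ⟶ t.Z), i ≫ p = 𝟙 _ ∧ p ≫ i = e ∧
      t.IsHom t' a b i ∧ t'.IsHom t a' b' p := by
  obtain ⟨i₀, hi₀⟩ := hT.exists_isHom ht ht' a b h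
  obtain ⟨p₀, hp₀⟩ := hT.exists_isHom ht' ht a' b' h'
  -- Fill-ins `i₀`, `p₀` are cut down by `e`. Their composite on `t.Z` is invertible by the five
  -- lemma, and `p` is normalized by its inverse.
  have hi : t.IsHom t' a b (i₀ ≫ e) := by
    have := hi₀.comp he
    rwa [reassoc_of% ha, reassoc_of% hb] at this
  have hp : t'.IsHom t a' b' (e ≫ p₀) := by
    have := he.comp hp₀
    rwa [Category.assoc, Category.assoc, ha, hb, Category.comp_id, Category.comp_id] at this
  have hu : t.IsHom t (𝟙 _) (𝟙 _) (i₀ ≫ e ≫ p₀) := by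
    have := hi₀.comp hp
    rwa [ha, hb] at this
  have : IsIso (i₀ ≫ e ≫ p₀) := hT.isIso ht ht hu inferInstance inferInstance
  have hu' : t.IsHom t (𝟙 _) (𝟙 _) (inv (i₀ ≫ e ≫ p₀)) :=
    Tri.IsHom.symm (a := Iso.refl _) (b := Iso.refl _) (c := asIso (i₀ ≫ e ≫ p₀)) hu
  have hp' : t'.IsHom t a' b' (e ≫ p₀ ≫ inv (i₀ ≫ e ≫ p₀)) := by
    have := hp.comp hu'
    rwa [Category.comp_id, Category.comp_id, Category.assoc] at this
  have ip : (i₀ ≫ e) ≫ e ≫ p₀ ≫ inv (i₀ ≫ e ≫ p₀) = 𝟙 _ := by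
    rw [Category.assoc, reassoc_of% hee]
    simpa only [Category.assoc] using IsIso.hom_inv_id (i₀ ≫ e ≫ p₀)
  obtain ⟨i, hi', hie⟩ : ∃ i, i = i₀ ≫ e ∧ i ≫ e = i := ⟨_, rfl, by rw [Category.assoc, hee]⟩
  obtain ⟨p, hp'', hep⟩ : ∃ p, p = e ≫ p₀ ≫ inv (i₀ ≫ e ≫ p₀) ∧ e ≫ p = p :=
    ⟨_, rfl, by rw [reassoc_of% hee]⟩
  rw [← hi'] at ip hi
  rw [← hp''] at ip hp'
  refine ⟨i, p, ip, ?_, hi, hp'⟩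
  have hpi := hp'.comp hi
  -- `e - p ≫ i` is idempotent, and its square is zero because it vanishes against `t'.g` and
  -- `t'.h`; so it is zero.
  have hd : (e - p ≫ i) ≫ (e - p ≫ i) = e - p ≫ i := by
    simp only [Preadditive.comp_sub, Preadditive.sub_comp, Category.assoc, hee, hie,
      reassoc_of% hep, reassoc_of% ip]
    abel
  have hd' := (hT.coExact ht').comp_eq_zero (n := e - p ≫ i)
    (by rw [Preadditive.comp_sub, he.comm₂, hpi.comm₂, sub_self])
    (by rw [Preadditive.sub_comp, ← he.comm₃, ← hpi.comm₃, sub_self])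
  rw [hd, sub_eq_zero] at hd'
  exact hd'.symm

end Pretriangulated

/-! ### Canonical triangles: fill-ins, cones and uniqueness -/

section Canonical

variable {G : Type w} [Group G] {D : Type u} [Category.{v} D] [Preadditive D]
  [HasFiniteBiproducts D] {b : RightAction G D} {T : D ⥤ D} {Δ : Set (Tri T)}
  {A : AdmissibleData b Δ}

/-- The average of a fill-in of the underlying triangles is again a fill-in, since the other
morphisms are equivariant. -/
theorem canonicalTriangles_exists_isHom [Finite G] (hG : InvertibleIn (Nat.card G) D)
    (hT : IsPretriangulatedStructure T Δ)
    {t t' : Tri A.translation} (ht : t ∈ canonicalTriangles A) (ht' : t' ∈ canonicalTriangles A)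
    (f : t.X ⟶ t'.X) (g : t.Y ⟶ t'.Y) (h : t.f ≫ g = f ≫ t'.f) :
    ∃ k : t.Z ⟶ t'.Z, t.IsHom t' f g k := by
  obtain ⟨k, hk⟩ := hT.exists_isHom (t := A.underlying t) (t' := A.underlying t') ht ht' f.hom g.hom
    (congrArg EquivHom.hom h)
  have h₂ : t.g.hom ≫ k = (g ≫ t'.g).hom := hk.comm₂
  have h₃ : (t.h ≫ A.translation.map f).hom = k ≫ t'.h.hom := hk.comm₃
  refine ⟨average hG k, h, ?_, ?_⟩
  · rw [← average_comp, h₂, average_hom]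
  · rw [← comp_average, ← h₃, average_hom]

/-- For a fill-in `k` the defect `k ≫ k - k` vanishes against `t.g` and `t.h`, so its square is
zero. The polynomial $3k^2-2k^3$ is then idempotent, and it is still a fill-in because its
coefficients add up to one. -/
theorem canonicalTriangles_exists_idempotent [Finite G] (hG : InvertibleIn (Nat.card G) D)
    (hT : IsPretriangulatedStructure T Δ)
    {t : Tri A.translation} (ht : t ∈ canonicalTriangles A)
    {f : t.X ⟶ t.X} {g : t.Y ⟶ t.Y} (hf : f ≫ f = f) (hg : g ≫ g = g) (h : t.f ≫ g = f ≫ t.f) :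
    ∃ k : t.Z ⟶ t.Z, k ≫ k = k ∧ t.IsHom t f g k := by
  obtain ⟨k, hk⟩ := canonicalTriangles_exists_isHom hG hT ht ht f g h
  have e₂ := hk.comm₂
  have e₃ := hk.comm₃
  have e₂' : t.g ≫ k ≫ k = g ≫ t.g := by rw [reassoc_of% e₂, e₂, reassoc_of% hg]
  have e₂'' : t.g ≫ k ≫ k ≫ k = g ≫ t.g := by rw [reassoc_of% e₂, e₂', reassoc_of% hg]
  have e₃' : k ≫ k ≫ t.h = t.h ≫ A.translation.map f := by
    rw [← e₃, ← reassoc_of% e₃, ← Functor.map_comp, hf]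
  have e₃'' : k ≫ t.h ≫ A.translation.map f = t.h ≫ A.translation.map f := by
    rw [← reassoc_of% e₃, ← Functor.map_comp, hf]
  have hz : (k ≫ k - k) ≫ (k ≫ k - k) = 0 := by
    have h₁ : t.g ≫ (k ≫ k - k) = 0 := by rw [Preadditive.comp_sub, e₂', e₂, sub_self]
    have h₂ : (k ≫ k - k) ≫ t.h = 0 := by
      rw [Preadditive.sub_comp, Category.assoc, e₃', e₃, sub_self]
    exact EquivObj.hom_ext ((hT.coExact ht).comp_eq_zero (n := (k ≫ k - k).hom)
      (congrArg EquivHom.hom h₁) (congrArg EquivHom.hom h₂))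
  refine ⟨_, idempotent_lift k hz, h, ?_, ?_⟩
  · simp only [Preadditive.comp_sub, Preadditive.comp_nsmul, e₂', e₂'']
    abel
  · simp only [Preadditive.sub_comp, Preadditive.nsmul_comp, Category.assoc, e₃', e₃'']
    abel

/-- The idempotent pair that cuts `f` out of `t.f` extends to an equivariant idempotent of `t.Z`. It
splits in `D`, with the cone of `f.hom` as image, and this image carries the induced equivariant
structure. -/
theorem canonicalTriangles_exists_cone [Finite G] (hG : InvertibleIn (Nat.card G) D)
    (hT : IsPretriangulatedStructure T Δ) {X Y : EquivObj b} (f : X ⟶ Y)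
    {t : Tri A.translation} (ht : t ∈ canonicalTriangles A) {s : X ⟶ t.X} {r : t.X ⟶ X}
    {s' : Y ⟶ t.Y} {r' : t.Y ⟶ Y} (h : s ≫ r = 𝟙 X) (h' : s' ≫ r' = 𝟙 Y) (hs : f ≫ s' = s ≫ t.f)
    (hr : t.f ≫ r' = r ≫ f) : ∃ (Z : EquivObj b) (g : Y ⟶ Z) (k : Z ⟶ A.translation.obj X),
      Tri.mk f g k ∈ canonicalTriangles A := by
  obtain ⟨e, he, He⟩ := canonicalTriangles_exists_idempotent hG hT ht (f := r ≫ s) (g := r' ≫ s')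
    (by rw [Category.assoc, reassoc_of% h]) (by rw [Category.assoc, reassoc_of% h'])
    (by rw [reassoc_of% hr, hs, Category.assoc])
  obtain ⟨U, g₀, h₀, hm⟩ := hT.exists_cone f.hom
  obtain ⟨i, p, ip, pi, Hi, Hp⟩ := hT.exists_splitting hm ht (congrArg EquivHom.hom h)
    (congrArg EquivHom.hom h') (congrArg EquivHom.hom hs) (congrArg EquivHom.hom hr) He.underlying
    (congrArg EquivHom.hom he)
  refine ⟨EquivObj.summand e i p ip pi, s' ≫ t.g ≫ EquivObj.summandπ e i p ip pi,
    EquivObj.summandι e i p ip pi ≫ t.h ≫ A.translation.map r, ?_⟩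
  have h₁ : s'.hom ≫ t.g.hom ≫ p = g₀ := by
    have e₁ : t.g.hom ≫ p = r'.hom ≫ g₀ := Hp.comm₂
    have e₂ : s'.hom ≫ r'.hom = 𝟙 _ := congrArg EquivHom.hom h'
    rw [e₁, reassoc_of% e₂]
  have h₂ : i ≫ t.h.hom ≫ T.map r.hom = h₀ := by
    have e₁ : h₀ ≫ T.map s.hom = i ≫ t.h.hom := Hi.comm₃
    have e₂ : s.hom ≫ r.hom = 𝟙 _ := congrArg EquivHom.hom h
    refine (Category.assoc _ _ _).symm.trans
      ((congrArg (fun k => k ≫ T.map r.hom) e₁.symm).trans ?_)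
    dsimp only
    rw [Category.assoc, ← T.map_comp, e₂, T.map_id, Category.comp_id]
  have hm' : Tri.mk (T := T) f.hom (s'.hom ≫ t.g.hom ≫ p) (i ≫ t.h.hom ≫ T.map r.hom) ∈ Δ := by
    rw [h₁, h₂]; exact hm
  exact hm'

/-- The canonical triangles form a pretriangulated structure, provided that each morphism is a
retract of a morphism which has a cone. -/
theorem canonicalTriangles_isPretriangulated [Finite G] (hG : InvertibleIn (Nat.card G) D)
    (hT : IsPretriangulatedStructure T Δ)
    (hcone : ∀ ⦃X Y : EquivObj b⦄ (f : X ⟶ Y), ∃ (Z : EquivObj b) (g : Y ⟶ Z)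
      (k : Z ⟶ A.translation.obj X), Tri.mk f g k ∈ canonicalTriangles A) :
    IsPretriangulatedStructure A.translation (canonicalTriangles A) where
  hasFiniteBiproducts := inferInstance
  isEquivalence := A.translation_isEquivalence hT.isEquivalence
  additive := ⟨fun {X Y f g} => by
    have := hT.additive
    exact EquivObj.hom_ext T.map_add⟩
  of_isomorphic t t' h ht := hT.of_isomorphic _ _ h.underlying ht
  contractible X Z hZ := hT.contractible X.obj Z.obj ((forget b).map_isZero hZ)
  exists_cone := hcone
  rotate_iff t := hT.rotate_iff (A.underlying t)
  complete t t' ht ht' f g h := by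
    obtain ⟨k, hk⟩ := canonicalTriangles_exists_isHom hG hT ht ht' f g h
    exact ⟨k, hk.comm₂, hk.comm₃⟩

theorem forget_isExact : IsExactFunctor (canonicalTriangles A) Δ (forget b) A.forgetIso where
  additive := inferInstance
  map_mem t ht := (AdmissibleData.forget_triangle t).symm ▸ ht

/-- Exactness of the forgetful functor gives one inclusion. Conversely, a canonical triangle is
isomorphic, by the five lemma, to the cone of its first morphism taken in `Γ`. -/
theorem AdmissibleData.IsCanonical.eq_canonicalTriangles {Γ : Set (Tri A.translation)}
    (h : A.IsCanonical Γ) (hT : IsPretriangulatedStructure A.translation (canonicalTriangles A)) :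
    Γ = canonicalTriangles A := by
  have hΓ : Γ ⊆ canonicalTriangles A := fun t ht =>
    mem_canonicalTriangles.2 <| AdmissibleData.forget_triangle t ▸ h.forget_exact.map_mem t ht
  refine hΓ.antisymm fun t ht => ?_
  obtain ⟨Z, g, k, hm⟩ := h.isTriangulated.exists_cone t.f
  obtain ⟨l, hl⟩ := hT.exists_isHom (hΓ hm) ht (𝟙 _) (𝟙 _)
    ((Category.comp_id _).trans (Category.id_comp _).symm)
  exact h.isTriangulated.of_isomorphic _ _ (hl.isomorphic (inferInstanceAs (IsIso (𝟙 _)))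
    (inferInstanceAs (IsIso (𝟙 _)))
    (hT.isIso (hΓ hm) ht hl (inferInstanceAs (IsIso (𝟙 _))) (inferInstanceAs (IsIso (𝟙 _))))) hm

end Canonical

/-! ### Functors that are dense up to retracts -/

section UpToRetracts

variable {S : Type u'} [Category.{v'} S]

/-- An equivalence up to retracts from an idempotent complete category is an equivalence. -/
theorem IsEquivalenceUpToRetracts.isEquivalence {D : Type u} [Category.{v} D] {K : S ⥤ D}
    (hK : IsEquivalenceUpToRetracts K) [IsIdempotentComplete S] : K.IsEquivalence where
  faithful := hK.faithful
  full := hK.full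
  essSurj := ⟨fun Y => by
    have := hK.full
    have := hK.faithful
    obtain ⟨Z, ⟨X, ⟨e⟩⟩, ⟨R⟩⟩ := hK.dense Y
    -- The idempotent of `K.obj X` with image `Y` lifts to an idempotent `q` of `X`; the functor
    -- sends a splitting of `q` to an object isomorphic to `Y`.
    obtain ⟨q, hq⟩ := K.map_surjective (e.hom ≫ R.r ≫ R.i ≫ e.inv)
    obtain ⟨Y', i, p, ip, pi⟩ := IsIdempotentComplete.idempotents_split X q (K.map_injective (by
      rw [K.map_comp, hq]; simp))
    have h₁ : K.map p ≫ K.map i = e.hom ≫ R.r ≫ R.i ≫ e.inv := by rw [← K.map_comp, pi, hq]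
    have h₂ : K.map i ≫ K.map p = 𝟙 _ := by rw [← K.map_comp, ip, K.map_id]
    refine ⟨Y', ⟨⟨K.map i ≫ e.hom ≫ R.r, R.i ≫ e.inv ≫ K.map p, ?_, ?_⟩⟩⟩
    · have : K.map i ≫ (K.map p ≫ K.map i) ≫ K.map p = 𝟙 _ := by
        rw [Category.assoc, reassoc_of% h₂, h₂]
      rw [h₁] at this
      simpa using this
    · have : R.i ≫ e.inv ≫ (K.map p ≫ K.map i) ≫ e.hom ≫ R.r = 𝟙 _ := by
        rw [h₁]; simp
      simpa using this⟩

variable [Preadditive S] {D : Type u} [Category.{v} D] [Preadditive D] {T' : S ⥤ S}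
  {Δ' : Set (Tri T')} {T : D ⥤ D} {Δ : Set (Tri T)} {K : S ⥤ D} {ξ : T' ⋙ K ≅ K ⋙ T}

/-- The image of one octahedron is an octahedron, and `HasOctahedron.of_exists` extends this to all
choices of cones, including those outside the image. -/
theorem IsExactFunctor.hasOctahedron (hK : IsExactFunctor Δ' Δ K ξ)
    (hS : IsTriangulatedStructure T' Δ') (hT : IsPretriangulatedStructure T Δ) {X₁ X₂ X₃ : S}
    (f : X₁ ⟶ X₂) (g : X₂ ⟶ X₃) : HasOctahedron Δ (K.map f) (K.map g) := by
  have nat : ∀ {X Y : S} (k : X ⟶ Y), K.map (T'.map k) ≫ ξ.hom.app Y =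
    ξ.hom.app X ≫ T.map (K.map k) := fun k => ξ.hom.naturality k
  obtain ⟨Z₁₂, v₁₂, w₁₂, h₁₂⟩ := hS.exists_cone f
  obtain ⟨Z₂₃, v₂₃, w₂₃, h₂₃⟩ := hS.exists_cone g
  obtain ⟨Z₁₃, v₁₃, w₁₃, h₁₃⟩ := hS.exists_cone (f ≫ g)
  obtain ⟨m₁, m₃, e₁, e₂, e₃, e₄, hm⟩ := hS.octahedron _ _ _ _ _ _ _ _ h₁₂ h₂₃ h₁₃
  have hm' := hK.map_mem _ hm
  have h₁₃' := hK.map_mem _ h₁₃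
  dsimp only at hm' h₁₃'
  rw [K.map_comp, Category.assoc, nat, ← Category.assoc] at hm'
  rw [K.map_comp] at h₁₃'
  refine HasOctahedron.of_exists hT (hK.map_mem _ h₁₂) (hK.map_mem _ h₂₃) h₁₃' (K.map m₁) (K.map m₃)
    ?_ ?_ ?_ ?_ hm'
  · dsimp only
    rw [← K.map_comp, e₁, K.map_comp]
  · dsimp only
    rw [← K.map_comp_assoc, e₂]
  · dsimp only
    rw [← K.map_comp, e₃]
  · dsimp only
    rw [Category.assoc, ← nat, ← K.map_comp_assoc, e₄, K.map_comp_assoc]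

/-- A pretriangulated category which is up to retracts the image of a triangulated category is
triangulated. -/
theorem IsExactFunctor.isTriangulated [HasFiniteBiproducts D] (hK : IsExactFunctor Δ' Δ K ξ)
    (hS : IsTriangulatedStructure T' Δ') (hT : IsPretriangulatedStructure T Δ) [K.Full]
    (dense : ∀ Y : D, ∃ (X : S) (s : Y ⟶ K.obj X) (r : K.obj X ⟶ Y), s ≫ r = 𝟙 Y) :
    IsTriangulatedStructure T Δ := by
  refine hT.isTriangulated fun X₁ X₂ X₃ f g => ?_
  obtain ⟨Y₁, s₁, r₁, h₁⟩ := dense X₁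
  obtain ⟨Y₂, s₂, r₂, h₂⟩ := dense X₂
  obtain ⟨Y₃, s₃, r₃, h₃⟩ := dense X₃
  obtain ⟨C₁, j₁, q₁, b₁⟩ := hT.exists_complement s₁ r₁ h₁
  obtain ⟨C₂, j₂, q₂, b₂⟩ := hT.exists_complement s₂ r₂ h₂
  obtain ⟨C₃, j₃, q₃, b₃⟩ := hT.exists_complement s₃ r₃ h₃
  -- Each of the three objects is replaced by an object in the image of `K` of which it is a
  -- summand. The enlarged morphisms then lift to `S` by fullness.
  refine HasOctahedron.of_thd hT b₃ (HasOctahedron.of_fst hT b₁ (HasOctahedron.of_snd hT b₂ ?_))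
  obtain ⟨f', hf'⟩ := K.map_surjective ((r₁ ≫ f) ≫ s₂)
  obtain ⟨g', hg'⟩ := K.map_surjective (r₂ ≫ g ≫ s₃)
  rw [← hf', ← hg']
  exact hK.hasOctahedron hS hT f' g'

end UpToRetracts

/-! ### The canonical structure on equivariant objects of the stable category -/

section Main

open ExactStructure

attribute [local instance] Fintype.ofFinite

/-- The canonical triangles form a triangulated structure, provided that the category of equivariant
objects is up to retracts the image of a triangulated category. -/
theorem canonicalTriangles_isCanonical {G : Type w} [Group G] [Finite G] {D : Type u}
    [Category.{v} D] [Preadditive D] [HasFiniteBiproducts D] {b : RightAction G D} {T : D ⥤ D}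
    {Δ : Set (Tri T)} {A : AdmissibleData b Δ} (hG : InvertibleIn (Nat.card G) D)
    (hT : IsPretriangulatedStructure T Δ) {S : Type u'} [Category.{v'} S] [Preadditive S]
    {T' : S ⥤ S} {Δ' : Set (Tri T')} (hS : IsTriangulatedStructure T' Δ') {K : S ⥤ EquivObj b}
    {ξ : T' ⋙ K ≅ K ⋙ A.translation} (hK : IsExactFunctor Δ' (canonicalTriangles A) K ξ) [K.Full]
    (dense : ∀ Y : EquivObj b, ∃ (X : S) (s : Y ⟶ K.obj X) (r : K.obj X ⟶ Y), s ≫ r = 𝟙 Y) :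
    A.IsCanonical (canonicalTriangles A) where
  isTriangulated := by
    refine hK.isTriangulated hS (canonicalTriangles_isPretriangulated hG hT fun X Y f => ?_) dense
    obtain ⟨X', s, r, h⟩ := dense X
    obtain ⟨Y', s', r', h'⟩ := dense Y
    obtain ⟨f', hf'⟩ := K.map_surjective (r ≫ f ≫ s')
    obtain ⟨Z, g, k, hm⟩ := hS.exists_cone f'
    refine canonicalTriangles_exists_cone hG hT f (hK.map_mem _ hm) h h' ?_ ?_
    · change f ≫ s' = s ≫ K.map f'
      rw [hf', reassoc_of% h]
    · change K.map f' ≫ r' = r ≫ f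
      rw [hf', Category.assoc, Category.assoc, h', Category.comp_id]
  forget_exact := forget_isExact

variable {G : Type w} [Group G] [Finite G] {C : Type u} [Category.{v} C] [Preadditive C]
  [HasFiniteBiproducts C] {a : RightAction G C} {ex : ExactStructure C}

/-- The canonical functor to the stable category preserves induced equivariant objects. -/
def Induced.stable (ha : a.IsAdmissible ex) {X : C} (I : Induced a X) :
    Induced (stableAction ha) (ex.toStable.obj X) where
  M := (toStableEquiv ha).obj I.M
  i g := ex.toStable.map (I.i g)
  p g := ex.toStable.map (I.p g)
  i_p g := (ex.toStable.map_comp _ _).symm.trans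
    ((congrArg ex.toStable.map (I.i_p g)).trans (ex.toStable.map_id _))
  i_p_ne g h hgh := (ex.toStable.map_comp _ _).symm.trans
    ((congrArg ex.toStable.map (I.i_p_ne g h hgh)).trans (ex.toStable.map_zero _ _))
  total := by
    have h := congrArg ex.toStable.map I.total
    rw [Functor.map_sum, CategoryTheory.Functor.map_id] at h
    simp only [Functor.map_comp] at h
    exact h
  i_lam h g r e := by
    rw [toStableEquiv_lam]
    have h' := congrArg ex.toStable.map (I.i_lam h g r e)
    rw [Functor.map_comp, Functor.map_comp] at h'
    exact h'

/-- `Y` is a retract of the object induced from `Y.obj`, which can be formed before stabilization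
and so comes from an equivariant object of `C`. -/
theorem stableComparison_dense (ha : a.IsAdmissible ex) (hE : ex.IsFrobenius)
    (hG : InvertibleIn (Nat.card G) C) (Y : EquivObj (stableAction ha)) :
    ∃ (X : (equivExact ex a ha).Stable) (s : Y ⟶ (stableComparison ha hE).obj X)
      (r : (stableComparison ha hE).obj X ⟶ Y), s ≫ r = 𝟙 Y := by
  obtain ⟨s, r, h⟩ := Induced.exists_retract (hG.stable ex) (Y := Y)
    ((induced a Y.obj.as).stable ha)
  exact ⟨(equivExact ex a ha).toStable.obj (induced a Y.obj.as).M, s, r, h⟩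

theorem stableComparison_isEquivalenceUpToRetracts (ha : a.IsAdmissible ex) (hE : ex.IsFrobenius)
    (hG : InvertibleIn (Nat.card G) C) : IsEquivalenceUpToRetracts (stableComparison ha hE) where
  full := stableComparison_full ha hE hG
  faithful := stableComparison_faithful ha hE hG
  dense Y := by
    obtain ⟨X, s, r, h⟩ := stableComparison_dense ha hE hG Y
    exact ⟨_, (stableComparison ha hE).obj_mem_essImage X, ⟨⟨s, r, h⟩⟩⟩

end Main

end Equivariantization

end

open Equivariantization in
theorem mainTheorem4 {G : Type*} [Group G] [Finite G] {E : Type*} [Category* E] [Preadditive E]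
    [HasFiniteBiproducts E] (ex : ExactStructure E) (hE : ex.IsFrobenius)
    (a : RightAction G E) (ha : a.IsAdmissible ex) (hG : InvertibleIn (Nat.card G) E) :
    (IsIdempotentComplete E →
      (equivExact ex a ha).EnoughProjectives ∧ (equivExact ex a ha).EnoughInjectives) ∧
    ((equivExact ex a ha).EnoughProjectives → (equivExact ex a ha).EnoughInjectives →
      ∀ (c : ex.Choice) (c' : (equivExact ex a ha).Choice),
        (equivExact ex a ha).IsFrobenius ∧
        IsTriangulatedStructure c.susp c.exactTriangles ∧
        IsTriangulatedStructure c'.susp c'.exactTriangles ∧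
        ∃ A : AdmissibleData (stableAction ha) c.exactTriangles,
          IsInduced ha c A ∧
          ∃ Γ : Set (Tri A.translation),
            A.IsCanonical Γ ∧ (∀ Γ' : Set (Tri A.translation), A.IsCanonical Γ' → Γ' = Γ) ∧
            ∃ K : (equivExact ex a ha).Stable ⥤ EquivObj (stableAction ha),
              (equivExact ex a ha).toStable ⋙ K = toStableEquiv ha ∧
              (∃ ξ : c'.susp ⋙ K ≅ K ⋙ A.translation,
                IsExactFunctor c'.exactTriangles Γ K ξ) ∧
              IsEquivalenceUpToRetracts K ∧
              (IsIdempotentComplete (equivExact ex a ha).Stable → K.IsEquivalence)) := by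
  refine ⟨fun _ => ⟨equivExact_enoughProjectives ha hE hG, equivExact_enoughInjectives ha hE hG⟩,
    fun _ _ c c' => ?_⟩
  have hF := equivExact_isFrobenius ha hE hG
  have hS := ExactStructure.Choice.isTriangulated c' hF
  have hK := stableComparison_isEquivalenceUpToRetracts ha hE hG
  have := hK.full
  -- Exactness, fullness and density of the comparison functor are inputs here: cones and octahedra
  -- are transported along it.
  have hcan : (stableAdmissible ha c).IsCanonical (canonicalTriangles (stableAdmissible ha c)) :=
    canonicalTriangles_isCanonical (hG.stable ex) (ExactStructure.Choice.isPretriangulated hE) hS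
      (stableComparison_isExact ha hE c c') (stableComparison_dense ha hE hG)
  exact ⟨hF, ExactStructure.Choice.isTriangulated c hE, hS, stableAdmissible ha c,
    stableAdmissible_isInduced ha c, canonicalTriangles _, hcan,
    fun Γ' h => h.eq_canonicalTriangles hcan.isTriangulated.toIsPretriangulatedStructure,
    stableComparison ha hE, toStable_stableComparison ha hE,
    ⟨stableComparisonIso ha hE c c', stableComparison_isExact ha hE c c'⟩, hK,
    fun _ => hK.isEquivalence⟩
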